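/- **Setting.** Let $a<b$, $T>0$, and let $u$ be a (classical) solution of $\partial_t u+\partial_x u=0$ on $[a,b]\times[0,T]$, $u(x,0)=u_0(x)$, with either the periodic boundary condition $u(a,t)=u(b,t)$ or the inflow boundary condition $u(a,t)=g(t)$, and suppose that $u(\cdot,t)\in W^{k+3,\infty}(a,b)$ with norm bounded uniformly in $t\in[0,T]$. Let $a=x_{1/2}<\dots<x_{N+1/2}=b$ be a mesh with cells $\tau_i=(x_{i-1/2},x_{i+1/2})$, $h_i=|\tau_i|$, $h=\max_i h_i$, which is shape regular: $h\le\kappa h_i$ for all $i$. Put $x_{i,0}=x_{i-1/2}$, $x_{i,k+1}=x_{i+1/2}$; the points $x_{i,1}<\dots<x_{i,k}$ inside $\tau_i$ are the $k$ Gauss points of $\tau_i$ (OF-LSV) or the $k$ interior zeros of $L_{i,k+1}-L_{i,k}$ (OF-RRSV), where $L_{i,n}$ is the Legendre polynomial of degree $n$ on $\tau_i$; the control volumes are $\tau_{i,j}=(x_{i,j},x_{i,j+1})$, $0\le j\le k$. Let $\mathcal U_h$ be the space of piecewise polynomials of degree $\le k$ on the cells, $P^l$ the cellwise $L^2$ projection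 onto polynomials of degree $\le l$, $P^{-1}=P^0$, and let $u_I\in\mathcal U_h$ interpolate $u$ at $x_{i,j}$, $1\le j\le k+1$. **Scheme.** $u_h(\cdot,t)\in\mathcal U_h$, $t\in[0,T]$, satisfies for all $i,j$ $$\int_{\tau_{i,j}}\partial_t u_h\,dx+u_h(x_{i,j+1}^-)-u_h(x_{i,j}^-)+\sum_{l=0}^k\frac{\sigma_i^l}{h_i}\int_{\tau_{i,j}}(u_h-P^{l-1}u_h)\,dx=0,$$ $$\sigma_i^l=\sigma_i^l(u_h)=\frac{2(2l+1)}{2k-1}\frac{h^l}{l!}\Big([\![\partial_x^l u_h]\!]_{i-1/2}^2+[\![\partial_x^l u_h]\!]_{i+1/2}^2\Big)^{1/2}.$$ In the periodic case traces and jumps at $a$ and $b$ are periodic. In the inflow case the exterior trace of $\partial_x^l u_h$ at $a$ is $(-1)^l g^{(l)}(t)$ (so $u_h(a^-)=g(t)$), and the jump at $b$ is $0$. **Correction function.** For a polynomial $v$ on $\tau_i$ let $v^*$ be constant on each $\tau_{i,j}$ with values $v^*_{i,0}=v(x_{i-1/2}^+)$, $v^*_{i,j}-v^*_{i,j-1}=A_{i,j}v'(x_{i,j})$,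 where $A_{i,j}$ are the weights of the $k$-point Gauss (OF-LSV), respectively the $(k+1)$-point right Radau (OF-RRSV), quadrature on $\tau_i$. The correction function $\omega\in\mathcal U_h$ is defined on each cell by $\omega(x_{i+1/2}^-)=0$ and $$(\omega,v_x)_i=(\partial_t(u-u_I),v^*)_i+\sum_{l=0}^k\frac{\sigma_i^l(u_h)}{h_i}(u_I-P^{l-1}u_I,v^*)_i$$ for all polynomials $v$ of degree $\le k$ with $\int_{\tau_i}v\,dx=0$, where $(f,g)_i=\int_{\tau_i}fg\,dx$. **Theorem (supercloseness).** Let $k\ge1$ for OF-RRSV and $k\ge2$ for OF-LSV. There are constants $C,h_0>0$, depending only on $u$, $k$, $a$, $b$, $T$, $\kappa$, the method and the boundary condition, and not on the mesh, such that for every mesh as above with $h\le h_0$ and every solution $u_h$ of the scheme with corrected initial value $u_h(\cdot,0)=u_I(\cdot,0)-\omega(\cdot,0)$, $$\|(u_I-u_h)(\cdot,t)\|_{L^2(a,b)}\le C h^{k+2}\qquad\text{for all }t\in[0,T].$$ -/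

import Mathlib

namespace OFSV

noncomputable section

open scoped Polynomial

/-! ### The exact problem -/

/-- The two families of control volumes: Gauss points and interior right Radau points. -/
inductive Method where
  | LSV
  | RRSV

/-- Periodic boundary condition, or inflow condition at the left end point. -/
inductive Boundary where
  | periodic
  | inflow

/-- `g` is the weak derivative of order `j` of `f` on `(a, b)`. -/
def HasWeakDeriv (a b : ℝ) (j : ℕ) (f g : ℝ → ℝ) : Prop :=
  ∀ φ : ℝ → ℝ, ContDiff ℝ (⊤ : ℕ∞) φ → HasCompactSupport φ → tsupport φ ⊆ Set.Ioo a b →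
    ∫ x in Set.Ioo a b, f x * iteratedDeriv j φ x =
      (-1) ^ j * ∫ x in Set.Ioo a b, g x * φ x

/-- `f ∈ W^{m,∞}(a, b)`, and `f` and its weak derivatives of order `≤ m` are bounded by `M`
in `L^∞(a, b)`. -/
def SobolevBound (a b : ℝ) (m : ℕ) (M : ℝ) (f : ℝ → ℝ) : Prop :=
  ∃ D : ℕ → ℝ → ℝ, D 0 = f ∧ ∀ j ≤ m,
    MeasureTheory.AEStronglyMeasurable (D j)
      (MeasureTheory.volume.restrict (Set.Ioo a b)) ∧
    MeasureTheory.eLpNorm (D j) ⊤ (MeasureTheory.volume.restrict (Set.Ioo a b))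
      ≤ ENNReal.ofReal M ∧
    HasWeakDeriv a b j f (D j)

/-- `u` solves `∂ₜ u + ∂ₓ u = 0` on `[a, b] × [0, T]` with initial value `u₀`, and with
`u(a, t) = u(b, t)` (periodic) or `u(a, t) = g(t)` (inflow). -/
structure IsSolution (bc : Boundary) (a b T : ℝ) (u₀ g : ℝ → ℝ) (u : ℝ → ℝ → ℝ) : Prop where
  pde : ∀ x ∈ Set.Icc a b, ∀ t ∈ Set.Icc 0 T, ∃ p q : ℝ,
    HasDerivWithinAt (fun s => u x s) p (Set.Icc 0 T) t ∧
    HasDerivWithinAt (fun y => u y t) q (Set.Icc a b) x ∧ p + q = 0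
  initial : ∀ x ∈ Set.Icc a b, u x 0 = u₀ x
  boundary : ∀ t ∈ Set.Icc 0 T,
    match bc with
    | .periodic => u a t = u b t
    | .inflow => u a t = g t

/-! ### Control volumes on the reference cell `[0, 1]` -/

/-- The Legendre polynomial of degree `n` transported from `[-1, 1]` to `[0, 1]`, with value `1`
at the right end point. -/
def legendre (n : ℕ) : ℝ[X] :=
  (-1) ^ n * (Polynomial.shiftedLegendre n).map (Int.castRingHom ℝ)

/-- The polynomial whose zeros in `(0, 1)` are the interior end points of the control volumes. -/
def cvPoly (m : Method) (k : ℕ) : ℝ[X] :=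
  match m with
  | .LSV => legendre k
  | .RRSV => legendre (k + 1) - legendre k

/-- `c` lists in increasing order `0`, the `k` zeros of `cvPoly m k` in `(0, 1)`, and `1`. This
determines `c`. -/
structure IsCVNodes (m : Method) (k : ℕ) (c : Fin (k + 2) → ℝ) : Prop where
  strictMono : StrictMono c
  first : c 0 = 0
  last : c (Fin.last (k + 1)) = 1
  zero : ∀ j : Fin k, (cvPoly m k).eval (c j.castSucc.succ) = 0

/-- Indices of the quadrature nodes: the `k` Gauss points, or the `k + 1` right Radau points
(the right end point included). -/
def quadIdx (m : Method) (k : ℕ) : Finset (Fin (k + 2)) :=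
  match m with
  | .LSV => Finset.univ.filter fun j => j ≠ 0 ∧ j ≠ Fin.last (k + 1)
  | .RRSV => Finset.univ.filter fun j => j ≠ 0

/-- The weight at the node `c j` of the (interpolatory) Gauss or right Radau quadrature on
`[0, 1]`. -/
def refWeight (m : Method) (k : ℕ) (c : Fin (k + 2) → ℝ) (j : Fin (k + 2)) : ℝ :=
  ∫ s in (0 : ℝ)..1, (Lagrange.basis (quadIdx m k) c j).eval s

/-! ### The `L²` projection onto polynomials on one cell -/

/-- `q` is the `L²(α, β)`-orthogonal projection of `p` onto polynomials of degree `≤ l`. -/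
def IsL2Proj (α β : ℝ) (l : ℕ) (p q : ℝ[X]) : Prop :=
  q.natDegree ≤ l ∧ ∀ r : ℝ[X], r.natDegree ≤ l →
    ∫ x in α..β, (p.eval x - q.eval x) * r.eval x = 0

open Classical in
/-- The `L²(α, β)`-orthogonal projection of `p` onto polynomials of degree `≤ l`. -/
def l2Proj (α β : ℝ) (l : ℕ) (p : ℝ[X]) : ℝ[X] :=
  if h : ∃ q, IsL2Proj α β l p q then h.choose else 0

theorem eq_zero_of_integral_sq {α β : ℝ} (h : α < β) (q : ℝ[X])
    (hq : ∫ x in α..β, q.eval x * q.eval x = 0) : q = 0 := by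
  by_contra hne
  have hc : ∃ c ∈ Set.Icc α β, q.eval c ≠ 0 := by
    by_contra hcon
    push Not at hcon
    exact hne (Polynomial.eq_zero_of_infinite_isRoot q
      ((Set.Icc_infinite h).mono fun x hx => hcon x hx))
  obtain ⟨c, hc, hc0⟩ := hc
  have := intervalIntegral.integral_pos (f := fun x => q.eval x * q.eval x) h
    (by fun_prop) (fun x _ => mul_self_nonneg _) ⟨c, hc, mul_self_pos.mpr hc0⟩
  exact this.ne' hq

/-- The projection exists. -/
theorem exists_isL2Proj {α β : ℝ} (h : α < β) (l : ℕ) (p : ℝ[X]) :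
    ∃ q, IsL2Proj α β l p q := by
  have hint : ∀ s : ℝ[X], IntervalIntegrable (fun x => s.eval x) MeasureTheory.volume α β :=
    fun s => (by fun_prop : Continuous fun x => s.eval x).intervalIntegrable _ _
  let I : ℝ[X] →ₗ[ℝ] ℝ :=
    { toFun := fun s => ∫ x in α..β, s.eval x
      map_add' := fun s t => by
        simp only [Polynomial.eval_add]
        exact intervalIntegral.integral_add (hint s) (hint t)
      map_smul' := fun c s => by simp }
  let V := Polynomial.degreeLT ℝ (l + 1)
  let B : ℝ[X] →ₗ[ℝ] Module.Dual ℝ V :=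
    (LinearMap.lcomp ℝ ℝ V.subtype).comp ((LinearMap.llcomp ℝ _ _ _ I).comp (LinearMap.mul ℝ ℝ[X]))
  have hB : ∀ s (r : V), B s r = ∫ x in α..β, s.eval x * (r : ℝ[X]).eval x := fun s r => by
    simp [B, I]
  have : FiniteDimensional ℝ V := Module.Finite.equiv (Polynomial.degreeLTEquiv ℝ (l + 1)).symm
  have hinj : Function.Injective (B.comp V.subtype) := by
    rw [injective_iff_map_eq_zero]
    intro q hq
    have h1 : B q q = 0 := by
      have := LinearMap.congr_fun hq q
      simpa using this
    rw [hB] at h1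
    exact Subtype.ext (eq_zero_of_integral_sq h _ h1)
  have hsurj := (LinearMap.injective_iff_surjective_of_finrank_eq_finrank
    (Subspace.dual_finrank_eq (K := ℝ) (V := V)).symm).mp hinj
  have hdeg : ∀ r : ℝ[X], r ∈ V ↔ r.natDegree ≤ l := fun r => by
    rw [Polynomial.mem_degreeLT, Polynomial.natDegree_le_iff_degree_le,
      Polynomial.degree_lt_iff_coeff_zero, Polynomial.degree_le_iff_coeff_zero]
    simp only [Nat.cast_lt, Nat.succ_le_iff]
  obtain ⟨q, hq⟩ := hsurj (B p)
  refine ⟨q, (hdeg _).1 q.2, fun r hr => ?_⟩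
  have h2 := LinearMap.congr_fun hq ⟨r, (hdeg r).2 hr⟩
  have h3 : B (p - q) ⟨r, (hdeg r).2 hr⟩ = 0 := by
    rw [map_sub, LinearMap.sub_apply, ← h2]
    simp
  rw [hB] at h3
  simpa using h3

/-- The projection is unique. -/
theorem IsL2Proj.unique {α β : ℝ} (h : α < β) {l : ℕ} {p q q' : ℝ[X]}
    (hq : IsL2Proj α β l p q) (hq' : IsL2Proj α β l p q') : q = q' := by
  have hd : (q' - q).natDegree ≤ l := (Polynomial.natDegree_sub_le _ _).trans
    (max_le hq'.1 hq.1)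
  have hi : ∀ s : ℝ[X], IntervalIntegrable
      (fun x => (p.eval x - s.eval x) * (q' - q).eval x) MeasureTheory.volume α β :=
    fun s => Continuous.intervalIntegrable (by fun_prop) _ _
  refine (sub_eq_zero.mp (eq_zero_of_integral_sq h (q' - q) ?_)).symm
  have := intervalIntegral.integral_sub (hi q) (hi q')
  rw [hq.2 _ hd, hq'.2 _ hd, sub_zero] at this
  rw [← this]
  refine intervalIntegral.integral_congr fun x _ => ?_
  simp only [Polynomial.eval_sub]
  ring

theorem l2Proj_spec {α β : ℝ} (h : α < β) (l : ℕ) (p : ℝ[X]) :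
    IsL2Proj α β l p (l2Proj α β l p) := by
  rw [l2Proj, dif_pos (exists_isL2Proj h l p)]
  exact (exists_isL2Proj h l p).choose_spec

/-! ### Meshes -/

/-- A partition of `[a, b]` into the `N` cells (spectral volumes) `(node i, node (i + 1))`. -/
structure Mesh (a b : ℝ) (N : ℕ) where
  node : Fin (N + 1) → ℝ
  strictMono : StrictMono node
  first : node 0 = a
  last : node (Fin.last N) = b

variable {a b : ℝ} {N : ℕ}

/-- The left end point of cell `i`. -/
def Mesh.left (M : Mesh a b N) (i : Fin N) : ℝ := M.node i.castSucc

/-- The right end point of cell `i`. -/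
def Mesh.right (M : Mesh a b N) (i : Fin N) : ℝ := M.node i.succ

/-- The length `h_i` of cell `i`. -/
def Mesh.len (M : Mesh a b N) (i : Fin N) : ℝ := M.right i - M.left i

/-- The mesh size `h`, the largest cell length. -/
def Mesh.h (M : Mesh a b N) : ℝ := ⨆ i, M.len i

/-- Shape regularity: `h ≤ κ h_i` for every cell. -/
def Mesh.ShapeRegular (M : Mesh a b N) (κ : ℝ) : Prop := ∀ i, M.h ≤ κ * M.len i

/-- The points `x_{i,j}`, `0 ≤ j ≤ k + 1`, that cut cell `i` into the `k + 1` control volumes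
`(x_{i,j}, x_{i,j+1})`. -/
def Mesh.pt {k : ℕ} (M : Mesh a b N) (c : Fin (k + 2) → ℝ) (i : Fin N) (j : Fin (k + 2)) : ℝ :=
  M.left i + M.len i * c j

/-! ### The scheme. A piecewise polynomial is the family of its pieces `w : Fin N → ℝ[X]`. -/

/-- The Lagrange interpolant of `v` of degree `≤ k` on cell `i`, at the points `x_{i,j}`,
`1 ≤ j ≤ k + 1`. -/
def Mesh.interp {k : ℕ} (M : Mesh a b N) (c : Fin (k + 2) → ℝ) (v : ℝ → ℝ) (i : Fin N) : ℝ[X] :=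
  Lagrange.interpolate Finset.univ (fun j : Fin (k + 1) => M.pt c i j.succ)
    (fun j => v (M.pt c i j.succ))

/-- The broken `L²` norm of a piecewise polynomial. -/
def Mesh.l2norm (M : Mesh a b N) (w : Fin N → ℝ[X]) : ℝ :=
  Real.sqrt (∑ i, ∫ x in (M.left i)..(M.right i), (w i).eval x ^ 2)

/-- The value on the control volume `(x_{i,j}, x_{i,j+1})` of the piecewise constant `v*` that the
trial-to-test map assigns to `v`: `v*_{i,0} = v(x_{i-1/2}⁺)` and
`v*_{i,j} - v*_{i,j-1} = A_{i,j} v'(x_{i,j})`, with the quadrature weights `A_{i,j}` of cell `i`. -/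
def Mesh.starVal {k : ℕ} (M : Mesh a b N) (m : Method) (c : Fin (k + 2) → ℝ) (v : ℝ[X])
    (i : Fin N) (j : Fin (k + 1)) : ℝ :=
  v.eval (M.left i) +
    ∑ r ∈ Finset.univ.filter (fun r : Fin (k + 2) => r ≠ 0 ∧ r ≤ j.castSucc),
      M.len i * refWeight m k c r * v.derivative.eval (M.pt c i r)

variable [NeZero N]

/-- The trace from the left of `∂ₓˡ w` at the left end point of cell `i`. It is taken from the
preceding cell (cyclically: `i - 1` is taken in `Fin N`), except at the inflow point, where it is
the boundary datum `ext l`. -/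
def Mesh.upTrace (M : Mesh a b N) (bc : Boundary) (ext : ℕ → ℝ) (w : Fin N → ℝ[X])
    (l : ℕ) (i : Fin N) : ℝ :=
  match bc with
  | .periodic => (Polynomial.derivative^[l] (w (i - 1))).eval (M.right (i - 1))
  | .inflow =>
    if i = 0 then ext l else (Polynomial.derivative^[l] (w (i - 1))).eval (M.right (i - 1))

/-- The jump of `∂ₓˡ w` at the left end point of cell `i`. -/
def Mesh.leftJump (M : Mesh a b N) (bc : Boundary) (ext : ℕ → ℝ) (w : Fin N → ℝ[X])
    (l : ℕ) (i : Fin N) : ℝ :=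
  (Polynomial.derivative^[l] (w i)).eval (M.left i) - M.upTrace bc ext w l i

/-- The jump of `∂ₓˡ w` at the right end point of cell `i`, that is, at the left end point of the
next cell. In the inflow problem nothing is prescribed at the outflow point `b`, and there is no
jump there. -/
def Mesh.rightJump (M : Mesh a b N) (bc : Boundary) (ext : ℕ → ℝ) (w : Fin N → ℝ[X])
    (l : ℕ) (i : Fin N) : ℝ :=
  match bc with
  | .periodic => M.leftJump bc ext w l (i + 1)
  | .inflow => if i + 1 = 0 then 0 else M.leftJump bc ext w l (i + 1)

/-- The damping coefficient `σ_i^l` computed from `w`. -/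
def Mesh.sigma (M : Mesh a b N) (k : ℕ) (bc : Boundary) (ext : ℕ → ℝ) (w : Fin N → ℝ[X])
    (l : ℕ) (i : Fin N) : ℝ :=
  2 * (2 * (l : ℝ) + 1) / (2 * (k : ℝ) - 1) * (M.h ^ l / (l.factorial : ℝ)) *
    Real.sqrt (M.leftJump bc ext w l i ^ 2 + M.rightJump bc ext w l i ^ 2)

/-- `∑_{l=0}^k σ_i^l / h_i ∫_{τ_{i,j}} (p - P^{l-1} p)`, where the `σ_i^l` are computed from `w`
and `P^{-1} = P^0` (natural subtraction gives `0 - 1 = 0`). -/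
def Mesh.damping {k : ℕ} (M : Mesh a b N) (bc : Boundary) (c : Fin (k + 2) → ℝ) (ext : ℕ → ℝ)
    (w : Fin N → ℝ[X]) (p : ℝ[X]) (i : Fin N) (j : Fin (k + 1)) : ℝ :=
  ∑ l ∈ Finset.range (k + 1), M.sigma k bc ext w l i / M.len i *
    ∫ x in (M.pt c i j.castSucc)..(M.pt c i j.succ),
      (p.eval x - (l2Proj (M.left i) (M.right i) (l - 1) p).eval x)

/-- The trace `w(x_{i,j}⁻)`. -/
def Mesh.minusTrace {k : ℕ} (M : Mesh a b N) (bc : Boundary) (c : Fin (k + 2) → ℝ)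
    (ext : ℕ → ℝ) (w : Fin N → ℝ[X]) (i : Fin N) (j : Fin (k + 2)) : ℝ :=
  if j = 0 then M.upTrace bc ext w 0 i else (w i).eval (M.pt c i j)

/-- The form `a_h(w, w*)`; `wt` is the time derivative of `w`, and `ws` are the values of the
piecewise constant `w*` on the control volumes. -/
def Mesh.form {k : ℕ} (M : Mesh a b N) (bc : Boundary) (c : Fin (k + 2) → ℝ) (ext : ℕ → ℝ)
    (w wt : Fin N → ℝ[X]) (ws : Fin N → Fin (k + 1) → ℝ) : ℝ :=
  ∑ i, ∑ j : Fin (k + 1), ws i j *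
    ((∫ x in (M.pt c i j.castSucc)..(M.pt c i j.succ), (wt i).eval x) +
      M.minusTrace bc c ext w i j.succ - M.minusTrace bc c ext w i j.castSucc +
      M.damping bc c ext w (w i) i j)

/-- Boundary data at the inflow point: the value `g(t)`, and for the derivatives of order `l` the
value `(-1)ˡ g⁽ˡ⁾(t)` of `∂ₓˡ u(a, t)` given by the equation `∂ₓ u = -∂ₜ u`. -/
def inflowData (T : ℝ) (g : ℝ → ℝ) (t : ℝ) (l : ℕ) : ℝ :=
  (-1) ^ l * iteratedDerivWithin l g (Set.Icc 0 T) t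

/-- `uh` solves the semi-discrete scheme on `[0, T]`: `uh(·, t)` is a piecewise polynomial of degree
`≤ k`, differentiable in `t`, with `a_h(uh, w*) = 0` for all piecewise constants `w*`. -/
structure Mesh.IsSchemeSolution {k : ℕ} (M : Mesh a b N) (bc : Boundary) (c : Fin (k + 2) → ℝ)
    (T : ℝ) (g : ℝ → ℝ) (uh : ℝ → Fin N → ℝ[X]) : Prop where
  degree : ∀ t ∈ Set.Icc 0 T, ∀ i, (uh t i).natDegree ≤ k
  scheme : ∀ t ∈ Set.Icc 0 T, ∃ ut : Fin N → ℝ[X], (∀ i, (ut i).natDegree ≤ k) ∧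
    (∀ i x, HasDerivWithinAt (fun s => (uh s i).eval x) ((ut i).eval x) (Set.Icc 0 T) t) ∧
    ∀ ws : Fin N → Fin (k + 1) → ℝ, M.form bc c (inflowData T g t) (uh t) ut ws = 0

/-! ### The correction function -/

/-- `ω` is the correction function at a given time, `v` and `vt` being the values of `u` and `∂ₜ u`
at that time, and the damping coefficients being those of `w` (the discrete solution at that time).
On every cell, `ω` has degree `≤ k`, vanishes at the right end point, and satisfies
`(ω, q')_i = (∂ₜ(u - u_I), q*)_i + ∑_l σ_i^l / h_i (u_I - P^{l-1} u_I, q*)_i`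
for all `q` of degree `≤ k` that are orthogonal to the constants. -/
def Mesh.IsCorrection {k : ℕ} (M : Mesh a b N) (m : Method) (bc : Boundary)
    (c : Fin (k + 2) → ℝ) (ext : ℕ → ℝ) (w : Fin N → ℝ[X]) (v vt : ℝ → ℝ)
    (ω : Fin N → ℝ[X]) : Prop :=
  ∀ i, (ω i).natDegree ≤ k ∧ (ω i).eval (M.right i) = 0 ∧
    ∀ q : ℝ[X], q.natDegree ≤ k → ∫ x in (M.left i)..(M.right i), q.eval x = 0 →
      ∫ x in (M.left i)..(M.right i), (ω i).eval x * q.derivative.eval x =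
        ∑ j : Fin (k + 1), M.starVal m c q i j *
          ((∫ x in (M.pt c i j.castSucc)..(M.pt c i j.succ),
              (vt x - (M.interp c vt i).eval x)) +
            M.damping bc c ext w (M.interp c v i) i j)

end

end OFSV

/-! The equation transports u along characteristics, so u(x, t) = D₀(x - t) for a single profile on
[a - T, b] whose derivatives D_n, n ≤ k + 2, are bounded and Lipschitz
(`IsSolution.exists_profile`). Time derivatives become space derivatives of the profile, and the
differentiated boundary condition makes every D_n consistent with the upwind traces
(`IsSolution.isCompatible`).

Each cell is mapped to [0, 1]. The Gauss and right Radau rules are exact at least to degree 2k - 1,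
so summation by parts turns the transport term tested with v* into the upwind discontinuous Galerkin
form (`sum_star_mul_transport`). The quadrature error in degree 2k is a nonnegative multiple of the
leading coefficient, so (f, v*) is an inner product on polynomials of degree ≤ k
(`exists_sum_star_mul_cvInt`). The damping is nonnegative (`sum_star_mul_dampInt_nonneg`). Hence the
scheme is stable in the energy (v, v*), and the rate is decided by consistency.

The interpolant u_I violates the scheme on one control volume by O(h^{k+2}), one power too few. Only
the sum over a cell is O(h^{k+3}): interpolation preserves integrals in degree k + 1, and the
damping is conservative (`Mesh.defect_bounds`). A polynomial ω̃ whose fluxes are the partial sums of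
the defect removes everything except that sum (`itp_partialSum_flux`). Stability then requires ∂ₜω̃
as well, whereas σ(u_h) contains a square root that need not be differentiable. So ω̃ is not the
correction function of the statement: it is built from coefficients σ̃ computed from u_I with a
regularised square root (`Mesh.waveSigma`). The exchange costs |σ(u_h) - σ̃|, which is bounded by
u_h - u_I on three neighbouring cells plus h^{k+2}, times the damping of u_I, which is O(h) because
damping annihilates constants. Therefore e = u_h - u_I + ω̃ solves the scheme up to a residual of
size h (h^{k+2} + |e|) (`Mesh.abs_residual_le`), and the energy estimate with Gronwall's inequality
keeps e at O(h^{k+2}) if it starts there (`exists_corrErr_bound`).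

The prescribed ω enters only at t = 0, where e = ω̃ - ω. It is defined implicitly, since σ(u_h(0))
depends on ω, but this dependence carries a factor h and is absorbed for small h; so ω = O(h^{k+2})
(`exists_initial_bound`). Finally u_I - u_h = ω̃ - e, and both terms are O(h^{k+2})
(`exists_l2norm_bound`). -/

namespace OFSV

open Polynomial Finset

/-! ### Integrals and antiderivatives of polynomials -/

/-- The integral over `(α, β)` as a linear functional on polynomials. -/
noncomputable def polyInt (α β : ℝ) : ℝ[X] →ₗ[ℝ] ℝ where
  toFun p := ∫ x in α..β, p.eval x
  map_add' p q := by
    simp only [eval_add]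
    exact intervalIntegral.integral_add
      ((by fun_prop : Continuous fun x => p.eval x).intervalIntegrable _ _)
      ((by fun_prop : Continuous fun x => q.eval x).intervalIntegrable _ _)
  map_smul' r p := by simp

theorem polyInt_apply (α β : ℝ) (p : ℝ[X]) : polyInt α β p = ∫ x in α..β, p.eval x := rfl

/-- The antiderivative of a polynomial that vanishes at `0`. -/
noncomputable def antideriv : ℝ[X] →ₗ[ℝ] ℝ[X] :=
  lsum fun n => (monomial (n + 1)).comp (LinearMap.lsmul ℝ ℝ ((n + 1 : ℝ)⁻¹))

theorem antideriv_monomial (n : ℕ) (r : ℝ) :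
    antideriv (monomial n r) = monomial (n + 1) ((n + 1 : ℝ)⁻¹ * r) := by
  rw [antideriv, lsum_apply, sum_monomial_index]
  · simp
  · simp

theorem derivative_antideriv (p : ℝ[X]) : derivative (antideriv p) = p := by
  induction p using Polynomial.induction_on' with
  | add p q hp hq => rw [map_add, derivative_add, hp, hq]
  | monomial n r =>
    rw [antideriv_monomial, derivative_monomial]
    have : (n + 1 : ℝ) ≠ 0 := by positivity
    rw [Nat.add_sub_cancel]
    congr 1
    push_cast
    field_simp

theorem coeff_antideriv_succ (p : ℝ[X]) (n : ℕ) :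
    (antideriv p).coeff (n + 1) = (n + 1 : ℝ)⁻¹ * p.coeff n := by
  have h := congrArg (fun q => q.coeff n) (derivative_antideriv p)
  simp only [coeff_derivative] at h
  have : (n + 1 : ℝ) ≠ 0 := by positivity
  field_simp
  linarith

theorem natDegree_antideriv_le {p : ℝ[X]} {n : ℕ} (hp : p.natDegree ≤ n) :
    (antideriv p).natDegree ≤ n + 1 := by
  rw [natDegree_le_iff_coeff_eq_zero]
  intro N hN
  obtain ⟨N, rfl⟩ : ∃ M, N = M + 1 := ⟨N - 1, by omega⟩
  rw [coeff_antideriv_succ, coeff_eq_zero_of_natDegree_lt (by omega), mul_zero]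

theorem polyInt_derivative (α β : ℝ) (p : ℝ[X]) :
    polyInt α β (derivative p) = p.eval β - p.eval α := by
  rw [polyInt_apply]
  exact intervalIntegral.integral_eq_sub_of_hasDerivAt (fun x _ => p.hasDerivAt x)
    ((by fun_prop : Continuous fun x => (derivative p).eval x).intervalIntegrable _ _)

theorem polyInt_eq_antideriv (α β : ℝ) (p : ℝ[X]) :
    polyInt α β p = (antideriv p).eval β - (antideriv p).eval α := by
  rw [← polyInt_derivative, derivative_antideriv]

theorem polyInt_nonneg {α β : ℝ} (h : α ≤ β) {p : ℝ[X]} (hp : ∀ x ∈ Set.Icc α β, 0 ≤ p.eval x) :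
    0 ≤ polyInt α β p :=
  intervalIntegral.integral_nonneg h hp

/-- The form `∫₀¹ W p q`. -/
noncomputable def weightForm (W : ℝ[X]) : LinearMap.BilinForm ℝ ℝ[X] :=
  (LinearMap.llcomp ℝ _ _ _ (polyInt 0 1)).comp
    ((LinearMap.mul ℝ ℝ[X]).comp (LinearMap.mulLeft ℝ W))

theorem weightForm_apply (W p q : ℝ[X]) : weightForm W p q = polyInt 0 1 (W * p * q) := rfl

theorem weightForm_symm (W : ℝ[X]) : (weightForm W).IsSymm :=
  ⟨fun p q => by simp [weightForm_apply, mul_assoc, mul_comm p q]⟩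

theorem weightForm_self_nonneg {W : ℝ[X]} (hW : ∀ x ∈ Set.Icc (0 : ℝ) 1, 0 ≤ W.eval x) (p : ℝ[X]) :
    0 ≤ weightForm W p p := by
  refine polyInt_nonneg zero_le_one fun x hx => ?_
  change 0 ≤ (W * p * p).eval x
  rw [mul_assoc, eval_mul, eval_mul]
  exact mul_nonneg (hW x hx) (mul_self_nonneg _)

/-- The weight may vanish at 1: this admits 1 - x, the weight needed for the correction function,
besides the weight 1. -/
theorem eq_zero_of_weightForm_self {W : ℝ[X]} (hW : ∀ x ∈ Set.Ico (0 : ℝ) 1, 0 < W.eval x)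
    (hW1 : 0 ≤ W.eval 1) {p : ℝ[X]} (hp : weightForm W p p = 0) : p = 0 := by
  by_contra hne
  obtain ⟨x, hx, hx0⟩ : ∃ x ∈ Set.Ico (0 : ℝ) 1, p.eval x ≠ 0 := by
    by_contra hcon
    push Not at hcon
    exact hne (eq_zero_of_infinite_isRoot p
      ((Set.Ico_infinite zero_lt_one).mono fun x hx => hcon x hx))
  have := intervalIntegral.integral_pos (f := fun x => (W * p * p).eval x) zero_lt_one
    (by fun_prop) (fun x hx => ?_) ⟨x, ⟨hx.1, hx.2.le⟩, ?_⟩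
  · exact this.ne' hp
  · simp only [eval_mul, mul_assoc]
    refine mul_nonneg ?_ (mul_self_nonneg _)
    rcases hx.2.lt_or_eq with h | h
    · exact (hW x ⟨hx.1.le, h⟩).le
    · rwa [h]
  · simp only [eval_mul, mul_assoc]
    exact mul_pos (hW x hx) (mul_self_pos.2 hx0)

/-- On polynomials of bounded degree a linear functional is bounded by a positive definite form. -/
theorem exists_sq_le_form (n : ℕ) (B : LinearMap.BilinForm ℝ ℝ[X]) (hs : ∀ p, 0 ≤ B p p)
    (hB : B.IsSymm) (hpos : ∀ p, B p p = 0 → p = 0) (f : ℝ[X] →ₗ[ℝ] ℝ) :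
    ∃ C, 0 ≤ C ∧ ∀ p : ℝ[X], p.natDegree ≤ n → f p ^ 2 ≤ C * B p p := by
  let V := degreeLT ℝ (n + 1)
  have : FiniteDimensional ℝ V := Module.Finite.equiv (degreeLTEquiv ℝ (n + 1)).symm
  let A : V →ₗ[ℝ] Module.Dual ℝ V := (LinearMap.lcomp ℝ ℝ V.subtype).comp (LinearMap.comp B V.subtype)
  have hA : ∀ p q : V, A p q = B p q := fun p q => rfl
  have hinj : Function.Injective A := by
    rw [injective_iff_map_eq_zero]
    intro q hq
    have h1 := LinearMap.congr_fun hq q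
    rw [hA] at h1
    exact Subtype.ext (hpos _ h1)
  have hsurj := (LinearMap.injective_iff_surjective_of_finrank_eq_finrank
    (Subspace.dual_finrank_eq (K := ℝ) (V := V)).symm).mp hinj
  -- Riesz representation: f = B q on the finite-dimensional space, and Cauchy–Schwarz gives the
  -- constant B q q.
  obtain ⟨q, hq⟩ := hsurj (f.comp V.subtype)
  refine ⟨B q q, hs _, fun p hp => ?_⟩
  have hpV : p ∈ V := by
    rw [mem_degreeLT]
    exact lt_of_le_of_lt degree_le_natDegree (by exact_mod_cast Nat.lt_succ_of_le hp)
  have h2 := LinearMap.congr_fun hq ⟨p, hpV⟩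
  rw [hA] at h2
  have h3 : f p = B q p := h2.symm
  rw [h3]
  exact LinearMap.BilinForm.apply_sq_le_of_symm B hs ⟨hB.eq⟩ q p

/-! ### Legendre polynomials -/

theorem polyInt_iterate_derivative_mul (n : ℕ) (P q : ℝ[X])
    (h0 : ∀ i < n, (derivative^[i] P).eval 0 = 0) (h1 : ∀ i < n, (derivative^[i] P).eval 1 = 0)
    (hq : derivative^[n] q = 0) : polyInt 0 1 (derivative^[n] P * q) = 0 := by
  induction n generalizing q with
  | zero =>
    simp only [Function.iterate_zero, id] at hq ⊢
    simp [hq]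
  | succ n ih =>
    have h2 : derivative (derivative^[n] P * q)
        = derivative^[n + 1] P * q + derivative^[n] P * derivative q := by
      rw [derivative_mul, Function.iterate_succ_apply']
    have h3 := polyInt_derivative 0 1 (derivative^[n] P * q)
    rw [h2, map_add, ih (derivative q) (fun i hi => h0 i (by omega)) (fun i hi => h1 i (by omega))
      (by rwa [Function.iterate_succ_apply] at hq), eval_mul, eval_mul, h0 n (by omega),
      h1 n (by omega)] at h3
    simpa using h3

/-- Rodrigues' formula writes the polynomial as an n-th derivative of X^n (1 - X)^n up to a factor.
In n integrations by parts the boundary terms vanish, and the n-th derivative of q is zero. -/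
theorem polyInt_legendre_mul {n : ℕ} {q : ℝ[X]} (hq : q.natDegree < n) :
    polyInt 0 1 (legendre n * q) = 0 := by
  have h1 : ((n.factorial : ℝ[X])) * (shiftedLegendre n).map (Int.castRingHom ℝ)
      = derivative^[n] (X ^ n * (1 - X) ^ n) := by
    have := congrArg (Polynomial.map (Int.castRingHom ℝ)) (factorial_mul_shiftedLegendre_eq n)
    rw [← Polynomial.iterate_derivative_map] at this
    simpa using this
  have h2 : polyInt 0 1 (derivative^[n] (X ^ n * (1 - X) ^ n) * q) = 0 := by
    refine polyInt_iterate_derivative_mul n _ q (fun i hi => ?_) (fun i hi => ?_)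
      (iterate_derivative_eq_zero hq)
    · have h := pow_sub_dvd_iterate_derivative_of_pow_dvd (p := X ^ n * (1 - X : ℝ[X]) ^ n) (q := X)
        i (dvd_mul_right _ _)
      have h' := (dvd_pow_self (X : ℝ[X]) (by omega : n - i ≠ 0)).trans h
      obtain ⟨r, hr⟩ := h'
      simp [hr]
    · have h := pow_sub_dvd_iterate_derivative_of_pow_dvd (p := X ^ n * (1 - X : ℝ[X]) ^ n)
        (q := 1 - X) i (dvd_mul_left _ _)
      have h' := (dvd_pow_self (1 - X : ℝ[X]) (by omega : n - i ≠ 0)).trans h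
      obtain ⟨r, hr⟩ := h'
      simp [hr]
  rw [← h1] at h2
  have h3 : (n.factorial : ℝ) * polyInt 0 1 ((shiftedLegendre n).map (Int.castRingHom ℝ) * q) = 0 := by
    rw [mul_assoc, ← C_eq_natCast, ← smul_eq_C_mul, map_smul, smul_eq_mul] at h2
    exact h2
  have h4 : legendre n * q = C ((-1 : ℝ) ^ n) * ((shiftedLegendre n).map (Int.castRingHom ℝ) * q) := by
    simp [legendre, mul_assoc]
  rw [h4, ← smul_eq_C_mul, map_smul, (mul_eq_zero.1 h3).resolve_left (by positivity), smul_zero]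

theorem legendre_eval_one (n : ℕ) : (legendre n).eval 1 = 1 := by
  have h := shiftedLegendre_eval_symm n (1 : ℝ)
  have h0 : aeval (0 : ℝ) (shiftedLegendre n) = 1 := by
    rw [aeval_def, eval₂_at_zero, coeff_shiftedLegendre]
    simp
  rw [sub_self, h0] at h
  rw [legendre, eval_mul, eval_map, ← algebraMap_int_eq, ← aeval_def, h]
  simp [← mul_pow]

theorem natDegree_legendre (n : ℕ) : (legendre n).natDegree = n := by
  have : legendre n = C ((-1 : ℝ) ^ n) * (shiftedLegendre n).map (Int.castRingHom ℝ) := by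
    simp [legendre]
  rw [this, natDegree_C_mul (by simp), natDegree_map_eq_of_injective Int.cast_injective,
    natDegree_shiftedLegendre]

/-! ### Quadrature -/

variable {m : Method} {k : ℕ} {c : Fin (k + 2) → ℝ}

theorem card_quadIdx (m : Method) (k : ℕ) :
    #(quadIdx m k) = match m with | .LSV => k | .RRSV => k + 1 := by
  cases m with
  | LSV =>
    have : quadIdx .LSV k = (univ.erase (0 : Fin (k + 2))).erase (Fin.last (k + 1)) := by
      ext j; simp [quadIdx, and_comm]
    rw [this, card_erase_of_mem (by simp [Fin.ext_iff]), card_erase_of_mem (mem_univ _)]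
    simp
  | RRSV =>
    have : quadIdx .RRSV k = univ.erase (0 : Fin (k + 2)) := by
      ext j; simp [quadIdx]
    rw [this, card_erase_of_mem (mem_univ _)]
    simp

theorem le_card_quadIdx (m : Method) (k : ℕ) : k ≤ #(quadIdx m k) := by
  rw [card_quadIdx]; cases m <;> simp

theorem ne_zero_of_mem_quadIdx {j : Fin (k + 2)} (hj : j ∈ quadIdx m k) : j ≠ 0 := by
  cases m <;> simp [quadIdx] at hj <;> tauto

theorem mem_quadIdx {j : Fin (k + 2)} (h0 : j ≠ 0) (h1 : j ≠ Fin.last (k + 1)) :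
    j ∈ quadIdx m k := by
  cases m <;> simp [quadIdx, h0, h1]

theorem natDegree_cvPoly (m : Method) (k : ℕ) : (cvPoly m k).natDegree = #(quadIdx m k) := by
  rw [card_quadIdx]
  cases m with
  | LSV => exact natDegree_legendre k
  | RRSV =>
    simp only [cvPoly]
    rw [natDegree_sub_eq_left_of_natDegree_lt] <;> simp [natDegree_legendre]

theorem cvPoly_ne_zero (hk : 1 ≤ k) : cvPoly m k ≠ 0 := fun h => by
  have h1 := natDegree_cvPoly m k
  rw [h, natDegree_zero] at h1
  have := le_card_quadIdx m k
  omega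

theorem polyInt_cvPoly_mul {q : ℝ[X]} (hq : q.natDegree < k) :
    polyInt 0 1 (cvPoly m k * q) = 0 := by
  cases m with
  | LSV => exact polyInt_legendre_mul hq
  | RRSV =>
    simp only [cvPoly]
    rw [sub_mul, map_sub, polyInt_legendre_mul hq, polyInt_legendre_mul (by omega), sub_zero]

theorem cvPoly_eval_node (hc : IsCVNodes m k c) {j : Fin (k + 2)} (hj : j ∈ quadIdx m k) :
    (cvPoly m k).eval (c j) = 0 := by
  by_cases hl : j = Fin.last (k + 1)
  · cases m with
    | LSV => simp [quadIdx, hl] at hj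
    | RRSV => simp [hl, hc.last, cvPoly, legendre_eval_one]
  · obtain ⟨i, rfl⟩ := Fin.exists_succ_eq.2 (ne_zero_of_mem_quadIdx hj)
    have : i ≠ Fin.last k := fun h => hl (by simp [h])
    obtain ⟨i, rfl⟩ := Fin.exists_castSucc_eq.2 this
    exact hc.zero i

/-- Both sides have the same degree and leading coefficient, so their difference has degree below
the number of nodes and vanishes at all of them. -/
theorem cvPoly_eq_C_mul_nodal (hc : IsCVNodes m k c) :
    cvPoly m k = C (cvPoly m k).leadingCoeff * Lagrange.nodal (quadIdx m k) c := by
  rw [← sub_eq_zero]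
  refine eq_zero_of_degree_lt_of_eval_index_eq_zero (quadIdx m k) (v := c)
    hc.strictMono.injective.injOn ?_ fun j hj => ?_
  · by_cases h0 : cvPoly m k = 0
    · rw [h0]; simp [bot_lt_iff_ne_bot]
    · have hd : (cvPoly m k).degree
          = (C (cvPoly m k).leadingCoeff * Lagrange.nodal (quadIdx m k) c).degree := by
        rw [degree_C_mul (leadingCoeff_ne_zero.2 h0), Lagrange.degree_nodal, degree_eq_natDegree h0,
          natDegree_cvPoly]
      have := degree_sub_lt_left hd h0 (by simp [Lagrange.nodal_monic.leadingCoeff])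
      rwa [degree_eq_natDegree h0, natDegree_cvPoly] at this
  · rw [eval_sub, eval_mul, Lagrange.eval_nodal_at_node hj, cvPoly_eval_node hc hj]
    simp

theorem polyInt_nodal_mul (hc : IsCVNodes m k c) {q : ℝ[X]} (hq : q.natDegree < k) :
    polyInt 0 1 (Lagrange.nodal (quadIdx m k) c * q) = 0 := by
  have h := polyInt_cvPoly_mul (m := m) hq
  rw [cvPoly_eq_C_mul_nodal hc, mul_assoc, ← smul_eq_C_mul, map_smul, smul_eq_mul] at h
  exact (mul_eq_zero.1 h).resolve_left (leadingCoeff_ne_zero.2 (cvPoly_ne_zero (by omega)))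

/-- The quadrature sum over the nodes `quadIdx m k`. -/
noncomputable def quad (m : Method) (k : ℕ) (c : Fin (k + 2) → ℝ) (p : ℝ[X]) : ℝ :=
  ∑ r ∈ quadIdx m k, refWeight m k c r * p.eval (c r)

theorem quad_eq_polyInt_interpolate (p : ℝ[X]) :
    quad m k c p = polyInt 0 1 (Lagrange.interpolate (quadIdx m k) c fun r => p.eval (c r)) := by
  rw [Lagrange.interpolate_apply, map_sum, quad]
  refine sum_congr rfl fun r _ => ?_
  rw [← smul_eq_C_mul, map_smul, smul_eq_mul, mul_comm]
  rfl

/-- Division by the nodal polynomial: the remainder is the interpolant, and the quotient has degree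
below k, so its product with the nodal polynomial integrates to zero. The exactness is 2k - 1 for
Gauss and 2k for Radau. -/
theorem quad_eq_polyInt (hc : IsCVNodes m k c) {p : ℝ[X]} (hk : 1 ≤ k)
    (hp : p.natDegree < #(quadIdx m k) + k) : quad m k c p = polyInt 0 1 p := by
  set n := Lagrange.nodal (quadIdx m k) c
  have hn : n.Monic := Lagrange.nodal_monic
  have hdiv := modByMonic_add_div p n
  have h1 : Lagrange.interpolate (quadIdx m k) c (fun r => p.eval (c r)) = p %ₘ n := by
    symm
    refine Lagrange.eq_interpolate_of_eval_eq _ hc.strictMono.injective.injOn ?_ fun i hi => ?_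
    · have := degree_modByMonic_lt p hn
      rwa [Lagrange.degree_nodal] at this
    · conv_rhs => rw [← hdiv]
      rw [eval_add, eval_mul, Lagrange.eval_nodal_at_node hi, zero_mul, add_zero]
  rw [quad_eq_polyInt_interpolate, h1]
  conv_rhs => rw [← hdiv]
  rw [map_add, polyInt_nodal_mul hc, add_zero]
  rw [natDegree_divByMonic _ hn, Lagrange.natDegree_nodal]
  omega

theorem quad_sub (p q : ℝ[X]) : quad m k c (p - q) = quad m k c p - quad m k c q := by
  simp [quad, mul_sub]

/-- The quadrature error on polynomials of degree `≤ 2k` is a nonnegative multiple of the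
leading coefficient. -/
theorem exists_quad_error (hc : IsCVNodes m k c) (hk : 1 ≤ k) :
    ∃ γ, 0 ≤ γ ∧ ∀ p : ℝ[X], p.natDegree ≤ 2 * k →
      polyInt 0 1 p - quad m k c p = γ * p.coeff (2 * k) := by
  cases m with
  | RRSV =>
    refine ⟨0, le_rfl, fun p hp => ?_⟩
    rw [quad_eq_polyInt hc hk (by rw [card_quadIdx]; simp; omega)]
    ring
  | LSV =>
    set n := Lagrange.nodal (quadIdx .LSV k) c with hn_def
    have hn : n.Monic := Lagrange.nodal_monic
    have hnd : n.natDegree = k := by rw [hn_def, Lagrange.natDegree_nodal, card_quadIdx]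
    have hnn : (n * n).natDegree = 2 * k := by rw [hn.natDegree_mul hn, hnd]; ring
    have hlead : (n * n).coeff (2 * k) = 1 := by
      rw [← hnn]; exact (hn.mul hn).coeff_natDegree
    refine ⟨polyInt 0 1 (n * n), polyInt_nonneg zero_le_one fun x _ => ?_, fun p hp => ?_⟩
    · rw [eval_mul]; exact mul_self_nonneg _
    -- The square of the nodal polynomial is monic of degree 2k and invisible to the quadrature.
    -- Subtracting the right multiple of it leaves a polynomial that is integrated exactly.
    · set r := p - C (p.coeff (2 * k)) * (n * n)
      have hr : r.natDegree < 2 * k := by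
        have h1 : r.natDegree ≤ 2 * k :=
          (natDegree_sub_le _ _).trans (max_le hp ((natDegree_C_mul_le _ _).trans hnn.le))
        refine lt_of_le_of_ne h1 fun h => ?_
        have : r.leadingCoeff = 0 := by
          rw [leadingCoeff, h]
          simp only [r, coeff_sub, coeff_C_mul, hlead]
          ring
        rw [leadingCoeff_eq_zero] at this
        rw [this, natDegree_zero] at h
        omega
      have h2 := quad_eq_polyInt hc hk (p := r) (by rw [card_quadIdx]; simp; omega)
      have h3 : quad .LSV k c (C (p.coeff (2 * k)) * (n * n)) = 0 := by
        refine sum_eq_zero fun i hi => ?_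
        simp [n, Lagrange.eval_nodal_at_node hi]
      rw [quad_sub, h3, map_sub, ← smul_eq_C_mul, map_smul, smul_eq_mul] at h2
      linarith

/-! ### The trial-to-test map on the reference cell -/

/-- The value on the `j`-th control volume of the piecewise constant assigned to a polynomial. -/
noncomputable def star (m : Method) (k : ℕ) (c : Fin (k + 2) → ℝ) (j : Fin (k + 1)) :
    ℝ[X] →ₗ[ℝ] ℝ :=
  leval 0 + ∑ r ∈ univ.filter (fun r : Fin (k + 2) => r ≠ 0 ∧ r ≤ j.castSucc),
    refWeight m k c r • (leval (c r)).comp derivative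

theorem star_apply (j : Fin (k + 1)) (v : ℝ[X]) :
    star m k c j v = v.eval 0 + ∑ r ∈ univ.filter (fun r : Fin (k + 2) => r ≠ 0 ∧ r ≤ j.castSucc),
      refWeight m k c r * (derivative v).eval (c r) := by
  simp [star, LinearMap.sum_apply, leval_apply]

/-- The integral over the `j`-th control volume. -/
noncomputable def cvInt (c : Fin (k + 2) → ℝ) (j : Fin (k + 1)) : ℝ[X] →ₗ[ℝ] ℝ :=
  polyInt (c j.castSucc) (c j.succ)

theorem sum_sub_castSucc {n : ℕ} (G : Fin (n + 1) → ℝ) (r : Fin (n + 1)) :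
    ∑ j ∈ univ.filter (fun j : Fin n => r ≤ j.castSucc), (G j.succ - G j.castSucc)
      = G (Fin.last n) - G r := by
  induction n with
  | zero => rw [Fin.fin_one_eq_zero r]; simp
  | succ n ih =>
    rw [sum_filter, Fin.sum_univ_castSucc]
    by_cases hr : r = Fin.last (n + 1)
    · subst hr
      simp
    · obtain ⟨s, rfl⟩ := Fin.exists_castSucc_eq.2 hr
      have := ih (fun j => G j.castSucc) s
      rw [sum_filter] at this
      simp only [Fin.castSucc_le_castSucc_iff, Fin.succ_last, ← Fin.succ_castSucc] at this ⊢
      rw [this, if_pos (Fin.le_last _)]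
      ring

/-- Summation by parts: v* jumps by A_r v'(c_r) at each node. These jumps add up to v(1) - v(0),
since the quadrature is exact for v', and this produces the boundary term at 1. -/
theorem sum_star_mul_sub (hc : IsCVNodes m k c) (hk : 1 ≤ k) {v : ℝ[X]} (hv : v.natDegree ≤ k)
    (G : Fin (k + 2) → ℝ) :
    ∑ j, star m k c j v * (G j.succ - G j.castSucc)
      = v.eval 1 * G (Fin.last _) - v.eval 0 * G 0
        - ∑ r ∈ quadIdx m k, refWeight m k c r * (G r * (derivative v).eval (c r)) := by
  set A : Fin (k + 2) → ℝ := fun r => refWeight m k c r * (derivative v).eval (c r) with hA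
  have hint : ∑ r ∈ quadIdx m k, A r = v.eval 1 - v.eval 0 := by
    rw [← polyInt_derivative, ← quad_eq_polyInt hc hk]
    · rfl
    · have := natDegree_derivative_le v
      have := le_card_quadIdx m k
      omega
  have h1 : ∀ j, star m k c j v * (G j.succ - G j.castSucc)
      = v.eval 0 * (G j.succ - G j.castSucc) + ∑ r, if r ≠ 0 ∧ r ≤ j.castSucc then
          A r * (G j.succ - G j.castSucc) else 0 := fun j => by
    rw [star_apply, add_mul, sum_mul, sum_filter]
  have h2 : ∀ r : Fin (k + 2), (∑ j : Fin (k + 1), if r ≠ 0 ∧ r ≤ j.castSucc then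
      A r * (G j.succ - G j.castSucc) else 0)
      = if r ≠ 0 then A r * (G (Fin.last _) - G r) else 0 := fun r => by
    by_cases hr : r = 0
    · simp [hr]
    · rw [if_pos hr, ← sum_sub_castSucc G r, sum_filter, mul_sum]
      refine sum_congr rfl fun j _ => ?_
      simp [hr]
  have h3 : ∑ r, (if r ≠ 0 then A r * (G (Fin.last _) - G r) else 0)
      = ∑ r ∈ quadIdx m k, A r * (G (Fin.last _) - G r) := by
    rw [← sum_filter]
    symm
    -- The only index that may be missing from `quadIdx` is the right end point (for Gauss), where
    -- the factor `G (Fin.last _) - G r` is zero.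
    refine sum_subset (fun r hr => by simpa using ne_zero_of_mem_quadIdx hr) fun r hr hr' => ?_
    have : r = Fin.last (k + 1) := by
      by_contra h
      exact hr' (mem_quadIdx (by simpa using hr) h)
    simp [this]
  have h4 := sum_sub_castSucc G 0
  simp only [Fin.zero_le, filter_true] at h4
  simp_rw [h1]
  rw [sum_add_distrib, ← mul_sum, h4, sum_comm]
  simp_rw [h2]
  rw [h3]
  simp_rw [mul_sub]
  rw [sum_sub_distrib, ← sum_mul, hint]
  have : ∑ r ∈ quadIdx m k, A r * G r
      = ∑ r ∈ quadIdx m k, refWeight m k c r * (G r * (derivative v).eval (c r)) :=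
    sum_congr rfl fun r _ => by simp only [hA]; ring
  rw [this]
  ring

/-- The transport term tested with the piecewise constant assigned to `v`. -/
theorem sum_star_mul_transport (hc : IsCVNodes m k c) (hk : 1 ≤ k) {v w : ℝ[X]}
    (hv : v.natDegree ≤ k) (hw : w.natDegree ≤ k) (up : ℝ) :
    ∑ j : Fin (k + 1), star m k c j v *
        (w.eval (c j.succ) - if j = 0 then up else w.eval (c j.castSucc))
      = v.eval 1 * w.eval 1 - v.eval 0 * up - polyInt 0 1 (w * derivative v) := by
  -- The upwind value replaces w at the left end point, which is not a quadrature node; so it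
  -- appears in the boundary term only, and the quadrature of w v', of degree at most 2k - 1, is
  -- exact.
  have h := sum_star_mul_sub hc hk hv (fun j => if j = 0 then up else w.eval (c j))
  simp only [Fin.succ_ne_zero, if_false, if_true, Fin.castSucc_eq_zero_iff,
    hc.last] at h
  rw [h, ← quad_eq_polyInt hc hk, quad]
  · congr 1
    refine sum_congr rfl fun r hr => ?_
    simp [ne_zero_of_mem_quadIdx hr]
  · have := natDegree_derivative_le v
    have := le_card_quadIdx m k
    have : (w * derivative v).natDegree ≤ k + (k - 1) := natDegree_mul_le.trans (by omega)
    omega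

/-- The form `(f, v*)` is symmetric on polynomials of degree `≤ k`. -/
theorem exists_sum_star_mul_cvInt (hc : IsCVNodes m k c) (hk : 1 ≤ k) :
    ∃ γ, 0 ≤ γ ∧ ∀ f v : ℝ[X], f.natDegree ≤ k → v.natDegree ≤ k →
      ∑ j, star m k c j v * cvInt c j f
        = polyInt 0 1 (f * v) + γ * (f.coeff k * v.coeff k) := by
  obtain ⟨γ, hγ, h⟩ := exists_quad_error hc hk
  -- Integrating f against v* leaves the quadrature error of F v' with F' = f. Its coefficient of
  -- degree 2k is (f_k / (k + 1)) (k v_k).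
  refine ⟨γ * ((k + 1 : ℝ)⁻¹ * k), by positivity, fun f v hf hv => ?_⟩
  have h1 := sum_star_mul_sub hc hk hv (fun j => (antideriv f).eval (c j))
  have h0 : ∀ j, cvInt c j f
      = (antideriv f).eval (c j.succ) - (antideriv f).eval (c j.castSucc) :=
    fun j => polyInt_eq_antideriv _ _ _
  simp_rw [h0]
  rw [h1]
  have h2 : ∑ r ∈ quadIdx m k, refWeight m k c r *
      ((antideriv f).eval (c r) * (derivative v).eval (c r))
      = quad m k c (antideriv f * derivative v) := by simp [quad]
  have hF := natDegree_antideriv_le hf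
  have hv' : (derivative v).natDegree ≤ k - 1 := (natDegree_derivative_le v).trans (by omega)
  have h3 := h (antideriv f * derivative v) (natDegree_mul_le.trans (by omega))
  have h4 : (antideriv f * derivative v).coeff (2 * k)
      = (k + 1 : ℝ)⁻¹ * k * (f.coeff k * v.coeff k) := by
    obtain ⟨n, rfl⟩ : ∃ n, k = n + 1 := ⟨k - 1, by omega⟩
    rw [Nat.add_sub_cancel] at hv'
    rw [show 2 * (n + 1) = (n + 1 + 1) + n by ring, coeff_mul_add_eq_of_natDegree_le hF hv',
      coeff_antideriv_succ, coeff_derivative]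
    push_cast
    ring
  have h5 := polyInt_derivative 0 1 (antideriv f * v)
  rw [derivative_mul, derivative_antideriv, map_add, eval_mul, eval_mul] at h5
  rw [h2, hc.first, hc.last]
  rw [h4] at h3
  linarith

theorem star_C (j : Fin (k + 1)) (r : ℝ) : star m k c j (C r) = r := by
  simp [star_apply]

theorem sum_cvInt (hc : IsCVNodes m k c) (p : ℝ[X]) : ∑ j, cvInt c j p = polyInt 0 1 p := by
  simp only [cvInt, polyInt_eq_antideriv]
  have h4 := sum_sub_castSucc (fun j => (antideriv p).eval (c j)) 0
  simp only [Fin.zero_le, filter_true, hc.first, hc.last] at h4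
  exact h4

end OFSV

namespace OFSV

open Polynomial Finset

/-! ### Interpolation on the reference cell and bounds for linear functionals -/

variable {m : Method} {k : ℕ} {c : Fin (k + 2) → ℝ}

/-- The polynomial of degree `≤ k` with prescribed values at the nodes `c 1, …, c (k + 1)`. -/
noncomputable def itp (c : Fin (k + 2) → ℝ) : (Fin (k + 1) → ℝ) →ₗ[ℝ] ℝ[X] :=
  Lagrange.interpolate univ fun j : Fin (k + 1) => c j.succ

/-- The sum of the absolute values at the nodes `c 1, …, c (k + 1)`. -/
noncomputable def nodeNorm (c : Fin (k + 2) → ℝ) (p : ℝ[X]) : ℝ :=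
  ∑ j : Fin (k + 1), |p.eval (c j.succ)|

theorem nodes_injOn (hc : IsCVNodes m k c) :
    Set.InjOn (fun j : Fin (k + 1) => c j.succ) (univ : Finset (Fin (k + 1))) :=
  fun _ _ _ _ h => Fin.succ_injective _ (hc.strictMono.injective h)

theorem itp_eval (hc : IsCVNodes m k c) (v : Fin (k + 1) → ℝ) (j : Fin (k + 1)) :
    (itp c v).eval (c j.succ) = v j :=
  Lagrange.eval_interpolate_at_node (v := fun j : Fin (k + 1) => c j.succ) _ (nodes_injOn hc)
    (mem_univ j)

theorem natDegree_itp_le (hc : IsCVNodes m k c) (v : Fin (k + 1) → ℝ) :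
    (itp c v).natDegree ≤ k := by
  have := Lagrange.degree_interpolate_le (r := v) (nodes_injOn hc)
  rw [card_univ, Fintype.card_fin, Nat.add_sub_cancel] at this
  exact natDegree_le_of_degree_le this

theorem itp_eq_self (hc : IsCVNodes m k c) {p : ℝ[X]} (hp : p.natDegree ≤ k) :
    itp c (fun j => p.eval (c j.succ)) = p := by
  symm
  refine Lagrange.eq_interpolate (v := fun j : Fin (k + 1) => c j.succ) (nodes_injOn hc) ?_
  rw [card_univ, Fintype.card_fin]
  exact lt_of_le_of_lt degree_le_natDegree (by exact_mod_cast Nat.lt_succ_of_le hp)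

/-- All quadrature nodes are interpolation nodes, so the interpolation error has quadrature value 0,
and the rule is exact in degree k + 1. For Gauss this means k + 1 ≤ 2k - 1: here k ≥ 2 is used. -/
theorem polyInt_itp_eq (hc : IsCVNodes m k c) (hk : 1 ≤ k) (hkL : m = .LSV → 2 ≤ k) {p : ℝ[X]}
    (hp : p.natDegree ≤ k + 1) :
    polyInt 0 1 (itp c fun j => p.eval (c j.succ)) = polyInt 0 1 p := by
  rw [← sub_eq_zero, ← map_sub, ← quad_eq_polyInt hc hk]
  · refine sum_eq_zero fun r hr => ?_
    obtain ⟨i, rfl⟩ := Fin.exists_succ_eq.2 (ne_zero_of_mem_quadIdx hr)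
    rw [eval_sub, itp_eval hc, sub_self, mul_zero]
  · refine lt_of_le_of_lt ((natDegree_sub_le _ _).trans
      (max_le ((natDegree_itp_le hc _).trans (Nat.le_succ k)) hp)) ?_
    rw [card_quadIdx]
    cases m with
    | LSV => have := hkL rfl; simp; omega
    | RRSV => simp; omega

theorem nodeNorm_nonneg (p : ℝ[X]) : 0 ≤ nodeNorm c p := sum_nonneg fun _ _ => abs_nonneg _

theorem nodeNorm_add_le (p q : ℝ[X]) : nodeNorm c (p + q) ≤ nodeNorm c p + nodeNorm c q := by
  rw [nodeNorm, nodeNorm, nodeNorm, ← sum_add_distrib]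
  refine sum_le_sum fun j _ => ?_
  rw [eval_add]
  exact abs_add_le _ _

theorem nodeNorm_itp (hc : IsCVNodes m k c) (v : Fin (k + 1) → ℝ) :
    nodeNorm c (itp c v) = ∑ j, |v j| := by
  simp only [nodeNorm, itp_eval hc]

theorem nodeNorm_itp_le (hc : IsCVNodes m k c) {v : Fin (k + 1) → ℝ} {r : ℝ}
    (h : ∀ j, |v j| ≤ r) : nodeNorm c (itp c v) ≤ (k + 1) * r := by
  rw [nodeNorm_itp hc]
  refine (sum_le_sum fun j _ => h j).trans ?_
  simp

theorem abs_eval_node_le (p : ℝ[X]) (j : Fin (k + 1)) : |p.eval (c j.succ)| ≤ nodeNorm c p :=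
  single_le_sum (f := fun j : Fin (k + 1) => |p.eval (c j.succ)|) (fun _ _ => abs_nonneg _)
    (mem_univ j)

theorem map_eq_sum_nodes (hc : IsCVNodes m k c) (f : ℝ[X] →ₗ[ℝ] ℝ) {p : ℝ[X]}
    (hp : p.natDegree ≤ k) :
    f p = ∑ j : Fin (k + 1), p.eval (c j.succ) * f (itp c (Pi.single j 1)) := by
  conv_lhs => rw [← itp_eq_self hc hp]
  have : (fun j : Fin (k + 1) => p.eval (c j.succ))
      = ∑ j : Fin (k + 1), p.eval (c j.succ) • (Pi.single j 1 : Fin (k + 1) → ℝ) := by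
    ext i
    simp [Finset.sum_apply, Pi.single_apply]
  rw [this, map_sum, map_sum]
  simp only [map_smul, smul_eq_mul]

/-- Finitely many linear functionals on polynomials of degree `≤ k` are bounded by the values at
the nodes. -/
theorem exists_abs_le_nodeNorm (hc : IsCVNodes m k c) {ι : Type*} [Finite ι]
    (f : ι → ℝ[X] →ₗ[ℝ] ℝ) :
    ∃ K, 0 ≤ K ∧ ∀ i, ∀ p : ℝ[X], p.natDegree ≤ k → |f i p| ≤ K * nodeNorm c p := by
  cases nonempty_fintype ι
  refine ⟨∑ i, ∑ j : Fin (k + 1), |f i (itp c (Pi.single j 1))|,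
    sum_nonneg fun _ _ => sum_nonneg fun _ _ => abs_nonneg _, fun i p hp => ?_⟩
  rw [map_eq_sum_nodes hc (f i) hp, nodeNorm, mul_sum]
  refine (abs_sum_le_sum_abs _ _).trans (sum_le_sum fun j _ => ?_)
  rw [abs_mul, mul_comm]
  refine mul_le_mul_of_nonneg_right ?_ (abs_nonneg _)
  refine le_trans ?_ (single_le_sum
    (f := fun i => ∑ j : Fin (k + 1), |f i (itp c (Pi.single j 1))|)
    (fun _ _ => sum_nonneg fun _ _ => abs_nonneg _) (mem_univ i))
  exact single_le_sum (f := fun j : Fin (k + 1) => |f i (itp c (Pi.single j 1))|)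
    (fun _ _ => abs_nonneg _) (mem_univ j)

theorem exists_nodeNorm_sq_le_form (B : LinearMap.BilinForm ℝ ℝ[X]) (hs : ∀ p, 0 ≤ B p p)
    (hB : B.IsSymm) (hpos : ∀ p, B p p = 0 → p = 0) (c : Fin (k + 2) → ℝ) :
    ∃ K, 0 ≤ K ∧ ∀ p : ℝ[X], p.natDegree ≤ k → nodeNorm c p ^ 2 ≤ K * B p p := by
  choose K hK0 hK using fun j : Fin (k + 1) => exists_sq_le_form k B hs hB hpos (leval (c j.succ))
  refine ⟨(k + 1) * ∑ j, K j, mul_nonneg (by positivity) (sum_nonneg fun j _ => hK0 j),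
    fun p hp => ?_⟩
  have h := sq_sum_le_card_mul_sum_sq (s := univ) (f := fun j : Fin (k + 1) => |p.eval (c j.succ)|)
  rw [card_univ, Fintype.card_fin] at h
  refine h.trans ?_
  push_cast
  rw [mul_assoc, sum_mul]
  refine mul_le_mul_of_nonneg_left (sum_le_sum fun j _ => ?_) (by positivity)
  rw [sq_abs]
  exact hK j p hp

theorem weightForm_one_apply (p q : ℝ[X]) : weightForm 1 p q = polyInt 0 1 (p * q) := by
  rw [weightForm_apply, one_mul]

theorem exists_nodeNorm_sq_le (c : Fin (k + 2) → ℝ) :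
    ∃ K, 0 ≤ K ∧ ∀ p : ℝ[X], p.natDegree ≤ k → nodeNorm c p ^ 2 ≤ K * polyInt 0 1 (p * p) := by
  obtain ⟨K, h0, h⟩ := exists_nodeNorm_sq_le_form (weightForm 1)
    (fun p => weightForm_self_nonneg (by simp) p) (weightForm_symm 1)
    (fun p hp => eq_zero_of_weightForm_self (by simp) (by simp) hp) c
  refine ⟨K, h0, fun p hp => ?_⟩
  rw [← weightForm_one_apply]
  exact h p hp

theorem exists_polyInt_sq_le (hc : IsCVNodes m k c) :
    ∃ K, 0 ≤ K ∧ ∀ p : ℝ[X], p.natDegree ≤ k → polyInt 0 1 (p * p) ≤ K * nodeNorm c p ^ 2 := by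
  obtain ⟨K, hK0, hK⟩ := exists_abs_le_nodeNorm hc
    (fun j : Fin (k + 1) => weightForm 1 (itp c (Pi.single j 1)))
  refine ⟨(k + 1) * K, by positivity, fun p hp => ?_⟩
  rw [← weightForm_one_apply, map_eq_sum_nodes hc (weightForm 1 p) hp]
  calc ∑ j : Fin (k + 1), p.eval (c j.succ) * weightForm 1 p (itp c (Pi.single j 1))
      ≤ ∑ j : Fin (k + 1), K * nodeNorm c p ^ 2 := sum_le_sum fun j _ => by
        refine (le_abs_self _).trans ?_
        rw [abs_mul, (weightForm_symm 1).eq]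
        calc |p.eval (c j.succ)| * |weightForm 1 (itp c (Pi.single j 1)) p|
            ≤ nodeNorm c p * (K * nodeNorm c p) :=
              mul_le_mul (abs_eval_node_le p j) (hK j p hp) (abs_nonneg _) (nodeNorm_nonneg p)
          _ = K * nodeNorm c p ^ 2 := by ring
    _ = (k + 1) * K * nodeNorm c p ^ 2 := by simp; ring

/-- A linear functional of a polynomial of degree `≤ k` that depends on time is differentiated
through the values at the nodes. -/
theorem hasDerivWithinAt_map (hc : IsCVNodes m k c) (f : ℝ[X] →ₗ[ℝ] ℝ) {p : ℝ → ℝ[X]} {q : ℝ[X]}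
    {S : Set ℝ} {t : ℝ} (hp : ∀ s ∈ S, (p s).natDegree ≤ k) (hq : q.natDegree ≤ k) (ht : t ∈ S)
    (h : ∀ j : Fin (k + 1), HasDerivWithinAt (fun s => (p s).eval (c j.succ))
      (q.eval (c j.succ)) S t) :
    HasDerivWithinAt (fun s => f (p s)) (f q) S t := by
  rw [map_eq_sum_nodes hc f hq]
  have := HasDerivWithinAt.fun_sum (u := univ)
    fun j (_ : j ∈ univ) => (h j).mul_const (f (itp c (Pi.single j 1)))
  exact this.congr (fun s hs => map_eq_sum_nodes hc f (hp s hs)) (map_eq_sum_nodes hc f (hp t ht))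

/-! ### Transport to the reference cell -/

/-- The polynomial `s ↦ p (α + δ s)`. -/
noncomputable def toRef (α δ : ℝ) (p : ℝ[X]) : ℝ[X] := p.comp (C δ * X + C α)

theorem toRef_eval (α δ : ℝ) (p : ℝ[X]) (s : ℝ) : (toRef α δ p).eval s = p.eval (α + δ * s) := by
  simp [toRef, add_comm]

theorem toRef_sub (α δ : ℝ) (p q : ℝ[X]) : toRef α δ (p - q) = toRef α δ p - toRef α δ q := by
  simp [toRef]

theorem toRef_mul (α δ : ℝ) (p q : ℝ[X]) : toRef α δ (p * q) = toRef α δ p * toRef α δ q := by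
  simp [toRef]

theorem natDegree_toRef_le (α δ : ℝ) {p : ℝ[X]} {n : ℕ} (hp : p.natDegree ≤ n) :
    (toRef α δ p).natDegree ≤ n := by
  refine natDegree_comp_le.trans ?_
  calc p.natDegree * (C δ * X + C α).natDegree ≤ n * 1 :=
        Nat.mul_le_mul hp natDegree_linear_le
    _ = n := mul_one n

theorem derivative_toRef (α δ : ℝ) (p : ℝ[X]) :
    derivative (toRef α δ p) = C δ * toRef α δ (derivative p) := by
  simp [toRef, derivative_comp]

theorem iterate_derivative_toRef (α δ : ℝ) (p : ℝ[X]) (l : ℕ) :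
    derivative^[l] (toRef α δ p) = C (δ ^ l) * toRef α δ (derivative^[l] p) := by
  induction l with
  | zero => simp
  | succ l ih =>
    rw [Function.iterate_succ_apply', ih, derivative_C_mul, derivative_toRef,
      Function.iterate_succ_apply', pow_succ, C_mul, mul_assoc]

theorem polyInt_cell (α δ β₁ β₂ : ℝ) (p : ℝ[X]) :
    polyInt (α + δ * β₁) (α + δ * β₂) p = δ * polyInt β₁ β₂ (toRef α δ p) := by
  have h := polyInt_derivative β₁ β₂ (toRef α δ (antideriv p))
  rw [derivative_toRef, derivative_antideriv, ← smul_eq_C_mul, map_smul, smul_eq_mul] at h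
  rw [h, polyInt_eq_antideriv, toRef_eval, toRef_eval]

theorem exists_toRef_eq (α : ℝ) {δ : ℝ} (hδ : δ ≠ 0) (r : ℝ[X]) {n : ℕ} (hr : r.natDegree ≤ n) :
    ∃ s : ℝ[X], s.natDegree ≤ n ∧ toRef α δ s = r := by
  refine ⟨toRef (-(α / δ)) δ⁻¹ r, natDegree_toRef_le _ _ hr, funext fun x => ?_⟩
  rw [toRef_eval, toRef_eval]
  congr 1
  field_simp
  ring

theorem isL2Proj_iff {α β : ℝ} {l : ℕ} {p q : ℝ[X]} :
    IsL2Proj α β l p q ↔ q.natDegree ≤ l ∧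
      ∀ r : ℝ[X], r.natDegree ≤ l → polyInt α β ((p - q) * r) = 0 := by
  simp only [IsL2Proj, polyInt_apply, eval_mul, eval_sub]

/-- An affine change of variables preserves degrees and multiplies inner products by δ, so the
transported projection satisfies the same orthogonality conditions. Uniqueness does the rest. -/
theorem toRef_l2Proj {α δ : ℝ} (hδ : 0 < δ) (l : ℕ) (p : ℝ[X]) :
    toRef α δ (l2Proj α (α + δ) l p) = l2Proj 0 1 l (toRef α δ p) := by
  refine IsL2Proj.unique zero_lt_one (p := toRef α δ p) (l := l) ?_ (l2Proj_spec zero_lt_one l _)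
  obtain ⟨h1, h2⟩ := isL2Proj_iff.1 (l2Proj_spec (by linarith : α < α + δ) l p)
  refine isL2Proj_iff.2 ⟨natDegree_toRef_le _ _ h1, fun r hr => ?_⟩
  obtain ⟨s, hs, rfl⟩ := exists_toRef_eq α hδ.ne' r hr
  have h3 := h2 s hs
  have h4 := polyInt_cell α δ 0 1 ((p - l2Proj α (α + δ) l p) * s)
  rw [mul_zero, add_zero, mul_one, h3, toRef_mul, toRef_sub] at h4
  exact (mul_eq_zero.1 h4.symm).resolve_left hδ.ne'

/-! ### The damping functionals on the reference cell -/

/-- The `L²(0, 1)`-projection as a linear map. -/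
noncomputable def refProj (l : ℕ) : ℝ[X] →ₗ[ℝ] ℝ[X] where
  toFun := l2Proj 0 1 l
  map_add' p q := by
    refine IsL2Proj.unique zero_lt_one (l2Proj_spec zero_lt_one l _) (isL2Proj_iff.2 ?_)
    obtain ⟨h1, h2⟩ := isL2Proj_iff.1 (l2Proj_spec zero_lt_one l p)
    obtain ⟨h3, h4⟩ := isL2Proj_iff.1 (l2Proj_spec zero_lt_one l q)
    refine ⟨(natDegree_add_le _ _).trans (max_le h1 h3), fun r hr => ?_⟩
    rw [add_sub_add_comm, add_mul, map_add, h2 r hr, h4 r hr, add_zero]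
  map_smul' a p := by
    refine IsL2Proj.unique zero_lt_one (l2Proj_spec zero_lt_one l _) (isL2Proj_iff.2 ?_)
    obtain ⟨h1, h2⟩ := isL2Proj_iff.1 (l2Proj_spec zero_lt_one l p)
    refine ⟨(natDegree_smul_le _ _).trans h1, fun r hr => ?_⟩
    rw [RingHom.id_apply, ← smul_sub, smul_mul_assoc, map_smul, h2 r hr, smul_zero]

theorem refProj_apply (l : ℕ) (p : ℝ[X]) : refProj l p = l2Proj 0 1 l p := rfl

theorem natDegree_refProj_le (l : ℕ) (p : ℝ[X]) : (refProj l p).natDegree ≤ l :=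
  (l2Proj_spec zero_lt_one l p).1

theorem polyInt_sub_refProj_mul (l : ℕ) (p : ℝ[X]) {r : ℝ[X]} (hr : r.natDegree ≤ l) :
    polyInt 0 1 ((p - refProj l p) * r) = 0 :=
  (isL2Proj_iff.1 (l2Proj_spec zero_lt_one l p)).2 r hr

theorem refProj_C (l : ℕ) (r : ℝ) : refProj l (C r) = C r :=
  IsL2Proj.unique zero_lt_one (l2Proj_spec zero_lt_one l _)
    (isL2Proj_iff.2 ⟨by simp, by simp⟩)

/-- The integral of `p - P^{l-1} p` over the `j`-th control volume. -/
noncomputable def dampInt (c : Fin (k + 2) → ℝ) (l : ℕ) (j : Fin (k + 1)) : ℝ[X] →ₗ[ℝ] ℝ :=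
  (cvInt c j).comp (LinearMap.id - refProj (l - 1))

theorem dampInt_apply (l : ℕ) (j : Fin (k + 1)) (p : ℝ[X]) :
    dampInt c l j p = cvInt c j (p - refProj (l - 1) p) := rfl

theorem dampInt_C (l : ℕ) (j : Fin (k + 1)) (r : ℝ) : dampInt c l j (C r) = 0 := by
  rw [dampInt_apply, refProj_C, sub_self, map_zero]

/-- The damping is conservative because p minus its projection is orthogonal to constants. For this
reason it does not spoil the superconvergence of the defect summed over a cell. -/
theorem sum_dampInt (hc : IsCVNodes m k c) (l : ℕ) (p : ℝ[X]) : ∑ j, dampInt c l j p = 0 := by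
  simp only [dampInt_apply]
  rw [sum_cvInt hc]
  have := polyInt_sub_refProj_mul (l - 1) p (r := 1) (by simp)
  rwa [mul_one] at this

/-- The integral part is the square of v - P^{l-1} v by orthogonality. The quadrature part is γ
times the square of the leading coefficient, because P^{l-1} v has degree below k for l ≤ k. -/
theorem sum_star_mul_dampInt_nonneg (hc : IsCVNodes m k c) (hk : 1 ≤ k) {l : ℕ} (hl : l ≤ k)
    {v : ℝ[X]} (hv : v.natDegree ≤ k) : 0 ≤ ∑ j, star m k c j v * dampInt c l j v := by
  obtain ⟨γ, hγ, h⟩ := exists_sum_star_mul_cvInt hc hk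
  have hd := natDegree_refProj_le (l - 1) v
  have h1 := h (v - refProj (l - 1) v) v
    ((natDegree_sub_le _ _).trans (max_le hv (hd.trans (by omega)))) hv
  simp only [dampInt_apply]
  rw [h1, coeff_sub, coeff_eq_zero_of_natDegree_lt (p := refProj (l - 1) v) (by omega), sub_zero]
  have h2 := polyInt_sub_refProj_mul (l - 1) v hd
  have h3 : polyInt 0 1 ((v - refProj (l - 1) v) * v)
      = polyInt 0 1 ((v - refProj (l - 1) v) * (v - refProj (l - 1) v)) := by
    rw [mul_sub, map_sub, h2, sub_zero]
  rw [h3]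
  exact add_nonneg (polyInt_nonneg zero_le_one fun x _ => by rw [eval_mul]; exact mul_self_nonneg _)
    (mul_nonneg hγ (mul_self_nonneg _))

end OFSV

namespace OFSV

open MeasureTheory Set

/-! ### From weak to classical derivatives -/

/-- Integration by parts for absolutely continuous functions; the primitive of an integrable f has
derivative f almost everywhere, and φ vanishes at both ends. -/
theorem integral_antideriv_mul_deriv {a b : ℝ} {f φ : ℝ → ℝ}
    (hf : IntervalIntegrable f volume a b) (hφ : ContDiff ℝ (⊤ : ℕ∞) φ)
    (hs : tsupport φ ⊆ Ioo a b) :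
    ∫ x in a..b, (∫ y in a..x, f y) * deriv φ x = -∫ x in a..b, f x * φ x := by
  have h1 := hf.absolutelyContinuousOnInterval_intervalIntegral (c := a) left_mem_uIcc
  have h2 : AbsolutelyContinuousOnInterval φ a b :=
    (hφ.of_le (by exact_mod_cast le_top)).contDiffOn.absolutelyContinuousOnInterval
  have hφa : φ a = 0 := image_eq_zero_of_notMem_tsupport fun h => lt_irrefl _ (hs h).1
  have hφb : φ b = 0 := image_eq_zero_of_notMem_tsupport fun h => lt_irrefl _ (hs h).2
  rw [h1.integral_mul_deriv_eq_deriv_mul h2, hφa, hφb]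
  simp only [mul_zero, sub_zero, zero_sub, neg_inj]
  refine intervalIntegral.integral_congr_ae ?_
  filter_upwards [hf.ae_hasDerivAt_integral] with x hx hx'
  rw [(hx (uIoc_subset_uIcc hx') a left_mem_uIcc).deriv]

/-- The lemma of du Bois-Reymond. -/
theorem ae_eq_const_of_integral_mul_deriv {a b : ℝ} (hab : a < b) {w : ℝ → ℝ}
    (hw : IntegrableOn w (Ioo a b))
    (h : ∀ φ : ℝ → ℝ, ContDiff ℝ (⊤ : ℕ∞) φ → HasCompactSupport φ → tsupport φ ⊆ Ioo a b →
      ∫ x in Ioo a b, w x * deriv φ x = 0) :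
    ∃ r : ℝ, ∀ᵐ x ∂volume.restrict (Ioo a b), w x = r := by
  have hmid : (a + b) / 2 ∈ Ioo a b := ⟨by linarith, by linarith⟩
  obtain ⟨ψ, hψs, hψc, hψd, hψr, hψ1⟩ :=
    exists_contDiff_tsupport_subset (n := ⊤) (isOpen_Ioo.mem_nhds hmid)
  have hψpos : 0 < ∫ x, ψ x := hψd.continuous.integral_pos_of_hasCompactSupport_nonneg_nonzero
    hψc (fun x => (hψr (mem_range_self x)).1) (x := (a + b) / 2) (by rw [hψ1]; exact one_ne_zero)
  have hmulint : ∀ g : ℝ → ℝ, Continuous g → HasCompactSupport g →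
      IntegrableOn (fun x => w x * g x) (Ioo a b) := fun g hg hgc => by
    obtain ⟨C, hC⟩ := hgc.exists_bound_of_continuous hg
    exact hw.mul_bdd (hg.aestronglyMeasurable) (Filter.Eventually.of_forall hC)
  have key : ∀ g : ℝ → ℝ, ContDiff ℝ (⊤ : ℕ∞) g → HasCompactSupport g → tsupport g ⊆ Ioo a b →
      ∫ x in Ioo a b, w x * g x
        = (∫ x, g x) * ((∫ x in Ioo a b, w x * ψ x) / ∫ x, ψ x) := by
    intro g hg hgc hgs
    -- Subtracting this multiple of the bump ψ makes the mean zero, so the primitive F has compact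
    -- support in (a, b) and may serve as the test function in the hypothesis.
    set s := (∫ x, g x) / ∫ x, ψ x with hs
    set χ : ℝ → ℝ := fun x => g x - s * ψ x with hχ
    have hχd : ContDiff ℝ (⊤ : ℕ∞) χ := hg.sub (contDiff_const.mul hψd)
    have hχ0 : ∫ x, χ x = 0 := by
      rw [integral_sub (hg.continuous.integrable_of_hasCompactSupport hgc)
        ((hψd.continuous.integrable_of_hasCompactSupport hψc).const_mul s), integral_const_mul, hs]
      field_simp
      ring
    obtain ⟨α, β, hα, hβ, hK⟩ : ∃ α β, a < α ∧ β < b ∧ tsupport g ∪ tsupport ψ ⊆ Icc α β := by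
      have hKc : IsCompact (tsupport g ∪ tsupport ψ) := hgc.isCompact.union hψc.isCompact
      have hne : (tsupport g ∪ tsupport ψ).Nonempty :=
        ⟨(a + b) / 2, Or.inr (subset_tsupport _ (by simp [hψ1]))⟩
      obtain ⟨α, hα, hα'⟩ := hKc.exists_isLeast hne
      obtain ⟨β, hβ, hβ'⟩ := hKc.exists_isGreatest hne
      exact ⟨α, β, (union_subset hgs hψs hα).1, (union_subset hgs hψs hβ).2,
        fun x hx => ⟨hα' hx, hβ' hx⟩⟩
    have hχz : ∀ x, x ∉ Icc α β → χ x = 0 := fun x hx => by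
      have h1 : x ∉ tsupport g := fun h' => hx (hK (Or.inl h'))
      have h2 : x ∉ tsupport ψ := fun h' => hx (hK (Or.inr h'))
      simp [hχ, image_eq_zero_of_notMem_tsupport h1, image_eq_zero_of_notMem_tsupport h2]
    set F : ℝ → ℝ := fun x => ∫ y in a..x, χ y with hF
    have hFd : ∀ x, HasDerivAt F (χ x) x := fun x => hχd.continuous.integral_hasStrictDerivAt a x
      |>.hasDerivAt
    have hderiv : deriv F = χ := funext fun x => (hFd x).deriv
    have hFc : ContDiff ℝ (⊤ : ℕ∞) F := by
      rw [contDiff_infty_iff_deriv, hderiv]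
      exact ⟨fun x => (hFd x).differentiableAt, hχd⟩
    have hFz : ∀ x, x ∉ Icc α β → F x = 0 := fun x hx => by
      rcases lt_or_ge x α with hxα | hxα
      · refine intervalIntegral.integral_zero_ae (Filter.Eventually.of_forall fun y hy => hχz y ?_)
        intro hy'
        have : y ≤ max a x := (uIoc_subset_uIcc hy).2
        exact absurd (lt_of_le_of_lt this (max_lt hα hxα)) (not_lt.2 hy'.1)
      · have hxβ : β < x := lt_of_not_ge fun h' => hx ⟨hxα, h'⟩
        rw [hF]
        simp only
        rw [intervalIntegral.integral_of_le (by linarith),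
          setIntegral_eq_integral_of_forall_compl_eq_zero, hχ0]
        intro y hy
        refine hχz y fun hy' => hy ⟨by linarith [hy'.1], by linarith [hy'.2]⟩
    have hFs : tsupport F ⊆ Icc α β :=
      closure_minimal (fun x hx => by_contra fun hx' => hx (hFz x hx')) isClosed_Icc
    have hFcs : HasCompactSupport F :=
      HasCompactSupport.of_support_subset_isCompact isCompact_Icc (subset_closure.trans hFs)
    have h0 := h F hFc hFcs (hFs.trans fun x hx => ⟨by linarith [hx.1], by linarith [hx.2]⟩)
    rw [hderiv] at h0
    have h1 : ∫ x in Ioo a b, w x * χ x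
        = (∫ x in Ioo a b, w x * g x) - s * ∫ x in Ioo a b, w x * ψ x := by
      rw [← integral_const_mul, ← integral_sub (hmulint g hg.continuous hgc)
        ((hmulint ψ hψd.continuous hψc).const_mul s)]
      refine integral_congr_ae (Filter.Eventually.of_forall fun x => ?_)
      simp only [hχ]
      ring
    rw [h0] at h1
    rw [hs] at h1
    field_simp at h1 ⊢
    linarith
  set r := (∫ x in Ioo a b, w x * ψ x) / ∫ x, ψ x
  refine ⟨r, ?_⟩
  have hloc : LocallyIntegrableOn (fun x => w x - r) (Ioo a b) :=
    (hw.sub (integrableOn_const (by simp))).locallyIntegrableOn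
  have h2 := isOpen_Ioo.ae_eq_zero_of_integral_contDiff_smul_eq_zero hloc fun g hg hgc hgs => by
    have hz : ∀ x, x ∉ Ioo a b → g x = 0 := fun x hx =>
      image_eq_zero_of_notMem_tsupport fun h' => hx (hgs h')
    rw [← setIntegral_eq_integral_of_forall_compl_eq_zero (s := Ioo a b)
      (fun x hx => by rw [hz x hx, zero_smul])]
    have h3 : ∫ x in Ioo a b, g x • (w x - r)
        = (∫ x in Ioo a b, w x * g x) - (∫ x in Ioo a b, g x) * r := by
      rw [← integral_mul_const, ← integral_sub (hmulint g hg.continuous hgc)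
        ((hg.continuous.integrable_of_hasCompactSupport hgc).integrableOn.mul_const r)]
      refine integral_congr_ae (Filter.Eventually.of_forall fun x => ?_)
      simp only [smul_eq_mul]
      ring
    rw [h3, key g hg hgc hgs, setIntegral_eq_integral_of_forall_compl_eq_zero hz, sub_self]
  rw [ae_restrict_iff' measurableSet_Ioo]
  filter_upwards [h2] with x hx hx'
  linarith [hx hx']

/-- `D n`, `n ≤ m`, are the successive derivatives on `[α, β]` of `D 0`; they are bounded by `B`
and Lipschitz continuous with constant `B`. -/
structure IsProfile (α β B : ℝ) (m : ℕ) (D : ℕ → ℝ → ℝ) : Prop where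
  deriv : ∀ n < m, ∀ x ∈ Icc α β, HasDerivWithinAt (D n) (D (n + 1) x) (Icc α β) x
  bound : ∀ n ≤ m, ∀ x ∈ Icc α β, |D n x| ≤ B
  lip : ∀ n ≤ m, ∀ x ∈ Icc α β, ∀ y ∈ Icc α β, |D n x - D n y| ≤ B * |x - y|

/-- A function in `W^{m+1,∞}` that is continuous has `m` classical derivatives, which are bounded
and Lipschitz continuous. -/
theorem SobolevBound.exists_classical {a b M : ℝ} (hab : a < b) {m : ℕ} {f : ℝ → ℝ}
    (h : SobolevBound a b (m + 1) M f) (hf : ContinuousOn f (Icc a b)) :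
    ∃ E : ℕ → ℝ → ℝ, (∀ x ∈ Icc a b, E 0 x = f x) ∧ IsProfile a b |M| m E := by
  obtain ⟨D, hD0, hD⟩ := h
  have hbd : ∀ j ≤ m + 1, ∀ᵐ x ∂volume.restrict (Ioo a b), |D j x| ≤ |M| := fun j hj => by
    obtain ⟨_, h2, _⟩ := hD j hj
    rw [eLpNorm_exponent_top] at h2
    filter_upwards [ae_le_eLpNormEssSup (f := D j) (μ := volume.restrict (Ioo a b))] with x hx
    have h3 := hx.trans h2
    rw [← ofReal_norm, Real.norm_eq_abs] at h3
    have h4 := h3.trans (ENNReal.ofReal_le_ofReal (le_abs_self M))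
    exact (ENNReal.ofReal_le_ofReal_iff (abs_nonneg M)).1 h4
  have hint : ∀ j ≤ m + 1, IntegrableOn (D j) (Ioo a b) := fun j hj =>
    Integrable.of_bound (hD j hj).1 _ (hbd j hj)
  have hii : ∀ j ≤ m + 1, IntervalIntegrable (D j) volume a b := fun j hj =>
    (intervalIntegrable_iff_integrableOn_Ioo_of_le hab.le).2 (hint j hj)
  have hsub : ∀ j ≤ m + 1, ∀ x ∈ Icc a b, ∀ y ∈ Icc a b, IntervalIntegrable (D j) volume x y :=
    fun j hj x hx y hy => (hii j hj).mono_set (by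
      rw [uIcc_of_le hab.le]; exact uIcc_subset_Icc hx hy)
  have hcontI : ∀ j ≤ m + 1, ContinuousOn (fun x => ∫ y in a..x, D j y) (Icc a b) :=
    fun j hj => by
      have := ((hii j hj).absolutelyContinuousOnInterval_intervalIntegral
        (c := a) left_mem_uIcc).continuousOn
      rwa [uIcc_of_le hab.le] at this
  -- The identities of order n, tested with φ', and of order n + 1, tested with φ, show that `D (n +
  -- 1)` is the weak derivative of `D n`. By du Bois-Reymond, `D n` then differs from the primitive
  -- of `D (n + 1)` by a constant.
  have hstep : ∀ n ≤ m, ∃ r : ℝ, ∀ᵐ x ∂volume.restrict (Ioo a b),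
      D n x = r + ∫ y in a..x, D (n + 1) y := fun n hn => by
    have hI : IntegrableOn (fun x => ∫ y in a..x, D (n + 1) y) (Ioo a b) :=
      ((hcontI (n + 1) (by omega)).integrableOn_Icc).mono_set Ioo_subset_Icc_self
    obtain ⟨r, hr⟩ := ae_eq_const_of_integral_mul_deriv hab
      (w := fun x => D n x - ∫ y in a..x, D (n + 1) y) ((hint n (by omega)).sub hI)
      fun φ hφ hφc hφs => by
        have hφ' : ContDiff ℝ (⊤ : ℕ∞) (deriv φ) := (contDiff_infty_iff_deriv.1 hφ).2
        have hφc' : HasCompactSupport (deriv φ) := hφc.deriv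
        obtain ⟨C, hC⟩ := hφc'.exists_bound_of_continuous hφ'.continuous
        have e1 := (hD n (by omega)).2.2 (deriv φ) hφ' hφc'
          ((tsupport_deriv_subset).trans hφs)
        have e2 := (hD (n + 1) (by omega)).2.2 φ hφ hφc hφs
        rw [iteratedDeriv_succ', e1, pow_succ] at e2
        have e3 := integral_antideriv_mul_deriv (hii (n + 1) (by omega)) hφ hφs
        rw [intervalIntegral.integral_of_le hab.le, intervalIntegral.integral_of_le hab.le,
          integral_Ioc_eq_integral_Ioo, integral_Ioc_eq_integral_Ioo] at e3
        have e4 : ∫ x in Ioo a b, (D n x - ∫ y in a..x, D (n + 1) y) * deriv φ x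
            = (∫ x in Ioo a b, D n x * deriv φ x)
              - ∫ x in Ioo a b, (∫ y in a..x, D (n + 1) y) * deriv φ x := by
          rw [← integral_sub]
          · refine integral_congr_ae (Filter.Eventually.of_forall fun x => ?_)
            simp only
            ring
          · exact (hint n (by omega)).mul_bdd hφ'.continuous.aestronglyMeasurable
              (Filter.Eventually.of_forall hC)
          · exact hI.mul_bdd hφ'.continuous.aestronglyMeasurable
              (Filter.Eventually.of_forall hC)
        rw [e4, e3]
        have hne : ((-1 : ℝ) ^ n) ≠ 0 := by simp
        have e5 : (-1 : ℝ) ^ n * ((∫ x in Ioo a b, D n x * deriv φ x)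
            + ∫ x in Ioo a b, D (n + 1) x * φ x) = 0 := by
          rw [mul_add, e2]
          ring
        linarith [(mul_eq_zero.1 e5).resolve_left hne]
    refine ⟨r, ?_⟩
    filter_upwards [hr] with x hx
    linarith
  choose! r hr using hstep
  set E : ℕ → ℝ → ℝ := fun n x => r n + ∫ y in a..x, D (n + 1) y with hE
  have ha : a ∈ Icc a b := ⟨le_rfl, hab.le⟩
  have hlip : ∀ n ≤ m, ∀ x ∈ Icc a b, ∀ y ∈ Icc a b, |E n x - E n y| ≤ |M| * |x - y| := by
    intro n hn x hx y hy
    have e1 : E n x - E n y = ∫ z in y..x, D (n + 1) z := by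
      simp only [hE]
      rw [add_sub_add_left_eq_sub, intervalIntegral.integral_interval_sub_left
        (hsub _ (by omega) a ha x hx) (hsub _ (by omega) a ha y hy)]
    rw [e1, ← Real.norm_eq_abs]
    refine intervalIntegral.norm_integral_le_of_norm_le_const_ae ?_
    have h2 := hbd (n + 1) (by omega)
    rw [restrict_Ioo_eq_restrict_Ioc, ae_restrict_iff' measurableSet_Ioc] at h2
    filter_upwards [h2] with z hz hz'
    refine hz ⟨lt_of_le_of_lt (le_min hy.1 hx.1) hz'.1, hz'.2.trans (max_le hy.2 hx.2)⟩
  have hcont : ∀ n ≤ m, ContinuousOn (E n) (Icc a b) := fun n hn =>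
    continuousOn_const.add (hcontI (n + 1) (by omega))
  have hae : ∀ n ≤ m, D n =ᵐ[volume.restrict (Icc a b)] E n := fun n hn => by
    rw [← restrict_Ioo_eq_restrict_Icc]
    exact hr n hn
  refine ⟨E, fun x hx => ?_, ⟨fun n hn x hx => ?_, fun n hn x hx => ?_, hlip⟩⟩
  · have := hae 0 (Nat.zero_le m)
    rw [hD0] at this
    exact (Measure.eqOn_Icc_of_ae_eq volume hab.ne this hf (hcont 0 (Nat.zero_le m)) hx).symm
  -- A continuous extension to the whole line makes the fundamental theorem of calculus available at
  -- the end points too.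
  · set G : ℝ → ℝ := IccExtend hab.le ((Icc a b).domRestrict (E (n + 1))) with hG
    have hGc : Continuous G := (continuousOn_iff_continuous_domRestrict.1
      (hcont (n + 1) hn)).Icc_extend'
    have hGE : ∀ y ∈ Icc a b, G y = E (n + 1) y := fun y hy => by
      rw [hG, IccExtend_of_mem _ _ hy, domRestrict_apply]
    have hEq : ∀ y ∈ Icc a b, E n y = r n + ∫ z in a..y, G z := fun y hy => by
      simp only [hE]
      congr 1
      refine intervalIntegral.integral_congr_ae ?_
      have h2 := hae (n + 1) hn
      rw [Filter.EventuallyEq, ae_restrict_iff' measurableSet_Icc] at h2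
      filter_upwards [h2] with z hz hz'
      rw [uIoc_of_le hy.1] at hz'
      have hz'' : z ∈ Icc a b := ⟨hz'.1.le, hz'.2.trans hy.2⟩
      rw [hz hz'', hGE z hz'']
    have h3 : HasDerivAt (fun y => r n + ∫ z in a..y, G z) (G x) x :=
      ((hGc.integral_hasStrictDerivAt a x).hasDerivAt).const_add _
    rw [hGE x hx] at h3
    exact h3.hasDerivWithinAt.congr hEq (hEq x hx)
  -- The bound of `D n` holds almost everywhere only. The continuous `E n` agrees almost everywhere
  -- with its truncation to [-|M|, |M|], hence everywhere.
  · have h2 : E n =ᵐ[volume.restrict (Icc a b)] fun x => max (min (E n x) |M|) (-|M|) := by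
      have h3 := hbd n (by omega)
      rw [restrict_Ioo_eq_restrict_Icc] at h3
      filter_upwards [hae n hn, h3] with y hy hy'
      rw [← hy, min_eq_left (abs_le.1 hy').2, max_eq_left (abs_le.1 hy').1]
    have h4 := Measure.eqOn_Icc_of_ae_eq volume hab.ne h2 (hcont n hn)
      (((hcont n hn).inf continuousOn_const).sup continuousOn_const) hx
    rw [h4, abs_le]
    exact ⟨le_max_right _ _, max_le (min_le_right _ _) (by linarith [abs_nonneg M])⟩

end OFSV

namespace OFSV

open MeasureTheory Set Filter Topology

/-! ### Restriction, translation and uniqueness of profiles -/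

variable {α β B : ℝ} {m : ℕ} {D : ℕ → ℝ → ℝ}

theorem IsProfile.mono (h : IsProfile α β B m D) {α' β' B' : ℝ} (hα : α ≤ α') (hβ : β' ≤ β)
    (hB : B ≤ B') : IsProfile α' β' B' m D where
  deriv n hn x hx := (h.deriv n hn x ⟨hα.trans hx.1, hx.2.trans hβ⟩).mono (Icc_subset_Icc hα hβ)
  bound n hn x hx := (h.bound n hn x ⟨hα.trans hx.1, hx.2.trans hβ⟩).trans hB
  lip n hn x hx y hy := (h.lip n hn x ⟨hα.trans hx.1, hx.2.trans hβ⟩ y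
    ⟨hα.trans hy.1, hy.2.trans hβ⟩).trans (mul_le_mul_of_nonneg_right hB (abs_nonneg _))

theorem IsProfile.shift (h : IsProfile α β B m D) (t : ℝ) :
    IsProfile (α - t) (β - t) B m (fun n y => D n (y + t)) where
  deriv n hn x hx := by
    have hm : MapsTo (fun y => y + t) (Icc (α - t) (β - t)) (Icc α β) := fun y hy =>
      ⟨by linarith [hy.1], by linarith [hy.2]⟩
    have := (h.deriv n hn (x + t) (hm hx)).comp x
      (((hasDerivAt_id x).add_const t).hasDerivWithinAt (s := Icc (α - t) (β - t))) hm
    simpa [Function.comp_def] using this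
  bound n hn x hx := h.bound n hn _ ⟨by linarith [hx.1], by linarith [hx.2]⟩
  lip n hn x hx y hy := by
    have := h.lip n hn (x + t) ⟨by linarith [hx.1], by linarith [hx.2]⟩ (y + t)
      ⟨by linarith [hy.1], by linarith [hy.2]⟩
    rwa [add_sub_add_right_eq_sub] at this

/-- Families of successive derivatives are determined by their first member. -/
theorem eq_of_hasDerivWithinAt {p q : ℝ} (hpq : p < q) {F G : ℕ → ℝ → ℝ}
    (hF : ∀ n < m, ∀ x ∈ Icc p q, HasDerivWithinAt (F n) (F (n + 1) x) (Icc p q) x)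
    (hG : ∀ n < m, ∀ x ∈ Icc p q, HasDerivWithinAt (G n) (G (n + 1) x) (Icc p q) x)
    (h0 : ∀ x ∈ Icc p q, F 0 x = G 0 x) : ∀ n ≤ m, ∀ x ∈ Icc p q, F n x = G n x := by
  intro n
  induction n with
  | zero => exact fun _ => h0
  | succ n ih =>
    intro hn x hx
    have h1 := hF n hn x hx
    have h2 := (hG n hn x hx).congr (fun y hy => ih (by omega) y hy) (ih (by omega) x hx)
    exact (uniqueDiffOn_Icc hpq x hx).eq_deriv _ h1 h2

/-! ### Taylor polynomials -/

/-- The Taylor polynomial of degree `≤ m` of `D n` at `y`. -/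
noncomputable def taylorPoly (D : ℕ → ℝ → ℝ) (n m : ℕ) (y : ℝ) : Polynomial ℝ :=
  ∑ r ∈ Finset.range (m + 1),
    Polynomial.C (D (n + r) y / r.factorial) * (Polynomial.X - Polynomial.C y) ^ r

theorem taylorPoly_zero (n : ℕ) (y : ℝ) : taylorPoly D n 0 y = Polynomial.C (D n y) := by
  simp [taylorPoly]

theorem derivative_taylorPoly (n m : ℕ) (y : ℝ) :
    Polynomial.derivative (taylorPoly D n (m + 1) y) = taylorPoly D (n + 1) m y := by
  rw [taylorPoly, Polynomial.derivative_sum, Finset.sum_range_succ', taylorPoly]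
  simp only [pow_zero, mul_one, Polynomial.derivative_C, add_zero]
  refine Finset.sum_congr rfl fun r _ => ?_
  rw [Polynomial.derivative_C_mul, Polynomial.derivative_X_sub_C_pow, Nat.add_sub_cancel,
    ← mul_assoc, ← Polynomial.C_mul, Nat.factorial_succ]
  congr 2
  have : (r.factorial : ℝ) ≠ 0 := by positivity
  have : (r + 1 : ℝ) ≠ 0 := by positivity
  push_cast
  rw [show n + (r + 1) = n + 1 + r by ring]
  field_simp

theorem taylorPoly_eval_self (n m : ℕ) (y : ℝ) : (taylorPoly D n m y).eval y = D n y := by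
  rw [taylorPoly, Polynomial.eval_finsetSum, Finset.sum_range_succ']
  simp

theorem natDegree_taylorPoly_le (n m : ℕ) (y : ℝ) : (taylorPoly D n m y).natDegree ≤ m := by
  refine Polynomial.natDegree_sum_le_of_forall_le _ _ fun r hr => ?_
  refine (Polynomial.natDegree_C_mul_le _ _).trans ?_
  rw [Polynomial.natDegree_pow, Polynomial.natDegree_X_sub_C, mul_one]
  exact Nat.lt_succ_iff.1 (Finset.mem_range.1 hr)

theorem iterate_derivative_taylorPoly_eval_self {n m l : ℕ} (hl : l ≤ m) (y : ℝ) :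
    (Polynomial.derivative^[l] (taylorPoly D n m y)).eval y = D (n + l) y := by
  induction l generalizing n m with
  | zero => exact taylorPoly_eval_self n m y
  | succ l ih =>
    obtain ⟨m, rfl⟩ : ∃ m', m = m' + 1 := ⟨m - 1, by omega⟩
    rw [Function.iterate_succ_apply, derivative_taylorPoly, ih (by omega)]
    congr 1
    ring

/-- Induction on the order: the derivative of the remainder is the remainder of `D (n + 1)` of one
order less, and the mean value inequality on the segment from y to x adds one power. The Lipschitz
bound starts the induction, so no derivative beyond `D m` is needed. -/
theorem IsProfile.taylor_bound (h : IsProfile α β B m D) {n l : ℕ} (hn : n + l ≤ m) {x y : ℝ}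
    (hx : x ∈ Icc α β) (hy : y ∈ Icc α β) :
    |D n x - (taylorPoly D n l y).eval x| ≤ B * |x - y| ^ (l + 1) := by
  have hB : 0 ≤ B := (abs_nonneg _).trans (h.bound 0 (Nat.zero_le m) x hx)
  induction l generalizing n x with
  | zero =>
    rw [taylorPoly_zero, Polynomial.eval_C, zero_add, pow_one]
    exact h.lip n (by omega) x hx y hy
  | succ l ih =>
    have hsub : uIcc y x ⊆ Icc α β := uIcc_subset_Icc hy hx
    have key := Convex.norm_image_sub_le_of_norm_hasDerivWithin_le
      (f := fun z => D n z - (taylorPoly D n (l + 1) y).eval z)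
      (f' := fun z => D (n + 1) z - (taylorPoly D (n + 1) l y).eval z)
      (C := B * |x - y| ^ (l + 1)) (s := uIcc y x) (x := y) (y := x)
      (fun z hz => ?_) (fun z hz => ?_) (convex_uIcc y x) left_mem_uIcc right_mem_uIcc
    · simp only [taylorPoly_eval_self, sub_self, sub_zero, Real.norm_eq_abs] at key
      rwa [mul_assoc, ← pow_succ] at key
    · have h2 := (taylorPoly D n (l + 1) y).hasDerivAt z
      rw [derivative_taylorPoly] at h2
      exact ((h.deriv n (by omega) z (hsub hz)).mono hsub).sub h2.hasDerivWithinAt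
    · refine (ih (by omega) (hsub hz)).trans (mul_le_mul_of_nonneg_left ?_ hB)
      exact pow_le_pow_left₀ (abs_nonneg _) (abs_sub_left_of_mem_uIcc hz) _

/-! ### The solution is constant along characteristics -/

variable {a b T : ℝ} {u : ℝ → ℝ → ℝ} {E : ℝ → ℕ → ℝ → ℝ}

theorem exists_near_ne (hab : a < b) {x ε : ℝ} (hx : x ∈ Icc a b) (hε : 0 < ε) :
    ∃ y ∈ Icc a b, y ≠ x ∧ |y - x| ≤ ε := by
  have hmin : 0 < min ε ((b - a) / 2) := lt_min hε (by linarith)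
  have h1 := min_le_left ε ((b - a) / 2)
  have h2 := min_le_right ε ((b - a) / 2)
  rcases le_total x ((a + b) / 2) with h | h
  · refine ⟨x + min ε ((b - a) / 2), ⟨by linarith [hx.1], by linarith⟩, by linarith, ?_⟩
    rw [add_sub_cancel_left, abs_of_pos hmin]
    exact h1
  · refine ⟨x - min ε ((b - a) / 2), ⟨by linarith, by linarith [hx.2]⟩, by linarith, ?_⟩
    rw [sub_sub_cancel_left, abs_neg, abs_of_pos hmin]
    exact h1

/-- A difference quotient of step η approximates the space derivative up to B η, uniformly in time,
and for fixed η it is continuous in time. Continuity in time of the values thus passes to the space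
derivative. -/
theorem tendsto_deriv_of_tendsto (hab : a < b) (hm : 1 ≤ m)
    (hE : ∀ t ∈ Icc 0 T, IsProfile a b B m (E t))
    (hcont : ∀ x ∈ Icc a b, ContinuousOn (fun t => E t 0 x) (Icc 0 T)) {x t : ℝ}
    (hx : x ∈ Icc a b) (ht : t ∈ Icc 0 T) :
    Tendsto (fun s => E s 1 x) (𝓝[Icc 0 T] t) (𝓝 (E t 1 x)) := by
  have hB : 0 ≤ B := (abs_nonneg _).trans ((hE t ht).bound 0 (Nat.zero_le m) x hx)
  rw [Metric.tendsto_nhds]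
  intro ε hε
  obtain ⟨y, hy, hyx, hyε⟩ := exists_near_ne hab hx (ε := ε / (4 * (B + 1))) (by positivity)
  set η := |y - x|
  have hη : 0 < η := abs_pos.2 (sub_ne_zero.2 hyx)
  have hBη : 2 * B * η < ε / 2 + ε * η * 0 := by
    rw [le_div_iff₀ (by positivity)] at hyε
    nlinarith
  have ev : ∀ z ∈ Icc a b, ∀ᶠ s in 𝓝[Icc 0 T] t, |E s 0 z - E t 0 z| < ε * η / 4 := fun z hz => by
    have := Metric.tendsto_nhds.1 (hcont z hz t ht) (ε * η / 4) (by positivity)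
    simpa only [Real.dist_eq] using this
  filter_upwards [ev x hx, ev y hy, self_mem_nhdsWithin] with s h1 h2 hs
  have hT : ∀ r ∈ Icc 0 T, |E r 0 y - E r 0 x - E r 1 x * (y - x)| ≤ B * η ^ 2 := fun r hr => by
    have := (hE r hr).taylor_bound (n := 0) (l := 1) (by omega) hy hx
    simp only [taylorPoly, Finset.sum_range_succ] at this
    simpa [sub_sub, η] using this
  have h3 := hT s hs
  have h4 := hT t ht
  rw [Real.dist_eq]
  have h5 : |E s 1 x - E t 1 x| * η < ε * η := by
    rw [← abs_mul]
    rw [abs_lt] at h1 h2 ⊢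
    rw [abs_le] at h3 h4
    have h6 : 2 * B * η * η < ε / 2 * η := by nlinarith
    constructor <;> nlinarith
  exact lt_of_mul_lt_mul_right h5 hη.le

/-- The equation gives partial derivatives only, so the chain rule is replaced by a decomposition of
the increment: a Taylor remainder in space at time r (`o1`), the change of the space derivative
between the times s and r (`o2`), and the time remainder at s (`o3`). The linear terms cancel by the
equation. -/
theorem hasDerivWithinAt_characteristic (hab : a < b) (hm : 1 ≤ m)
    (hE : ∀ t ∈ Icc 0 T, IsProfile a b B m (E t))
    (hEt : ∀ x ∈ Icc a b, ∀ t ∈ Icc 0 T,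
      HasDerivWithinAt (fun s => E s 0 x) (-E t 1 x) (Icc 0 T) t)
    {y s₁ s₂ s : ℝ} (hs₁ : 0 ≤ s₁) (hs₂ : s₂ ≤ T) (ha : a ≤ y + s₁) (hb : y + s₂ ≤ b)
    (hs : s ∈ Icc s₁ s₂) :
    HasDerivWithinAt (fun r => E r 0 (y + r)) 0 (Icc s₁ s₂) s := by
  have hx : ∀ r ∈ Icc s₁ s₂, y + r ∈ Icc a b := fun r hr =>
    ⟨by linarith [hr.1], by linarith [hr.2]⟩
  have hI : Icc s₁ s₂ ⊆ Icc 0 T := Icc_subset_Icc hs₁ hs₂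
  set x := y + s
  have hxs : x ∈ Icc a b := hx s hs
  have hB : 0 ≤ B := (abs_nonneg _).trans ((hE s (hI hs)).bound 0 (Nat.zero_le m) x hxs)
  have hle : 𝓝[Icc s₁ s₂] s ≤ 𝓝[Icc 0 T] s := nhdsWithin_mono s hI
  rw [hasDerivWithinAt_iff_isLittleO]
  have o3 := ((hasDerivWithinAt_iff_isLittleO.1 (hEt x hxs s (hI hs))).mono hle)
  have o2 : (fun r => (r - s) * (E r 1 x - E s 1 x)) =o[𝓝[Icc s₁ s₂] s] fun r => r - s := by
    have h1 : (fun r => E r 1 x - E s 1 x) =o[𝓝[Icc s₁ s₂] s] fun _ => (1 : ℝ) := by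
      rw [Asymptotics.isLittleO_one_iff]
      have := (tendsto_deriv_of_tendsto hab hm hE
        (fun x hx t ht => (hEt x hx t ht).continuousWithinAt) hxs (hI hs)).mono_left hle
      simpa using this.sub_const (E s 1 x)
    simpa using (Asymptotics.isBigO_refl (fun r => r - s) _).mul_isLittleO h1
  have o1 : (fun r => E r 0 (y + r) - E r 0 x - (r - s) * E r 1 x)
      =o[𝓝[Icc s₁ s₂] s] fun r => r - s := by
    have h1 : (fun r => E r 0 (y + r) - E r 0 x - (r - s) * E r 1 x)
        =O[𝓝[Icc s₁ s₂] s] fun r => (r - s) ^ 2 := by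
      refine Asymptotics.IsBigO.of_bound B ?_
      filter_upwards [self_mem_nhdsWithin] with r hr
      have := (hE r (hI hr)).taylor_bound (n := 0) (l := 1) (by omega) (hx r hr) hxs
      simp only [taylorPoly, Finset.sum_range_succ] at this
      rw [show y + r - x = r - s by simp only [x]; ring] at this
      simp only [Real.norm_eq_abs, abs_pow]
      refine le_trans (le_of_eq ?_) this
      congr 1
      simp [x]
      ring
    refine h1.trans_isLittleO ?_
    have h2 : (fun r => r - s) =o[𝓝[Icc s₁ s₂] s] fun _ => (1 : ℝ) := by
      rw [Asymptotics.isLittleO_one_iff]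
      have : Tendsto (fun r => r - s) (𝓝 s) (𝓝 (s - s)) := tendsto_id.sub_const s
      rw [sub_self] at this
      exact this.mono_left nhdsWithin_le_nhds
    simpa [sq] using (Asymptotics.isBigO_refl (fun r => r - s) _).mul_isLittleO h2
  refine ((o1.add o2).add o3).congr_left fun r => ?_
  simp only [smul_eq_mul, x]
  ring

theorem eq_along_characteristic (hab : a < b) (hm : 1 ≤ m)
    (hE : ∀ t ∈ Icc 0 T, IsProfile a b B m (E t))
    (hEt : ∀ x ∈ Icc a b, ∀ t ∈ Icc 0 T,
      HasDerivWithinAt (fun s => E s 0 x) (-E t 1 x) (Icc 0 T) t)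
    {y s t : ℝ} (hs : s ∈ Icc 0 T) (ht : t ∈ Icc 0 T) (hys : y + s ∈ Icc a b)
    (hyt : y + t ∈ Icc a b) : E s 0 (y + s) = E t 0 (y + t) := by
  wlog hst : s ≤ t generalizing s t
  · exact (this ht hs hyt hys (le_of_not_ge hst)).symm
  have hd := fun r (hr : r ∈ Icc s t) =>
    hasDerivWithinAt_characteristic hab hm hE hEt hs.1 ht.2 hys.1 hyt.2 hr
  exact (constant_of_has_deriv_right_zero (fun r hr => (hd r hr).continuousWithinAt)
    (fun r hr => (hd r ⟨hr.1, hr.2.le⟩).mono_of_mem_nhdsWithin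
      (mem_of_superset (Icc_mem_nhdsGE hr.2) (Icc_subset_Icc hr.1 le_rfl))) t ⟨hst, le_rfl⟩).symm

/-- The profiles at the different times are parts of a single profile. -/
theorem exists_glued_profile (hab : a < b) (hT : 0 < T) (hm : 1 ≤ m)
    (hE : ∀ t ∈ Icc 0 T, IsProfile a b B m (E t))
    (hEt : ∀ x ∈ Icc a b, ∀ t ∈ Icc 0 T,
      HasDerivWithinAt (fun s => E s 0 x) (-E t 1 x) (Icc 0 T) t) :
    ∃ B' D, IsProfile (a - T) b B' m D ∧
      ∀ x ∈ Icc a b, ∀ t ∈ Icc 0 T, E t 0 x = D 0 (x - t) := by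
  have hB : 0 ≤ B := (abs_nonneg _).trans
    ((hE 0 ⟨le_rfl, hT.le⟩).bound 0 (Nat.zero_le m) a ⟨le_rfl, hab.le⟩)
  -- The translated intervals [a - s, b - s] and [a - t, b - t] overlap in a nondegenerate interval.
  -- There the functions agree by transport along characteristics, and hence so do their
  -- derivatives.
  have hmatch : ∀ s ∈ Icc 0 T, ∀ t ∈ Icc 0 T, |s - t| < b - a → ∀ y, y + s ∈ Icc a b →
      y + t ∈ Icc a b → ∀ n ≤ m, E s n (y + s) = E t n (y + t) := by
    intro s hs t ht hst y hys hyt n hn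
    have h1 := (hE s hs).shift s
    have h2 := (hE t ht).shift t
    have hlt : a - min s t < b - max s t := by
      have := max_sub_min_eq_abs s t
      rw [abs_sub_comm] at this
      linarith
    refine eq_of_hasDerivWithinAt (m := m) hlt
      (h1.mono (by linarith [min_le_left s t]) (by linarith [le_max_left s t]) le_rfl).deriv
      (h2.mono (by linarith [min_le_right s t]) (by linarith [le_max_right s t]) le_rfl).deriv
      (fun x hx => ?_) n hn y ⟨?_, ?_⟩
    · have h3 := hx.1
      have h4 := hx.2
      have := min_le_left s t
      have := min_le_right s t
      have := le_max_left s t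
      have := le_max_right s t
      exact eq_along_characteristic hab hm hE hEt hs ht ⟨by linarith, by linarith⟩
        ⟨by linarith, by linarith⟩
    · have := min_choice s t
      rcases this with h | h <;> rw [h] <;> linarith [hys.1, hyt.1]
    · have := max_choice s t
      rcases this with h | h <;> rw [h] <;> linarith [hys.2, hyt.2]
  -- The time at which the characteristic with foot y passes the midpoint of [a, b], clamped to [0,
  -- T]. It is 1-Lipschitz, and at that time all feet of [a - T, b] within (b - a) / 4 of y are
  -- still inside [a, b].
  set τ : ℝ → ℝ := fun y => max 0 (min T ((a + b) / 2 - y)) with hτ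
  have hτm : ∀ y, τ y ∈ Icc 0 T := fun y => ⟨le_max_left _ _, max_le hT.le (min_le_left _ _)⟩
  have hτl : ∀ y z, |τ y - τ z| ≤ |y - z| := fun y z => by
    simp only [hτ]
    refine (abs_max_sub_max_le_max _ _ _ _).trans ?_
    simp only [sub_self, abs_zero, abs_nonneg, sup_of_le_right]
    refine (abs_min_sub_min_le_max _ _ _ _).trans ?_
    simp only [sub_self, abs_zero, abs_nonneg, sup_of_le_right]
    rw [abs_sub_comm y z]
    exact le_of_eq (congrArg _ (by ring))
  have hwin : ∀ y ∈ Icc (a - T) b, ∀ z ∈ Icc (a - T) b, |z - y| ≤ (b - a) / 4 →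
      z + τ y ∈ Icc a b := by
    intro y hy z hz hzy
    rw [abs_le] at hzy
    simp only [hτ]
    rcases le_total ((a + b) / 2 - y) 0 with h | h
    · rw [max_eq_left ((min_le_right _ _).trans h)]
      exact ⟨by linarith, by linarith [hz.2]⟩
    · rw [max_eq_right (le_min hT.le h)]
      rcases le_total T ((a + b) / 2 - y) with h' | h'
      · rw [min_eq_left h']
        exact ⟨by linarith [hz.1], by linarith⟩
      · rw [min_eq_right h']
        exact ⟨by linarith, by linarith⟩
  set D : ℕ → ℝ → ℝ := fun n y => E (τ y) n (y + τ y) with hD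
  have hself : ∀ y ∈ Icc (a - T) b, y + τ y ∈ Icc a b := fun y hy =>
    hwin y hy y hy (by rw [sub_self, abs_zero]; linarith)
  have hloc : ∀ y ∈ Icc (a - T) b, ∀ z ∈ Icc (a - T) b, |z - y| ≤ (b - a) / 4 → ∀ n ≤ m,
      D n z = E (τ y) n (z + τ y) := fun y hy z hz hzy n hn =>
    hmatch _ (hτm z) _ (hτm y) (by linarith [hτl z y]) z (hself z hz) (hwin y hy z hz hzy) n hn
  -- For |y - z| ≤ (b - a) / 4 the Lipschitz bound of one time slice applies. Otherwise the
  -- difference is at most 2B ≤ (8B / (b - a)) |y - z|.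
  refine ⟨B + 8 * B / (b - a), D, ⟨fun n hn y hy => ?_, fun n hn y hy => ?_,
    fun n hn y hy z hz => ?_⟩, fun x hx t ht => ?_⟩
  · have h1 : HasDerivWithinAt (fun z => E (τ y) n (z + τ y)) (D (n + 1) y)
        (Icc (a - τ y) (b - τ y)) y := ((hE (τ y) (hτm y)).shift (τ y)).deriv n hn y
      ⟨by linarith [(hself y hy).1], by linarith [(hself y hy).2]⟩
    have hnear : ∀ᶠ z in 𝓝[Icc (a - T) b] y, |z - y| ≤ (b - a) / 4 := by
      refine nhdsWithin_le_nhds ?_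
      filter_upwards [Metric.closedBall_mem_nhds y (by linarith : 0 < (b - a) / 4)] with z hz
      rwa [Metric.mem_closedBall, Real.dist_eq] at hz
    have h2 : HasDerivWithinAt (fun z => E (τ y) n (z + τ y)) (D (n + 1) y) (Icc (a - T) b) y := by
      refine h1.mono_of_mem_nhdsWithin ?_
      filter_upwards [hnear, self_mem_nhdsWithin] with z hz hz'
      have := hwin y hy z hz' hz
      exact ⟨by linarith [this.1], by linarith [this.2]⟩
    refine h2.congr_of_eventuallyEq_of_mem ?_ hy
    filter_upwards [hnear, self_mem_nhdsWithin] with z hz hz'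
    exact hloc y hy z hz' hz n hn.le
  · exact ((hE _ (hτm y)).bound n hn _ (hself y hy)).trans
      (le_add_of_nonneg_right (div_nonneg (by positivity) (by linarith)))
  · rcases le_total (|z - y|) ((b - a) / 4) with h | h
    · rw [hloc y hy z hz h n hn]
      have := (hE _ (hτm y)).lip n hn _ (hself y hy) _ (hwin y hy z hz h)
      rw [add_sub_add_right_eq_sub] at this
      refine this.trans (mul_le_mul_of_nonneg_right ?_ (abs_nonneg _))
      exact le_add_of_nonneg_right (div_nonneg (by positivity) (by linarith))
    · have h1 := (hE _ (hτm y)).bound n hn _ (hself y hy)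
      have h2 := (hE _ (hτm z)).bound n hn _ (hself z hz)
      have h3 : |D n y - D n z| ≤ 2 * B := (abs_sub _ _).trans (by linarith)
      rw [abs_sub_comm z y] at h
      have h4 : 2 * B ≤ 8 * B / (b - a) * |y - z| := by
        rw [div_mul_eq_mul_div, le_div_iff₀ (by linarith)]
        nlinarith
      refine h3.trans (h4.trans (mul_le_mul_of_nonneg_right ?_ (abs_nonneg _)))
      linarith
  · have hy : x - t ∈ Icc (a - T) b := ⟨by linarith [hx.1, ht.2], by linarith [hx.2, ht.1]⟩
    have := eq_along_characteristic hab hm hE hEt ht (hτm (x - t)) (y := x - t)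
      (by simpa using hx) (hself _ hy)
    rw [sub_add_cancel] at this
    exact this

/-- A smooth solution of the transport equation is a travelling wave `D 0 (x - t)`. -/
theorem IsSolution.exists_profile {bc : Boundary} {u₀ g : ℝ → ℝ} (hab : a < b) (hT : 0 < T)
    (hm : 1 ≤ m) (hu : IsSolution bc a b T u₀ g u)
    (hreg : ∃ B : ℝ, ∀ t ∈ Icc 0 T, SobolevBound a b (m + 1) B (fun x => u x t)) :
    ∃ B D, IsProfile (a - T) b B m D ∧ ∀ x ∈ Icc a b, ∀ t ∈ Icc 0 T, u x t = D 0 (x - t) := by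
  obtain ⟨M, hM⟩ := hreg
  have hE : ∀ t, ∃ E : ℕ → ℝ → ℝ, t ∈ Icc 0 T →
      (∀ x ∈ Icc a b, E 0 x = u x t) ∧ IsProfile a b |M| m E := fun t => by
    by_cases ht : t ∈ Icc 0 T
    · obtain ⟨E, hE⟩ := (hM t ht).exists_classical hab fun x hx => by
        obtain ⟨p, q, _, hq, _⟩ := hu.pde x hx t ht
        exact hq.continuousWithinAt
      exact ⟨E, fun _ => hE⟩
    · exact ⟨fun _ _ => 0, fun h => absurd h ht⟩
  choose E hE using hE
  have hEt : ∀ x ∈ Icc a b, ∀ t ∈ Icc 0 T,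
      HasDerivWithinAt (fun s => E s 0 x) (-E t 1 x) (Icc 0 T) t := fun x hx t ht => by
    obtain ⟨p, q, hp, hq, hpq⟩ := hu.pde x hx t ht
    have h1 := (hE t ht).2.deriv 0 (by omega) x hx
    have h2 : q = E t 1 x := (uniqueDiffOn_Icc hab x hx).eq_deriv _ hq
      (h1.congr (fun y hy => ((hE t ht).1 y hy).symm) ((hE t ht).1 x hx).symm)
    have h3 : p = -E t 1 x := by linarith
    rw [← h3]
    exact hp.congr (fun s hs => (hE s hs).1 x hx) ((hE t ht).1 x hx)
  obtain ⟨B, D, h1, h2⟩ := exists_glued_profile hab hT hm (fun t ht => (hE t ht).2) hEt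
  exact ⟨B, D, h1, fun x hx t ht => by rw [← h2 x hx t ht, (hE t ht).1 x hx]⟩

/-- A travelling wave is differentiated in time. -/
theorem IsProfile.hasDerivWithinAt_time (h : IsProfile (a - T) b B m D) {n : ℕ} (hn : n < m)
    {x t : ℝ} (hx : x ∈ Icc a b) (ht : t ∈ Icc 0 T) :
    HasDerivWithinAt (fun s => D n (x - s)) (-D (n + 1) (x - t)) (Icc 0 T) t := by
  have hm : MapsTo (fun s => x - s) (Icc 0 T) (Icc (a - T) b) := fun s hs =>
    ⟨by linarith [hs.2, hx.1], by linarith [hs.1, hx.2]⟩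
  have := (h.deriv n hn (x - t) (hm ht)).comp t
    (((hasDerivAt_id t).const_sub x).hasDerivWithinAt (s := Icc 0 T)) hm
  simpa [Function.comp_def] using this

/-- Periodicity is given for `D 0` only; it is differentiated in time, and the sign (-1)^n turns
D_n(x - t) into successive time derivatives, so that uniqueness applies. -/
theorem IsProfile.periodic (h : IsProfile (a - T) b B m D) (hab : a ≤ b) (hT : 0 < T)
    (h0 : ∀ t ∈ Icc 0 T, D 0 (a - t) = D 0 (b - t)) :
    ∀ n ≤ m, ∀ t ∈ Icc 0 T, D n (a - t) = D n (b - t) := by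
  have key : ∀ x ∈ Icc a b, ∀ n < m, ∀ t ∈ Icc 0 T,
      HasDerivWithinAt (fun s => (-1) ^ n * D n (x - s)) ((-1) ^ (n + 1) * D (n + 1) (x - t))
        (Icc 0 T) t := fun x hx n hn t ht => by
    have := (h.hasDerivWithinAt_time hn hx ht).const_mul ((-1 : ℝ) ^ n)
    rwa [show (-1 : ℝ) ^ n * -D (n + 1) (x - t) = (-1) ^ (n + 1) * D (n + 1) (x - t) by
      ring] at this
  intro n hn t ht
  have := eq_of_hasDerivWithinAt (m := m) hT (F := fun n t => (-1) ^ n * D n (a - t))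
    (G := fun n t => (-1) ^ n * D n (b - t)) (key a ⟨le_rfl, hab⟩) (key b ⟨hab, le_rfl⟩)
    (fun s hs => by simpa using h0 s hs) n hn t ht
  exact mul_left_cancel₀ (by simp) this

/-- Each time derivative of D₀(a - t) = g(t) produces a factor -1, which the sign in `inflowData`
removes. The exterior data are therefore exact derivatives of the wave. -/
theorem IsProfile.inflowData_eq (h : IsProfile (a - T) b B m D) (hab : a ≤ b) (hT : 0 < T)
    {g : ℝ → ℝ} (h0 : ∀ t ∈ Icc 0 T, D 0 (a - t) = g t) :
    ∀ n ≤ m, ∀ t ∈ Icc 0 T, inflowData T g t n = D n (a - t) := by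
  have key : ∀ n ≤ m, ∀ t ∈ Icc 0 T,
      iteratedDerivWithin n g (Icc 0 T) t = (-1) ^ n * D n (a - t) := by
    intro n
    induction n with
    | zero => intro _ t ht; simp [h0 t ht]
    | succ n ih =>
      intro hn t ht
      have h1 := (h.hasDerivWithinAt_time hn ⟨le_rfl, hab⟩ ht).const_mul ((-1 : ℝ) ^ n)
      rw [show (-1 : ℝ) ^ n * -D (n + 1) (a - t) = (-1) ^ (n + 1) * D (n + 1) (a - t) by
        ring] at h1
      rw [iteratedDerivWithin_succ]
      have h2 := h1.congr (fun s hs => ih (by omega) s hs) (ih (by omega) t ht)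
      exact h2.derivWithin (uniqueDiffOn_Icc hT t ht)
  intro n hn t ht
  rw [inflowData, key n hn t ht, ← mul_assoc, ← mul_pow]
  simp

end OFSV

namespace OFSV

open Polynomial Finset

variable {m : Method} {k : ℕ} {c : Fin (k + 2) → ℝ}

/-! ### Bounds for the functionals of the scheme -/

/-- The `l`-th derivative at `s`. -/
noncomputable def traceDeriv (s : ℝ) (l : ℕ) : ℝ[X] →ₗ[ℝ] ℝ :=
  (leval s).comp ((derivative : ℝ[X] →ₗ[ℝ] ℝ[X]) ^ l)

theorem traceDeriv_apply (s : ℝ) (l : ℕ) (p : ℝ[X]) :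
    traceDeriv s l p = (derivative^[l] p).eval s := by
  simp [traceDeriv, Module.End.pow_apply, leval_apply]

theorem iterate_derivative_eval_cell (α : ℝ) {δ : ℝ} (hδ : δ ≠ 0) (s : ℝ) (l : ℕ) (p : ℝ[X]) :
    (derivative^[l] p).eval (α + δ * s) = (δ ^ l)⁻¹ * traceDeriv s l (toRef α δ p) := by
  rw [traceDeriv_apply, iterate_derivative_toRef, eval_mul, eval_C, toRef_eval]
  field_simp

/-- A bound for the functionals that occur in the scheme. -/
structure IsFunctionalBound (m : Method) (k : ℕ) (c : Fin (k + 2) → ℝ) (K : ℝ) : Prop where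
  nonneg : 0 ≤ K
  star : ∀ j, ∀ p : ℝ[X], p.natDegree ≤ k → |star m k c j p| ≤ K * nodeNorm c p
  cvInt : ∀ j, ∀ p : ℝ[X], p.natDegree ≤ k → |cvInt c j p| ≤ K * nodeNorm c p
  damp : ∀ l ≤ k, ∀ j, ∀ p : ℝ[X], p.natDegree ≤ k → |dampInt c l j p| ≤ K * nodeNorm c p
  trace : ∀ l ≤ k, ∀ s : ℝ, s = 0 ∨ s = 1 → ∀ p : ℝ[X], p.natDegree ≤ k →
    |traceDeriv s l p| ≤ K * nodeNorm c p

theorem exists_isFunctionalBound (hc : IsCVNodes m k c) : ∃ K, IsFunctionalBound m k c K := by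
  obtain ⟨K₁, h₁, H₁⟩ := exists_abs_le_nodeNorm hc (fun j => star m k c j)
  obtain ⟨K₂, h₂, H₂⟩ := exists_abs_le_nodeNorm hc (fun j => cvInt c j)
  obtain ⟨K₃, h₃, H₃⟩ := exists_abs_le_nodeNorm hc
    (fun q : Fin (k + 1) × Fin (k + 1) => dampInt c q.1 q.2)
  obtain ⟨K₄, h₄, H₄⟩ := exists_abs_le_nodeNorm hc (fun l : Fin (k + 1) => traceDeriv 0 l)
  obtain ⟨K₅, h₅, H₅⟩ := exists_abs_le_nodeNorm hc (fun l : Fin (k + 1) => traceDeriv 1 l)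
  have mono : ∀ {x K : ℝ} {p : ℝ[X]}, x ≤ K * nodeNorm c p → K ≤ K₁ + K₂ + K₃ + K₄ + K₅ →
      x ≤ (K₁ + K₂ + K₃ + K₄ + K₅) * nodeNorm c p := fun h h' =>
    h.trans (mul_le_mul_of_nonneg_right h' (nodeNorm_nonneg _))
  refine ⟨K₁ + K₂ + K₃ + K₄ + K₅, ⟨by positivity, fun j p hp => mono (H₁ j p hp) (by linarith),
    fun j p hp => mono (H₂ j p hp) (by linarith),
    fun l hl j p hp => mono (H₃ (⟨l, by omega⟩, j) p hp) (by linarith), fun l hl s hs p hp => ?_⟩⟩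
  rcases hs with rfl | rfl
  · exact mono (H₄ ⟨l, by omega⟩ p hp) (by linarith)
  · exact mono (H₅ ⟨l, by omega⟩ p hp) (by linarith)

/-! ### Interpolation of smooth functions on one cell -/

variable {α β B : ℝ} {D : ℕ → ℝ → ℝ}

/-- The interpolant of `D n` on the cell `(y, y + δ)`, in reference coordinates. -/
noncomputable def cellItp (c : Fin (k + 2) → ℝ) (D : ℕ → ℝ → ℝ) (n : ℕ) (y δ : ℝ) : ℝ[X] :=
  itp c fun j => D n (y + δ * c j.succ)

theorem node_mem (hc : IsCVNodes m k c) (j : Fin (k + 2)) : c j ∈ Set.Icc (0 : ℝ) 1 :=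
  ⟨hc.first ▸ hc.strictMono.monotone (Fin.zero_le j),
    hc.last ▸ hc.strictMono.monotone (Fin.le_last j)⟩

theorem cell_mem {y δ s : ℝ} (hδ : 0 ≤ δ) (hy : y ∈ Set.Icc α β) (hy' : y + δ ∈ Set.Icc α β)
    (hs : s ∈ Set.Icc (0 : ℝ) 1) : y + δ * s ∈ Set.Icc α β := by
  have h1 := mul_nonneg hδ hs.1
  have h2 := mul_le_mul_of_nonneg_left hs.2 hδ
  exact ⟨by linarith [hy.1], by linarith [hy'.2]⟩

theorem cell_dist {y δ s r : ℝ} (hδ : 0 ≤ δ) (hs : s ∈ Set.Icc (0 : ℝ) 1)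
    (hr : r ∈ Set.Icc (0 : ℝ) 1) : |y + δ * s - (y + δ * r)| ≤ δ := by
  rw [add_sub_add_left_eq_sub, ← mul_sub, abs_mul, abs_of_nonneg hδ]
  have : |s - r| ≤ 1 := abs_le.2 ⟨by linarith [hs.1, hr.2], by linarith [hs.2, hr.1]⟩
  nlinarith

theorem IsProfile.taylor_bound_cell {M : ℕ} (h : IsProfile α β B M D) {n l : ℕ} (hn : n + l ≤ M)
    {y δ s r : ℝ} (hδ : 0 ≤ δ) (hy : y ∈ Set.Icc α β) (hy' : y + δ ∈ Set.Icc α β)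
    (hs : s ∈ Set.Icc (0 : ℝ) 1) (hr : r ∈ Set.Icc (0 : ℝ) 1) :
    |D n (y + δ * s) - (toRef y δ (taylorPoly D n l (y + δ * r))).eval s| ≤ B * δ ^ (l + 1) := by
  have hB : 0 ≤ B := (abs_nonneg _).trans (h.bound 0 (Nat.zero_le M) y hy)
  rw [toRef_eval]
  refine (h.taylor_bound hn (cell_mem hδ hy hy' hs) (cell_mem hδ hy hy' hr)).trans ?_
  exact mul_le_mul_of_nonneg_left (pow_le_pow_left₀ (abs_nonneg _) (cell_dist hδ hs hr) _) hB

theorem nodeNorm_cellItp_sub_le (hc : IsCVNodes m k c) {M : ℕ} (h : IsProfile α β B M D) {n l : ℕ}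
    (hn : n + l ≤ M) {y δ r : ℝ} (hδ : 0 ≤ δ) (hy : y ∈ Set.Icc α β) (hy' : y + δ ∈ Set.Icc α β)
    (hr : r ∈ Set.Icc (0 : ℝ) 1) :
    nodeNorm c (cellItp c D n y δ - itp c fun j =>
      (toRef y δ (taylorPoly D n l (y + δ * r))).eval (c j.succ)) ≤ (k + 1) * (B * δ ^ (l + 1)) := by
  rw [cellItp, ← map_sub]
  exact nodeNorm_itp_le hc fun j => h.taylor_bound_cell hn hδ hy hy' (node_mem hc _) hr

/-- The profile is expanded at the end point `y + δ * s` itself: there the l-th derivative of the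
Taylor polynomial is exact, and interpolation reproduces the polynomial. The remainder is controlled
through the nodal values. -/
theorem exists_trace_bound (hc : IsCVNodes m k c) (h : IsProfile α β B (k + 2) D) :
    ∃ K, 0 ≤ K ∧ ∀ n ≤ 2, ∀ l ≤ k, ∀ s : ℝ, s = 0 ∨ s = 1 → ∀ y δ, 0 ≤ δ → y ∈ Set.Icc α β →
      y + δ ∈ Set.Icc α β →
      |traceDeriv s l (cellItp c D n y δ) - δ ^ l * D (n + l) (y + δ * s)| ≤ K * δ ^ (k + 1) := by
  obtain ⟨K, hK⟩ := exists_isFunctionalBound hc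
  refine ⟨K * ((k + 1) * |B|), mul_nonneg hK.nonneg (by positivity),
    fun n hn l hl s hs y δ hδ hy hy' => ?_⟩
  have hs' : s ∈ Set.Icc (0 : ℝ) 1 := by rcases hs with rfl | rfl <;> simp
  have h1 := nodeNorm_cellItp_sub_le hc h (n := n) (l := k) (by omega) hδ hy hy' hs'
  have hd := natDegree_toRef_le y δ (natDegree_taylorPoly_le (D := D) n k (y + δ * s))
  rw [itp_eq_self hc hd] at h1
  have h2 := hK.trace l hl s hs _ ((natDegree_sub_le _ _).trans (max_le
    (natDegree_itp_le hc (fun j => D n (y + δ * c j.succ))) hd))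
  rw [map_sub, traceDeriv_apply _ _ (toRef _ _ _), iterate_derivative_toRef, eval_mul, eval_C,
    toRef_eval, iterate_derivative_taylorPoly_eval_self hl] at h2
  refine h2.trans ((mul_le_mul_of_nonneg_left h1 hK.nonneg).trans (le_of_eq ?_))
  rw [abs_of_nonneg ((abs_nonneg _).trans (h.bound 0 (Nat.zero_le _) y hy))]
  ring

/-- The Taylor polynomial of degree k + 1 of `D n` has as derivative that of degree k of `D (n +
1)`, which interpolation reproduces. The factor δ in front of the integral supplies the last power.
-/
theorem exists_flux_bound (hc : IsCVNodes m k c) (h : IsProfile α β B (k + 2) D) :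
    ∃ K, 0 ≤ K ∧ ∀ n ≤ 1, ∀ j : Fin (k + 1), ∀ y δ, 0 ≤ δ → y ∈ Set.Icc α β →
      y + δ ∈ Set.Icc α β →
      |D n (y + δ * c j.succ) - D n (y + δ * c j.castSucc)
        - δ * cvInt c j (cellItp c D (n + 1) y δ)| ≤ K * δ ^ (k + 2) := by
  obtain ⟨K, hK⟩ := exists_isFunctionalBound hc
  refine ⟨(2 + K * (k + 1)) * |B|, mul_nonneg (add_nonneg zero_le_two
    (mul_nonneg hK.nonneg (by positivity))) (abs_nonneg B), fun n hn j y δ hδ hy hy' => ?_⟩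
  have hB : 0 ≤ B := (abs_nonneg _).trans (h.bound 0 (Nat.zero_le _) y hy)
  have h0 : (0 : ℝ) ∈ Set.Icc (0 : ℝ) 1 := by simp
  have h1 := nodeNorm_cellItp_sub_le hc h (n := n + 1) (l := k) (by omega) hδ hy hy' h0
  have hd := natDegree_toRef_le y δ (natDegree_taylorPoly_le (D := D) (n + 1) k (y + δ * 0))
  rw [itp_eq_self hc hd] at h1
  have h2 := hK.cvInt j _ ((natDegree_sub_le _ _).trans (max_le
    (natDegree_itp_le hc (fun j => D (n + 1) (y + δ * c j.succ))) hd))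
  rw [map_sub] at h2
  have h3 := polyInt_derivative (c j.castSucc) (c j.succ) (toRef y δ (taylorPoly D n (k + 1) (y + δ * 0)))
  rw [derivative_toRef, derivative_taylorPoly, ← smul_eq_C_mul, map_smul, smul_eq_mul] at h3
  have h4 := h.taylor_bound_cell (n := n) (l := k + 1) (by omega) hδ hy hy'
    (node_mem hc j.succ) h0
  have h5 := h.taylor_bound_cell (n := n) (l := k + 1) (by omega) hδ hy hy'
    (node_mem hc j.castSucc) h0
  have h6 : |δ * (cvInt c j (cellItp c D (n + 1) y δ)
      - cvInt c j (toRef y δ (taylorPoly D (n + 1) k (y + δ * 0))))|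
      ≤ δ * (K * ((k + 1) * (B * δ ^ (k + 1)))) := by
    rw [abs_mul, abs_of_nonneg hδ]
    exact mul_le_mul_of_nonneg_left (h2.trans (mul_le_mul_of_nonneg_left h1 hK.nonneg)) hδ
  have h3' : δ * cvInt c j (toRef y δ (taylorPoly D (n + 1) k (y + δ * 0)))
      = (toRef y δ (taylorPoly D n (k + 1) (y + δ * 0))).eval (c j.succ)
      - (toRef y δ (taylorPoly D n (k + 1) (y + δ * 0))).eval (c j.castSucc) := h3
  rw [mul_sub, h3'] at h6
  have h7 : δ * (K * ((k + 1) * (B * δ ^ (k + 1)))) = K * (k + 1) * B * δ ^ (k + 2) := by ring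
  rw [h7] at h6
  rw [abs_of_nonneg hB]
  rw [abs_le] at *
  constructor <;> nlinarith

/-- Over the whole cell one more power is gained, since by `polyInt_itp_eq` interpolation preserves
the integral of the Taylor polynomial of degree k + 1. The expansion of `D 0` to degree k + 2 uses
the Lipschitz continuity of `D (k + 2)`, that is, W^{k+3,∞}. -/
theorem exists_flux_sum_bound (hc : IsCVNodes m k c) (hk : 1 ≤ k) (hkL : m = .LSV → 2 ≤ k)
    (h : IsProfile α β B (k + 2) D) :
    ∃ K, 0 ≤ K ∧ ∀ y δ, 0 ≤ δ → y ∈ Set.Icc α β → y + δ ∈ Set.Icc α β →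
      |D 0 (y + δ) - D 0 y - δ * polyInt 0 1 (cellItp c D 1 y δ)| ≤ K * δ ^ (k + 3) := by
  obtain ⟨K, hK0, hK⟩ := exists_abs_le_nodeNorm hc (fun _ : Unit => polyInt 0 1)
  refine ⟨(2 + K * (k + 1)) * |B|, mul_nonneg (add_nonneg zero_le_two
    (mul_nonneg hK0 (by positivity))) (abs_nonneg B), fun y δ hδ hy hy' => ?_⟩
  have hB : 0 ≤ B := (abs_nonneg _).trans (h.bound 0 (Nat.zero_le _) y hy)
  have h0 : (0 : ℝ) ∈ Set.Icc (0 : ℝ) 1 := by simp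
  have h1 := nodeNorm_cellItp_sub_le hc h (n := 1) (l := k + 1) (by omega) hδ hy hy' h0
  have h2 := hK () _ ((natDegree_sub_le _ _).trans (max_le
    (natDegree_itp_le hc (fun j => D 1 (y + δ * c j.succ)))
    (natDegree_itp_le hc fun j =>
      (toRef y δ (taylorPoly D 1 (k + 1) (y + δ * 0))).eval (c j.succ))))
  rw [map_sub, polyInt_itp_eq hc hk hkL
    (natDegree_toRef_le y δ (natDegree_taylorPoly_le (D := D) 1 (k + 1) (y + δ * 0)))] at h2
  have h3 := polyInt_derivative 0 1 (toRef y δ (taylorPoly D 0 (k + 2) (y + δ * 0)))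
  rw [derivative_toRef, derivative_taylorPoly, ← smul_eq_C_mul, map_smul, smul_eq_mul,
    zero_add] at h3
  have h4 := h.taylor_bound_cell (n := 0) (l := k + 2) (s := 1) (by omega) hδ hy hy' (by simp) h0
  have h5 := h.taylor_bound_cell (n := 0) (l := k + 2) (by omega) hδ hy hy' h0 h0
  have h6 : |δ * (polyInt 0 1 (cellItp c D 1 y δ)
      - polyInt 0 1 (toRef y δ (taylorPoly D 1 (k + 1) (y + δ * 0))))|
      ≤ δ * (K * ((k + 1) * (B * δ ^ (k + 2)))) := by
    rw [abs_mul, abs_of_nonneg hδ]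
    exact mul_le_mul_of_nonneg_left (h2.trans (mul_le_mul_of_nonneg_left h1 hK0)) hδ
  rw [mul_sub, h3] at h6
  have h7 : δ * (K * ((k + 1) * (B * δ ^ (k + 2)))) = K * (k + 1) * B * δ ^ (k + 3) := by ring
  rw [h7] at h6
  have h8 : y + δ * (0 : ℝ) = y := by ring
  have h9 : y + δ * (1 : ℝ) = y + δ := by ring
  rw [h9] at h4
  rw [h8] at h4 h5 h6
  rw [abs_of_nonneg hB]
  rw [abs_le] at *
  constructor <;> nlinarith

/-- Damping annihilates constants, so only the variation of the interpolant over the cell counts. -/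
theorem exists_damp_bound (hc : IsCVNodes m k c) (h : IsProfile α β B (k + 2) D) :
    ∃ K, 0 ≤ K ∧ ∀ n ≤ k + 2, ∀ l ≤ k, ∀ j : Fin (k + 1), ∀ y δ, 0 ≤ δ → y ∈ Set.Icc α β →
      y + δ ∈ Set.Icc α β → |dampInt c l j (cellItp c D n y δ)| ≤ K * δ := by
  obtain ⟨K, hK⟩ := exists_isFunctionalBound hc
  refine ⟨K * ((k + 1) * |B|), mul_nonneg hK.nonneg (by positivity),
    fun n hn l hl j y δ hδ hy hy' => ?_⟩
  have h0 : (0 : ℝ) ∈ Set.Icc (0 : ℝ) 1 := by simp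
  have h1 := nodeNorm_cellItp_sub_le hc h (n := n) (l := 0) (by omega) hδ hy hy' h0
  have hd := natDegree_toRef_le y δ ((natDegree_taylorPoly_le (D := D) n 0 (y + δ * 0)).trans
    (Nat.zero_le k))
  rw [itp_eq_self hc hd] at h1
  have h2 := hK.damp l hl j _ ((natDegree_sub_le _ _).trans (max_le
    (natDegree_itp_le hc (fun j => D n (y + δ * c j.succ))) hd))
  have h3 : toRef y δ (taylorPoly D n 0 (y + δ * 0)) = C (D n (y + δ * 0)) := by
    rw [taylorPoly_zero, toRef, C_comp]
  rw [map_sub, h3, dampInt_C, sub_zero] at h2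
  rw [h3] at h1
  refine h2.trans ((mul_le_mul_of_nonneg_left h1 hK.nonneg).trans (le_of_eq ?_))
  rw [abs_of_nonneg ((abs_nonneg _).trans (h.bound 0 (Nat.zero_le _) y hy))]
  ring

/-- The constants of the interpolation estimates. -/
structure IsCellBound {k : ℕ} (c : Fin (k + 2) → ℝ) (D : ℕ → ℝ → ℝ) (α β K : ℝ) : Prop where
  nonneg : 0 ≤ K
  trace : ∀ n ≤ 2, ∀ l ≤ k, ∀ s : ℝ, s = 0 ∨ s = 1 → ∀ y δ, 0 ≤ δ → y ∈ Set.Icc α β →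
    y + δ ∈ Set.Icc α β →
    |traceDeriv s l (cellItp c D n y δ) - δ ^ l * D (n + l) (y + δ * s)| ≤ K * δ ^ (k + 1)
  flux : ∀ n ≤ 1, ∀ j : Fin (k + 1), ∀ y δ, 0 ≤ δ → y ∈ Set.Icc α β → y + δ ∈ Set.Icc α β →
    |D n (y + δ * c j.succ) - D n (y + δ * c j.castSucc)
      - δ * cvInt c j (cellItp c D (n + 1) y δ)| ≤ K * δ ^ (k + 2)
  flux_sum : ∀ y δ, 0 ≤ δ → y ∈ Set.Icc α β → y + δ ∈ Set.Icc α β →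
    |D 0 (y + δ) - D 0 y - δ * polyInt 0 1 (cellItp c D 1 y δ)| ≤ K * δ ^ (k + 3)
  damp : ∀ n ≤ k + 2, ∀ l ≤ k, ∀ j : Fin (k + 1), ∀ y δ, 0 ≤ δ → y ∈ Set.Icc α β →
    y + δ ∈ Set.Icc α β → |dampInt c l j (cellItp c D n y δ)| ≤ K * δ

theorem IsProfile.exists_isCellBound (hc : IsCVNodes m k c) (hk : 1 ≤ k) (hkL : m = .LSV → 2 ≤ k)
    (h : IsProfile α β B (k + 2) D) : ∃ K, IsCellBound c D α β K := by
  obtain ⟨K₁, h₁, H₁⟩ := exists_trace_bound hc h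
  obtain ⟨K₂, h₂, H₂⟩ := exists_flux_bound hc h
  obtain ⟨K₃, h₃, H₃⟩ := exists_flux_sum_bound hc hk hkL h
  obtain ⟨K₄, h₄, H₄⟩ := exists_damp_bound hc h
  refine ⟨K₁ + K₂ + K₃ + K₄, ⟨by positivity, fun n hn l hl s hs y δ hδ hy hy' => ?_,
    fun n hn j y δ hδ hy hy' => ?_, fun y δ hδ hy hy' => ?_, fun n hn l hl j y δ hδ hy hy' => ?_⟩⟩
  · exact (H₁ n hn l hl s hs y δ hδ hy hy').trans
      (mul_le_mul_of_nonneg_right (by linarith) (by positivity))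
  · exact (H₂ n hn j y δ hδ hy hy').trans
      (mul_le_mul_of_nonneg_right (by linarith) (by positivity))
  · exact (H₃ y δ hδ hy hy').trans (mul_le_mul_of_nonneg_right (by linarith) (by positivity))
  · exact (H₄ n hn l hl j y δ hδ hy hy').trans
      (mul_le_mul_of_nonneg_right (by linarith) (by positivity))

end OFSV

namespace OFSV

open Polynomial Finset

variable {m : Method} {k : ℕ} {c : Fin (k + 2) → ℝ} {a b : ℝ} {N : ℕ}

/-! ### Geometry of the mesh -/

theorem Mesh.len_pos (M : Mesh a b N) (i : Fin N) : 0 < M.len i :=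
  sub_pos.2 (M.strictMono (Fin.castSucc_lt_succ))

theorem Mesh.left_add_len (M : Mesh a b N) (i : Fin N) : M.left i + M.len i = M.right i := by
  simp [Mesh.len]

theorem Mesh.len_le_h (M : Mesh a b N) (i : Fin N) : M.len i ≤ M.h :=
  le_ciSup (Set.finite_range M.len).bddAbove i

theorem Mesh.left_mem (M : Mesh a b N) (i : Fin N) : M.left i ∈ Set.Icc a b :=
  ⟨M.first.symm.trans_le (M.strictMono.monotone (Fin.zero_le _)),
    (M.strictMono.monotone (Fin.le_last _)).trans_eq M.last⟩

theorem Mesh.right_mem (M : Mesh a b N) (i : Fin N) : M.right i ∈ Set.Icc a b :=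
  ⟨M.first.symm.trans_le (M.strictMono.monotone (Fin.zero_le _)),
    (M.strictMono.monotone (Fin.le_last _)).trans_eq M.last⟩

theorem Mesh.sum_len (M : Mesh a b N) : ∑ i, M.len i = b - a := by
  have h := sum_sub_castSucc M.node 0
  simp only [Fin.zero_le, filter_true] at h
  rw [M.first, M.last] at h
  exact h

theorem Mesh.pt_mem (M : Mesh a b N) (hc : IsCVNodes m k c) (i : Fin N) (j : Fin (k + 2)) :
    M.pt c i j ∈ Set.Icc a b :=
  cell_mem (M.len_pos i).le (M.left_mem i) (by rw [M.left_add_len]; exact M.right_mem i)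
    (node_mem hc j)

theorem Mesh.left_zero [NeZero N] (M : Mesh a b N) : M.left 0 = a := by
  obtain ⟨n, rfl⟩ : ∃ n, N = n + 1 := ⟨N - 1, (Nat.succ_pred (NeZero.ne N)).symm⟩
  exact M.first

theorem Mesh.right_zero_sub_one [NeZero N] (M : Mesh a b N) : M.right (0 - 1) = b := by
  obtain ⟨n, rfl⟩ : ∃ n, N = n + 1 := ⟨N - 1, (Nat.succ_pred (NeZero.ne N)).symm⟩
  have : (0 - 1 : Fin (n + 1)).succ = Fin.last (n + 1) := by
    rw [Fin.ext_iff, Fin.val_succ, zero_sub, Fin.coe_neg_one, Fin.val_last]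
  rw [Mesh.right, this, M.last]

theorem Mesh.right_sub_one [NeZero N] (M : Mesh a b N) {i : Fin N} (hi : i ≠ 0) :
    M.right (i - 1) = M.left i := by
  obtain ⟨n, rfl⟩ : ∃ n, N = n + 1 := ⟨N - 1, (Nat.succ_pred (NeZero.ne N)).symm⟩
  have : (i - 1).succ = i.castSucc := by
    rw [Fin.ext_iff, Fin.val_succ, Fin.val_castSucc, Fin.val_sub_one_of_ne_zero hi]
    have : (i : ℕ) ≠ 0 := fun h => hi (Fin.ext h)
    omega
  rw [Mesh.right, this, Mesh.left]

theorem Mesh.h_pos [NeZero N] (M : Mesh a b N) : 0 < M.h := (M.len_pos 0).trans_le (M.len_le_h 0)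

theorem Mesh.ShapeRegular.one_le [NeZero N] {M : Mesh a b N} {κ : ℝ} (h : M.ShapeRegular κ) :
    1 ≤ κ := by
  have h1 := h 0
  have h2 := M.len_le_h 0
  have h3 := M.len_pos 0
  by_contra hκ
  nlinarith

theorem Mesh.ShapeRegular.h_pow_le [NeZero N] {M : Mesh a b N} {κ : ℝ} (h : M.ShapeRegular κ)
    {l : ℕ} (hl : l ≤ k) (i : Fin N) : M.h ^ l * (M.len i ^ l)⁻¹ ≤ κ ^ k := by
  have h1 : M.h ^ l ≤ κ ^ l * M.len i ^ l := by
    rw [← mul_pow]; exact pow_le_pow_left₀ M.h_pos.le (h i) l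
  rw [← div_eq_mul_inv, div_le_iff₀ (pow_pos (M.len_pos i) l)]
  exact h1.trans (mul_le_mul_of_nonneg_right (pow_le_pow_right₀ h.one_le hl)
    (pow_pos (M.len_pos i) l).le)

/-! ### Upwind values and jumps in reference coordinates -/

/-- The value taken from the preceding cell, with exterior value `e` at the inflow point. -/
def upwind [NeZero N] (bc : Boundary) (e : ℝ) (z : Fin N → ℝ) (i : Fin N) : ℝ :=
  match bc with
  | .periodic => z (i - 1)
  | .inflow => if i = 0 then e else z (i - 1)

/-- The value at the right end point of a cell of a quantity that is attached to left end points. -/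
def downwind [NeZero N] (bc : Boundary) (z : Fin N → ℝ) (i : Fin N) : ℝ :=
  match bc with
  | .periodic => z (i + 1)
  | .inflow => if i + 1 = 0 then 0 else z (i + 1)

/-- A piecewise polynomial in reference coordinates. -/
noncomputable def Mesh.ref (M : Mesh a b N) (w : Fin N → ℝ[X]) (i : Fin N) : ℝ[X] :=
  toRef (M.left i) (M.len i) (w i)

theorem Mesh.right_eval (M : Mesh a b N) (w : Fin N → ℝ[X]) (l : ℕ) (i : Fin N) :
    (derivative^[l] (w i)).eval (M.right i) = (M.len i ^ l)⁻¹ * traceDeriv 1 l (M.ref w i) := by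
  have := iterate_derivative_eval_cell (M.left i) (M.len_pos i).ne' 1 l (w i)
  rwa [mul_one, M.left_add_len] at this

theorem Mesh.left_eval (M : Mesh a b N) (w : Fin N → ℝ[X]) (l : ℕ) (i : Fin N) :
    (derivative^[l] (w i)).eval (M.left i) = (M.len i ^ l)⁻¹ * traceDeriv 0 l (M.ref w i) := by
  have := iterate_derivative_eval_cell (M.left i) (M.len_pos i).ne' 0 l (w i)
  rwa [mul_zero, add_zero] at this

theorem Mesh.ref_interp (M : Mesh a b N) (hc : IsCVNodes m k c) (v : ℝ → ℝ) (i : Fin N) :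
    toRef (M.left i) (M.len i) (M.interp c v i) = itp c fun j => v (M.pt c i j.succ) := by
  have hinj : Set.InjOn (fun j : Fin (k + 1) => M.pt c i j.succ)
      (univ : Finset (Fin (k + 1))) := fun j _ j' _ h => by
    have h1 : M.len i * c j.succ = M.len i * c j'.succ := add_left_cancel h
    exact Fin.succ_injective _ (hc.strictMono.injective (mul_left_cancel₀ (M.len_pos i).ne' h1))
  have hd : (M.interp c v i).natDegree ≤ k := by
    have := Lagrange.degree_interpolate_le (r := fun j : Fin (k + 1) => v (M.pt c i j.succ)) hinj
    rw [card_univ, Fintype.card_fin, Nat.add_sub_cancel] at this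
    exact natDegree_le_of_degree_le this
  rw [← itp_eq_self hc (natDegree_toRef_le (M.left i) (M.len i) hd)]
  congr 1
  ext j
  rw [toRef_eval]
  exact Lagrange.eval_interpolate_at_node (v := fun j : Fin (k + 1) => M.pt c i j.succ) _ hinj
    (mem_univ j)

section

variable [NeZero N]

theorem upwind_sub (bc : Boundary) (e e' : ℝ) (z z' : Fin N → ℝ) (i : Fin N) :
    upwind bc e z i - upwind bc e' z' i = upwind bc (e - e') (fun i => z i - z' i) i := by
  cases bc with
  | periodic => rfl
  | inflow => simp only [upwind]; split_ifs <;> rfl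

theorem abs_upwind_zero_le (bc : Boundary) (z : Fin N → ℝ) (i : Fin N) :
    |upwind bc 0 z i| ≤ |z (i - 1)| := by
  cases bc with
  | periodic => exact le_rfl
  | inflow => simp only [upwind]; split_ifs <;> simp

theorem downwind_sub (bc : Boundary) (z z' : Fin N → ℝ) (i : Fin N) :
    downwind bc z i - downwind bc z' i = downwind bc (fun i => z i - z' i) i := by
  cases bc with
  | periodic => rfl
  | inflow => simp only [downwind]; split_ifs <;> simp

theorem abs_downwind_le (bc : Boundary) (z : Fin N → ℝ) (i : Fin N) :
    |downwind bc z i| ≤ |z (i + 1)| := by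
  cases bc with
  | periodic => exact le_rfl
  | inflow => simp only [downwind]; split_ifs <;> simp

theorem hasDerivWithinAt_upwind (bc : Boundary) {e : ℝ → ℝ} {e' : ℝ} {z : ℝ → Fin N → ℝ}
    {z' : Fin N → ℝ} {S : Set ℝ} {t : ℝ} (he : HasDerivWithinAt e e' S t)
    (hz : ∀ i, HasDerivWithinAt (fun s => z s i) (z' i) S t) (i : Fin N) :
    HasDerivWithinAt (fun s => upwind bc (e s) (z s) i) (upwind bc e' z' i) S t := by
  cases bc with
  | periodic => exact hz (i - 1)
  | inflow => simp only [upwind]; split_ifs; exacts [he, hz (i - 1)]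

theorem hasDerivWithinAt_downwind (bc : Boundary) {z : ℝ → Fin N → ℝ}
    {z' : Fin N → ℝ} {S : Set ℝ} {t : ℝ}
    (hz : ∀ i, HasDerivWithinAt (fun s => z s i) (z' i) S t) (i : Fin N) :
    HasDerivWithinAt (fun s => downwind bc (z s) i) (downwind bc z' i) S t := by
  cases bc with
  | periodic => exact hz (i + 1)
  | inflow =>
    simp only [downwind]; split_ifs; exacts [hasDerivWithinAt_const t S 0, hz (i + 1)]

theorem sum_sub_one {f : Fin N → ℝ} : ∑ i, f (i - 1) = ∑ i, f i :=
  Equiv.sum_comp (Equiv.subRight (1 : Fin N)) f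

theorem sum_add_one {f : Fin N → ℝ} : ∑ i, f (i + 1) = ∑ i, f i :=
  Equiv.sum_comp (Equiv.addRight (1 : Fin N)) f

theorem sum_upwind_zero_sq_le (bc : Boundary) (z : Fin N → ℝ) :
    ∑ i, upwind bc 0 z i ^ 2 ≤ ∑ i, z i ^ 2 := by
  rw [← sum_sub_one (f := fun i => z i ^ 2)]
  exact sum_le_sum fun i _ => sq_le_sq.2 (abs_upwind_zero_le bc z i)

theorem Mesh.upTrace_eq (M : Mesh a b N) (bc : Boundary) (ext : ℕ → ℝ) (w : Fin N → ℝ[X])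
    (l : ℕ) (i : Fin N) : M.upTrace bc ext w l i
      = upwind bc (ext l) (fun i => (M.len i ^ l)⁻¹ * traceDeriv 1 l (M.ref w i)) i := by
  simp only [← M.right_eval]
  rfl

theorem Mesh.leftJump_eq (M : Mesh a b N) (bc : Boundary) (ext : ℕ → ℝ) (w : Fin N → ℝ[X])
    (l : ℕ) (i : Fin N) : M.leftJump bc ext w l i
      = (M.len i ^ l)⁻¹ * traceDeriv 0 l (M.ref w i)
        - upwind bc (ext l) (fun i => (M.len i ^ l)⁻¹ * traceDeriv 1 l (M.ref w i)) i := by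
  rw [← M.upTrace_eq, ← M.left_eval]
  rfl

theorem Mesh.rightJump_eq (M : Mesh a b N) (bc : Boundary) (ext : ℕ → ℝ) (w : Fin N → ℝ[X])
    (l : ℕ) (i : Fin N) : M.rightJump bc ext w l i = downwind bc (M.leftJump bc ext w l) i := rfl

/-- The factor 1 / h_i of the scheme cancels the cell length produced by the change of variables. -/
theorem Mesh.damping_eq (M : Mesh a b N) (bc : Boundary) (ext : ℕ → ℝ) (w : Fin N → ℝ[X])
    (p : ℝ[X]) (i : Fin N) (j : Fin (k + 1)) :
    M.damping bc c ext w p i j = ∑ l ∈ range (k + 1), M.sigma k bc ext w l i *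
      dampInt c l j (toRef (M.left i) (M.len i) p) := by
  refine sum_congr rfl fun l _ => ?_
  have h : ∫ x in (M.pt c i j.castSucc)..(M.pt c i j.succ),
      (p.eval x - (l2Proj (M.left i) (M.right i) (l - 1) p).eval x)
      = M.len i * dampInt c l j (toRef (M.left i) (M.len i) p) := by
    rw [dampInt_apply, refProj_apply, ← toRef_l2Proj (M.len_pos i), ← toRef_sub, cvInt,
      ← polyInt_cell, M.left_add_len, polyInt_apply]
    simp only [eval_sub]
    rfl
  rw [h]
  field_simp [(M.len_pos i).ne']

/-- The scheme in reference coordinates. -/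
theorem Mesh.IsSchemeSolution.ref_eq {M : Mesh a b N} {bc : Boundary} {T : ℝ} {g : ℝ → ℝ}
    {uh : ℝ → Fin N → ℝ[X]} (h : M.IsSchemeSolution bc c T g uh) {t : ℝ} (ht : t ∈ Set.Icc 0 T) :
    ∃ ut : Fin N → ℝ[X], (∀ i, (ut i).natDegree ≤ k) ∧
      (∀ i x, HasDerivWithinAt (fun s => (M.ref (uh s) i).eval x) ((ut i).eval x)
        (Set.Icc 0 T) t) ∧
      ∀ i (j : Fin (k + 1)), M.len i * cvInt c j (ut i)
        + ((M.ref (uh t) i).eval (c j.succ) - if j = 0 then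
            upwind bc (inflowData T g t 0) (fun i => (M.ref (uh t) i).eval 1) i
          else (M.ref (uh t) i).eval (c j.castSucc))
        + ∑ l ∈ range (k + 1), M.sigma k bc (inflowData T g t) (uh t) l i *
            dampInt c l j (M.ref (uh t) i) = 0 := by
  obtain ⟨ut, hd, hder, hform⟩ := h.scheme t ht
  refine ⟨M.ref ut, fun i => natDegree_toRef_le _ _ (hd i), fun i x => ?_, fun i j => ?_⟩
  · simp only [Mesh.ref, toRef_eval]
    exact hder i _
  -- Testing with the indicator of one control volume isolates its equation.
  · have h1 := hform (Pi.single i (Pi.single j 1))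
    rw [Mesh.form, sum_eq_single i (fun i' _ hi => by simp [Pi.single_eq_of_ne hi]) (by simp),
      Pi.single_eq_same,
      sum_eq_single j (fun j' _ hj => by simp [Pi.single_eq_of_ne hj]) (by simp),
      Pi.single_eq_same, one_mul, M.damping_eq] at h1
    have h2 : ∫ x in (M.pt c i j.castSucc)..(M.pt c i j.succ), (ut i).eval x
        = M.len i * cvInt c j (M.ref ut i) := by
      rw [Mesh.ref, cvInt, ← polyInt_cell]
      rfl
    have h3 : M.minusTrace bc c (inflowData T g t) (uh t) i j.succ
        = (M.ref (uh t) i).eval (c j.succ) := by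
      rw [Mesh.minusTrace, if_neg (Fin.succ_ne_zero j), Mesh.ref, toRef_eval]
      rfl
    have h4 : M.minusTrace bc c (inflowData T g t) (uh t) i j.castSucc
        = if j = 0 then upwind bc (inflowData T g t 0) (fun i => (M.ref (uh t) i).eval 1) i
          else (M.ref (uh t) i).eval (c j.castSucc) := by
      rw [Mesh.minusTrace, M.upTrace_eq]
      simp only [Fin.castSucc_eq_zero_iff, pow_zero, inv_one, one_mul, traceDeriv_apply,
        Function.iterate_zero, id]
      split_ifs
      · rfl
      · rw [Mesh.ref, toRef_eval]
        rfl
    rw [h2, h3, h4] at h1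
    rw [← h1, Mesh.ref, Mesh.ref]
    ring

/-! ### The damping coefficients -/

/-- The factor in front of the jumps in the damping coefficients. -/
noncomputable def sigmaCoef (k : ℕ) (h : ℝ) (l : ℕ) : ℝ :=
  2 * (2 * (l : ℝ) + 1) / (2 * (k : ℝ) - 1) * (h ^ l / (l.factorial : ℝ))

theorem sigmaCoef_nonneg (hk : 1 ≤ k) {h : ℝ} (hh : 0 ≤ h) (l : ℕ) : 0 ≤ sigmaCoef k h l := by
  have : (1 : ℝ) ≤ k := by exact_mod_cast hk
  exact mul_nonneg (div_nonneg (by positivity) (by linarith)) (by positivity)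

theorem sigmaCoef_le (hk : 1 ≤ k) {h : ℝ} (hh : 0 ≤ h) {l : ℕ} (hl : l ≤ k) :
    sigmaCoef k h l ≤ (4 * k + 2) * h ^ l := by
  have h1 : (1 : ℝ) ≤ k := by exact_mod_cast hk
  have h2 : (l : ℝ) ≤ k := by exact_mod_cast hl
  have h3 : (1 : ℝ) ≤ l.factorial := by exact_mod_cast l.factorial_pos
  refine mul_le_mul ?_ (div_le_self (by positivity) h3) (by positivity) (by positivity)
  rw [div_le_iff₀ (by linarith)]
  nlinarith

/-- This is the triangle inequality for the Euclidean norms of (x, y, 0) and (x', y', ε), followed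
by the bound of the norm by the sum of the absolute values. -/
theorem abs_sqrt_sub_sqrt_le (x y x' y' ε : ℝ) :
    |√(x ^ 2 + y ^ 2) - √(x' ^ 2 + y' ^ 2 + ε ^ 2)| ≤ |x - x'| + |y - y'| + |ε| := by
  have hx : |x| ≤ |x'| + |x - x'| := by
    have := abs_add_le x' (x - x'); rwa [add_sub_cancel] at this
  have hy : |y| ≤ |y'| + |y - y'| := by
    have := abs_add_le y' (y - y'); rwa [add_sub_cancel] at this
  have hx' : |x'| ≤ |x| + |x - x'| := by
    have := abs_sub x (x - x'); rwa [sub_sub_cancel] at this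
  have hy' : |y'| ≤ |y| + |y - y'| := by
    have := abs_sub y (y - y'); rwa [sub_sub_cancel] at this
  have e1 := abs_nonneg (x - x')
  have e2 := abs_nonneg (y - y')
  have e3 := abs_nonneg ε
  have s1 := Real.sqrt_nonneg (x ^ 2 + y ^ 2)
  have s2 := Real.sqrt_nonneg (x' ^ 2 + y' ^ 2 + ε ^ 2)
  have q1 := Real.sq_sqrt (by positivity : 0 ≤ x ^ 2 + y ^ 2)
  have q2 := Real.sq_sqrt (by positivity : 0 ≤ x' ^ 2 + y' ^ 2 + ε ^ 2)
  have a1 : |x| ≤ √(x ^ 2 + y ^ 2) := Real.abs_le_sqrt (by nlinarith)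
  have a2 : |y| ≤ √(x ^ 2 + y ^ 2) := Real.abs_le_sqrt (by nlinarith)
  have a3 : |x'| ≤ √(x' ^ 2 + y' ^ 2 + ε ^ 2) := Real.abs_le_sqrt (by nlinarith)
  have a4 : |y'| ≤ √(x' ^ 2 + y' ^ 2 + ε ^ 2) := Real.abs_le_sqrt (by nlinarith)
  set S := √(x ^ 2 + y ^ 2)
  set S' := √(x' ^ 2 + y' ^ 2 + ε ^ 2)
  have b1 : x ^ 2 ≤ (|x'| + |x - x'|) ^ 2 := sq_le_sq.2 (by
    rwa [abs_of_nonneg (by positivity : 0 ≤ |x'| + |x - x'|)])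
  have b2 : y ^ 2 ≤ (|y'| + |y - y'|) ^ 2 := sq_le_sq.2 (by
    rwa [abs_of_nonneg (by positivity : 0 ≤ |y'| + |y - y'|)])
  have b3 : x' ^ 2 ≤ (|x| + |x - x'|) ^ 2 := sq_le_sq.2 (by
    rwa [abs_of_nonneg (by positivity : 0 ≤ |x| + |x - x'|)])
  have b4 : y' ^ 2 ≤ (|y| + |y - y'|) ^ 2 := sq_le_sq.2 (by
    rwa [abs_of_nonneg (by positivity : 0 ≤ |y| + |y - y'|)])
  have c1 := mul_le_mul_of_nonneg_right a1 e1
  have c2 := mul_le_mul_of_nonneg_right a2 e2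
  have c3 := mul_le_mul_of_nonneg_right a3 e1
  have c4 := mul_le_mul_of_nonneg_right a4 e2
  have c5 := mul_nonneg e1 e2
  have c6 := mul_nonneg s1 e3
  have c7 := mul_nonneg e1 e3
  have c8 := mul_nonneg e2 e3
  have d1 := sq_abs x
  have d2 := sq_abs y
  have d3 := sq_abs x'
  have d4 := sq_abs y'
  have d5 := sq_abs ε
  rw [abs_le]
  constructor
  · have : S' ≤ S + (|x - x'| + |y - y'| + |ε|) := by
      refine Real.sqrt_le_iff.2 ⟨by positivity, ?_⟩
      nlinarith
    linarith
  · have : S ≤ S' + (|x - x'| + |y - y'|) := by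
      refine Real.sqrt_le_iff.2 ⟨by positivity, ?_⟩
      nlinarith [sq_nonneg ε]
    linarith

/-- The damping coefficient with a regularised square root. -/
noncomputable def Mesh.regSigma (M : Mesh a b N) (k : ℕ) (bc : Boundary) (ext : ℕ → ℝ)
    (w : Fin N → ℝ[X]) (ε : ℝ) (l : ℕ) (i : Fin N) : ℝ :=
  sigmaCoef k M.h l * √(M.leftJump bc ext w l i ^ 2 + M.rightJump bc ext w l i ^ 2 + ε ^ 2)

theorem Mesh.sigma_nonneg (M : Mesh a b N) (hk : 1 ≤ k) (bc : Boundary) (ext : ℕ → ℝ)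
    (w : Fin N → ℝ[X]) (l : ℕ) (i : Fin N) : 0 ≤ M.sigma k bc ext w l i :=
  mul_nonneg (sigmaCoef_nonneg hk M.h_pos.le l) (Real.sqrt_nonneg _)

/-- In reference coordinates an l-th derivative carries the factor `(M.len i ^ l)⁻¹`, which h^l
compensates up to κ^k by shape regularity. The exterior data are the same on both sides and cancel.
-/
theorem Mesh.abs_leftJump_sub_le {M : Mesh a b N} {κ K : ℝ} (hκ : M.ShapeRegular κ)
    (hK : IsFunctionalBound m k c K) (bc : Boundary) (ext : ℕ → ℝ) {w w' : Fin N → ℝ[X]}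
    (hw : ∀ i, (M.ref w i).natDegree ≤ k) (hw' : ∀ i, (M.ref w' i).natDegree ≤ k) {l : ℕ}
    (hl : l ≤ k) (i : Fin N) :
    M.h ^ l * |M.leftJump bc ext w l i - M.leftJump bc ext w' l i|
      ≤ κ ^ k * K * (nodeNorm c (M.ref w i - M.ref w' i)
        + nodeNorm c (M.ref w (i - 1) - M.ref w' (i - 1))) := by
  have hd : ∀ i, (M.ref w i - M.ref w' i).natDegree ≤ k := fun i =>
    (natDegree_sub_le _ _).trans (max_le (hw i) (hw' i))
  have hone : ∀ s : ℝ, s = 0 ∨ s = 1 → ∀ i, M.h ^ l * |(M.len i ^ l)⁻¹ * traceDeriv s l (M.ref w i)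
      - (M.len i ^ l)⁻¹ * traceDeriv s l (M.ref w' i)|
      ≤ κ ^ k * K * nodeNorm c (M.ref w i - M.ref w' i) := fun s hs i => by
    rw [← mul_sub, ← map_sub, abs_mul, abs_of_pos (inv_pos.2 (pow_pos (M.len_pos i) l)),
      ← mul_assoc, mul_assoc (κ ^ k)]
    exact mul_le_mul (hκ.h_pow_le hl i) (hK.trace l hl s hs _ (hd i)) (abs_nonneg _)
      (pow_nonneg (zero_le_one.trans hκ.one_le) k)
  rw [M.leftJump_eq, M.leftJump_eq, sub_sub_sub_comm, upwind_sub, sub_self]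
  refine (mul_le_mul_of_nonneg_left ((abs_sub _ _).trans
    (add_le_add_right (abs_upwind_zero_le _ _ _) _)) (pow_nonneg M.h_pos.le l)).trans ?_
  rw [mul_add, mul_add]
  exact add_le_add (hone 0 (Or.inl rfl) i) (hone 1 (Or.inr rfl) (i - 1))

/-- The sum of a quantity over a cell and its two neighbours. -/
def patch (z : Fin N → ℝ) (i : Fin N) : ℝ := z (i - 1) + z i + z (i + 1)

/-- The damping coefficient is Lipschitz in the discrete function. The jumps at both ends of cell i
involve its two neighbours, hence the patch. -/
theorem Mesh.abs_sigma_sub_regSigma_le {M : Mesh a b N} {κ K : ℝ} (hκ : M.ShapeRegular κ)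
    (hk : 1 ≤ k) (hK : IsFunctionalBound m k c K) (bc : Boundary) (ext : ℕ → ℝ)
    {w w' : Fin N → ℝ[X]} (hw : ∀ i, (M.ref w i).natDegree ≤ k)
    (hw' : ∀ i, (M.ref w' i).natDegree ≤ k) {l : ℕ} (hl : l ≤ k) (i : Fin N) (ε : ℝ) :
    |M.sigma k bc ext w l i - M.regSigma k bc ext w' ε l i|
      ≤ (4 * k + 2) * (2 * κ ^ k * K * patch (fun i => nodeNorm c (M.ref w i - M.ref w' i)) i
        + M.h ^ l * |ε|) := by
  have e : M.sigma k bc ext w l i = sigmaCoef k M.h l *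
    √(M.leftJump bc ext w l i ^ 2 + M.rightJump bc ext w l i ^ 2) := rfl
  have hKκ : 0 ≤ κ ^ k * K := mul_nonneg (pow_nonneg (zero_le_one.trans hκ.one_le) k) hK.nonneg
  rw [e, Mesh.regSigma, ← mul_sub, abs_mul, abs_of_nonneg (sigmaCoef_nonneg hk M.h_pos.le l)]
  have h1 := M.abs_leftJump_sub_le hκ hK bc ext hw hw' hl i
  have h2 := M.abs_leftJump_sub_le hκ hK bc ext hw hw' hl (i + 1)
  rw [add_sub_cancel_right] at h2
  have h3 : |M.rightJump bc ext w l i - M.rightJump bc ext w' l i|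
      ≤ |M.leftJump bc ext w l (i + 1) - M.leftJump bc ext w' l (i + 1)| := by
    rw [M.rightJump_eq, M.rightJump_eq, downwind_sub]
    exact abs_downwind_le _ _ _
  have h4 := abs_sqrt_sub_sqrt_le (M.leftJump bc ext w l i) (M.rightJump bc ext w l i)
    (M.leftJump bc ext w' l i) (M.rightJump bc ext w' l i) ε
  refine (mul_le_mul (sigmaCoef_le hk M.h_pos.le hl) h4 (abs_nonneg _)
    (mul_nonneg (by positivity) (pow_nonneg M.h_pos.le l))).trans ?_
  rw [mul_assoc]
  refine mul_le_mul_of_nonneg_left ?_ (by positivity)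
  have h5 := mul_le_mul_of_nonneg_left h3 (pow_nonneg M.h_pos.le l)
  have p0 := mul_nonneg hKκ (nodeNorm_nonneg (c := c) (M.ref w i - M.ref w' i))
  have p1 := mul_nonneg hKκ (nodeNorm_nonneg (c := c) (M.ref w (i - 1) - M.ref w' (i - 1)))
  have p2 := mul_nonneg hKκ (nodeNorm_nonneg (c := c) (M.ref w (i + 1) - M.ref w' (i + 1)))
  rw [mul_add, mul_add, patch]
  nlinarith

end

end OFSV

namespace OFSV

open Polynomial Finset

variable {m : Method} {k : ℕ} {c : Fin (k + 2) → ℝ} {a b : ℝ} {N : ℕ}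

/-! ### The energy estimate -/

/-- Young's inequality on each product; then h is replaced by κ times the length of the cell to
which each square belongs. Every cell occurs in three patches, which gives the inner factor 3. -/
theorem Mesh.sum_h_mul_patch_sq_le [NeZero N] {M : Mesh a b N} {κ : ℝ} (hκ : M.ShapeRegular κ)
    (z : Fin N → ℝ) (H : ℝ) :
    ∑ i, M.h * (z i * (H + patch z i))
      ≤ 3 * κ * ((b - a) * H ^ 2 + 3 * ∑ i, M.len i * z i ^ 2) := by
  have h1 : ∀ i, M.h * (z i * (H + patch z i)) ≤ 3 * κ * (M.len i * H ^ 2 +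
      (M.len (i - 1) * z (i - 1) ^ 2 + M.len i * z i ^ 2 + M.len (i + 1) * z (i + 1) ^ 2)) :=
    fun i => by
    have h2 : z i * (H + patch z i) ≤ 3 * (H ^ 2 + (z (i - 1) ^ 2 + z i ^ 2 + z (i + 1) ^ 2)) := by
      rw [patch]
      nlinarith [sq_nonneg (z i - H), sq_nonneg (z i - z (i - 1)), sq_nonneg (z i - z (i + 1)),
        sq_nonneg H, sq_nonneg (z (i - 1)), sq_nonneg (z (i + 1))]
    have e0 := mul_le_mul_of_nonneg_right (hκ i) (sq_nonneg H)
    have e1 := mul_le_mul_of_nonneg_right (hκ (i - 1)) (sq_nonneg (z (i - 1)))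
    have e2 := mul_le_mul_of_nonneg_right (hκ i) (sq_nonneg (z i))
    have e3 := mul_le_mul_of_nonneg_right (hκ (i + 1)) (sq_nonneg (z (i + 1)))
    have h3 := mul_le_mul_of_nonneg_left h2 M.h_pos.le
    linarith
  refine (sum_le_sum fun i _ => h1 i).trans (le_of_eq ?_)
  rw [← mul_sum, sum_add_distrib, sum_add_distrib, sum_add_distrib, ← sum_mul, M.sum_len,
    sum_sub_one (f := fun i => M.len i * z i ^ 2), sum_add_one (f := fun i => M.len i * z i ^ 2)]
  ring

/-- One step of the energy argument: a piecewise polynomial `z` with time derivative `zt` that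
solves the scheme up to the residual `ρ`. -/
theorem Mesh.energy_step [NeZero N] {M : Mesh a b N} {κ K A H : ℝ} (hκ : M.ShapeRegular κ)
    (hc : IsCVNodes m k c) (hk : 1 ≤ k) (hK : IsFunctionalBound m k c K) (hA : 0 ≤ A)
    (bc : Boundary) {z zt : Fin N → ℝ[X]} (hz : ∀ i, (z i).natDegree ≤ k)
    {σ : ℕ → Fin N → ℝ} (hσ : ∀ l i, 0 ≤ σ l i) {ρ : Fin N → Fin (k + 1) → ℝ}
    (heq : ∀ i j, M.len i * cvInt c j (zt i)
      + ((z i).eval (c j.succ) - if j = 0 then upwind bc 0 (fun i => (z i).eval 1) i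
          else (z i).eval (c j.castSucc))
      + ∑ l ∈ range (k + 1), σ l i * dampInt c l j (z i) = ρ i j)
    (hρ : ∀ i j, |ρ i j| ≤ A * M.h * (H + patch (fun i => nodeNorm c (z i)) i)) :
    ∑ i, M.len i * ∑ j, star m k c j (z i) * cvInt c j (zt i)
      ≤ 3 * κ * (k + 1) * K * A * ((b - a) * H ^ 2 + 3 * ∑ i, M.len i * nodeNorm c (z i) ^ 2) := by
  -- The equations of cell i are multiplied by the values of z* and added.
  have h1 : ∀ i, M.len i * (∑ j, star m k c j (z i) * cvInt c j (zt i))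
      + ((z i).eval 1 * (z i).eval 1
        - (z i).eval 0 * upwind bc 0 (fun i => (z i).eval 1) i
        - polyInt 0 1 (z i * derivative (z i)))
      + ∑ l ∈ range (k + 1), σ l i * ∑ j, star m k c j (z i) * dampInt c l j (z i)
      = ∑ j, star m k c j (z i) * ρ i j := fun i => by
    rw [← sum_star_mul_transport hc hk (hz i) (hz i)]
    simp_rw [← heq, mul_add, mul_sum]
    rw [sum_add_distrib, sum_add_distrib, sum_comm]
    refine congrArg₂ _ (congrArg₂ _ ?_ rfl) ?_
    · exact sum_congr rfl fun j _ => by ring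
    · exact sum_congr rfl fun j _ => sum_congr rfl fun l _ => by ring
  -- The difference of the two sides is half the square of the jump at the left end point: the
  -- dissipation of the upwind flux.
  have h2 : ∀ i, (1 / 2 : ℝ) * ((z i).eval 1 ^ 2 - upwind bc 0 (fun i => (z i).eval 1) i ^ 2)
      ≤ (z i).eval 1 * (z i).eval 1
        - (z i).eval 0 * upwind bc 0 (fun i => (z i).eval 1) i
        - polyInt 0 1 (z i * derivative (z i)) := fun i => by
    have h3 := polyInt_derivative 0 1 (z i * z i)
    rw [derivative_mul, mul_comm (derivative (z i)), map_add, eval_mul, eval_mul] at h3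
    nlinarith [sq_nonneg ((z i).eval 0 - upwind bc 0 (fun i => (z i).eval 1) i)]
  have h3 : ∀ i, 0 ≤ ∑ l ∈ range (k + 1), σ l i * ∑ j, star m k c j (z i) * dampInt c l j (z i) :=
    fun i => sum_nonneg fun l hl => mul_nonneg (hσ l i)
      (sum_star_mul_dampInt_nonneg hc hk (Nat.lt_succ_iff.1 (mem_range.1 hl)) (hz i))
  have h4 : ∀ i, ∑ j, star m k c j (z i) * ρ i j ≤ (k + 1) * K * A * (M.h * (nodeNorm c (z i) *
      (H + patch (fun i => nodeNorm c (z i)) i))) := fun i => by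
    calc ∑ j, star m k c j (z i) * ρ i j
        ≤ ∑ _j : Fin (k + 1), K * nodeNorm c (z i) *
            (A * M.h * (H + patch (fun i => nodeNorm c (z i)) i)) := sum_le_sum fun j _ => by
          refine (le_abs_self _).trans ?_
          rw [abs_mul]
          exact mul_le_mul (hK.star j _ (hz i)) (hρ i j) (abs_nonneg _)
            (mul_nonneg hK.nonneg (nodeNorm_nonneg _))
      _ = _ := by
          rw [sum_const, card_univ, Fintype.card_fin, nsmul_eq_mul]
          push_cast
          ring
  -- Summed over the cells, the squared upwind traces do not exceed the squared right traces, so the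
  -- transport term is nonnegative. For inflow the exterior value of the error is 0.
  have h5 := sum_upwind_zero_sq_le bc fun i => (z i).eval 1
  have h6 : ∑ i, M.len i * ∑ j, star m k c j (z i) * cvInt c j (zt i)
      ≤ ∑ i, ((k + 1) * K * A * (M.h * (nodeNorm c (z i) *
      (H + patch (fun i => nodeNorm c (z i)) i)))
      - (1 / 2 : ℝ) * ((z i).eval 1 ^ 2 - upwind bc 0 (fun i => (z i).eval 1) i ^ 2)) :=
    sum_le_sum fun i _ => by linarith [h1 i, h2 i, h3 i, h4 i]
  have h8 : ∑ i, (1 / 2 : ℝ) * ((z i).eval 1 ^ 2 - upwind bc 0 (fun i => (z i).eval 1) i ^ 2)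
      = 1 / 2 * (∑ i, (z i).eval 1 ^ 2 - ∑ i, upwind bc 0 (fun i => (z i).eval 1) i ^ 2) := by
    rw [← mul_sum, sum_sub_distrib]
  rw [sum_sub_distrib, ← mul_sum, h8] at h6
  have h7 := mul_le_mul_of_nonneg_left
    (M.sum_h_mul_patch_sq_le hκ (fun i => nodeNorm c (z i)) H)
    (mul_nonneg (mul_nonneg (by positivity : (0 : ℝ) ≤ k + 1) hK.nonneg) hA)
  linarith

/-- The discrete energy. -/
noncomputable def Mesh.energy (M : Mesh a b N) (m : Method) (c : Fin (k + 2) → ℝ)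
    (z : Fin N → ℝ[X]) : ℝ :=
  ∑ i, M.len i * ∑ j, star m k c j (z i) * cvInt c j (z i)

/-- The form (f, v*) is symmetric, so the two halves of the product rule coincide; this is what
makes the trial-to-test map compatible with an energy argument. -/
theorem Mesh.hasDerivWithinAt_energy (M : Mesh a b N) (hc : IsCVNodes m k c) (hk : 1 ≤ k)
    {z : ℝ → Fin N → ℝ[X]} {zt : Fin N → ℝ[X]} {S : Set ℝ} {t : ℝ} (ht : t ∈ S)
    (hz : ∀ s ∈ S, ∀ i, (z s i).natDegree ≤ k) (hzt : ∀ i, (zt i).natDegree ≤ k)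
    (h : ∀ i, ∀ j : Fin (k + 1), HasDerivWithinAt (fun s => (z s i).eval (c j.succ))
      ((zt i).eval (c j.succ)) S t) :
    HasDerivWithinAt (fun s => M.energy m c (z s))
      (2 * ∑ i, M.len i * ∑ j, star m k c j (z t i) * cvInt c j (zt i)) S t := by
  obtain ⟨γ, -, hγ⟩ := exists_sum_star_mul_cvInt hc hk
  have hder : ∀ (f : ℝ[X] →ₗ[ℝ] ℝ) i, HasDerivWithinAt (fun s => f (z s i)) (f (zt i)) S t :=
    fun f i => hasDerivWithinAt_map hc f (fun s hs => hz s hs i) (hzt i) ht (h i)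
  have h1 := HasDerivWithinAt.fun_sum (u := univ) fun i (_ : i ∈ univ) =>
    (HasDerivWithinAt.fun_sum (u := univ) fun j (_ : j ∈ univ) =>
      (hder (star m k c j) i).fun_mul (hder (cvInt c j) i)).const_mul (M.len i)
  refine h1.congr_deriv ?_
  rw [mul_sum]
  refine sum_congr rfl fun i _ => ?_
  have h2 : ∑ j, star m k c j (zt i) * cvInt c j (z t i)
      = ∑ j, star m k c j (z t i) * cvInt c j (zt i) := by
    rw [hγ _ _ (hz t ht i) (hzt i), hγ _ _ (hzt i) (hz t ht i), mul_comm (z t i),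
      mul_comm ((z t i).coeff k)]
  rw [sum_add_distrib, h2]
  ring

/-- From below, (z, z*) dominates the integral of z², since γ ≥ 0; on degree ≤ k this is equivalent
to the nodal norm. The upper bound is continuity of the functionals involved. -/
theorem exists_energy_bounds (hc : IsCVNodes m k c) (hk : 1 ≤ k) :
    ∃ K, 0 < K ∧ ∀ z : ℝ[X], z.natDegree ≤ k →
      nodeNorm c z ^ 2 ≤ K * ∑ j, star m k c j z * cvInt c j z ∧
      ∑ j, star m k c j z * cvInt c j z ≤ K * nodeNorm c z ^ 2 := by
  obtain ⟨γ, hγ0, hγ⟩ := exists_sum_star_mul_cvInt hc hk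
  obtain ⟨K₁, h₁, H₁⟩ := exists_nodeNorm_sq_le c
  obtain ⟨K₂, hK₂⟩ := exists_isFunctionalBound hc
  refine ⟨K₁ + (k + 1) * K₂ ^ 2 + 1, by positivity, fun z hz => ⟨?_, ?_⟩⟩
  · have h1 : 0 ≤ polyInt 0 1 (z * z) :=
      polyInt_nonneg zero_le_one fun x _ => by rw [eval_mul]; exact mul_self_nonneg _
    have h2 : polyInt 0 1 (z * z) ≤ ∑ j, star m k c j z * cvInt c j z := by
      rw [hγ z z hz hz]
      exact le_add_of_nonneg_right (mul_nonneg hγ0 (mul_self_nonneg _))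
    calc nodeNorm c z ^ 2 ≤ K₁ * polyInt 0 1 (z * z) := H₁ z hz
      _ ≤ K₁ * ∑ j, star m k c j z * cvInt c j z := mul_le_mul_of_nonneg_left h2 h₁
      _ ≤ _ := mul_le_mul_of_nonneg_right (by nlinarith [sq_nonneg K₂, (by positivity : (0:ℝ) ≤ k)])
        (h1.trans h2)
  · calc ∑ j, star m k c j z * cvInt c j z
        ≤ ∑ _j : Fin (k + 1), (K₂ * nodeNorm c z) * (K₂ * nodeNorm c z) :=
          sum_le_sum fun j _ => (le_abs_self _).trans (by
            rw [abs_mul]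
            exact mul_le_mul (hK₂.star j z hz) (hK₂.cvInt j z hz) (abs_nonneg _)
              (mul_nonneg hK₂.nonneg (nodeNorm_nonneg _)))
      _ = (k + 1) * K₂ ^ 2 * nodeNorm c z ^ 2 := by
          rw [sum_const, card_univ, Fintype.card_fin, nsmul_eq_mul]
          push_cast
          ring
      _ ≤ _ := mul_le_mul_of_nonneg_right (by linarith) (sq_nonneg _)

/-- Gronwall's inequality in the form used here. -/
theorem le_mul_exp_of_hasDerivWithinAt {T A R : ℝ} {f f' : ℝ → ℝ}
    (hf : ∀ t ∈ Set.Icc 0 T, HasDerivWithinAt f (f' t) (Set.Icc 0 T) t)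
    (hle : ∀ t ∈ Set.Icc 0 T, f' t ≤ A * (f t + R)) {t : ℝ} (ht : t ∈ Set.Icc 0 T) :
    f t + R ≤ (f 0 + R) * Real.exp (A * t) := by
  have hd : ∀ s ∈ Set.Icc 0 T, HasDerivWithinAt (fun s => (f s + R) * Real.exp (-(A * s)))
      ((f' s - A * (f s + R)) * Real.exp (-(A * s))) (Set.Icc 0 T) s := fun s hs => by
    have h1 : HasDerivAt (fun s => Real.exp (-(A * s))) (Real.exp (-(A * s)) * (-(A * 1))) s :=
      (((hasDerivAt_id s).const_mul A).neg).exp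
    refine (((hf s hs).add_const R).fun_mul h1.hasDerivWithinAt).congr_deriv ?_
    ring
  have hanti : AntitoneOn (fun s => (f s + R) * Real.exp (-(A * s))) (Set.Icc 0 T) := by
    refine antitoneOn_of_hasDerivWithinAt_nonpos (f' := fun s =>
      (f' s - A * (f s + R)) * Real.exp (-(A * s))) (convex_Icc 0 T)
      (fun s hs => (hd s hs).continuousWithinAt)
      (fun s hs => (hd s (interior_subset hs)).mono interior_subset) fun s hs => ?_
    exact mul_nonpos_of_nonpos_of_nonneg (by linarith [hle s (interior_subset hs)])
      (Real.exp_pos _).le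
  have h0 := hanti ⟨le_rfl, ht.1.trans ht.2⟩ ht ht.1
  simp only [mul_zero, neg_zero, Real.exp_zero, mul_one] at h0
  calc f t + R = (f t + R) * Real.exp (-(A * t)) * Real.exp (A * t) := by
        rw [mul_assoc, ← Real.exp_add]; simp
    _ ≤ (f 0 + R) * Real.exp (A * t) := mul_le_mul_of_nonneg_right h0 (Real.exp_pos _).le

end OFSV

namespace OFSV

open Polynomial Finset

variable {m : Method} {k : ℕ} {c : Fin (k + 2) → ℝ} {a b T B : ℝ} {N : ℕ} {D : ℕ → ℝ → ℝ}
  {bc : Boundary}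

/-! ### The interpolant of a travelling wave -/

/-- The interpolant of `x ↦ D n (x - t)`. -/
noncomputable def Mesh.wave (M : Mesh a b N) (c : Fin (k + 2) → ℝ) (D : ℕ → ℝ → ℝ) (n : ℕ)
    (t : ℝ) (i : Fin N) : ℝ[X] :=
  M.interp c (fun x => D n (x - t)) i

theorem Mesh.ref_wave (M : Mesh a b N) (hc : IsCVNodes m k c) (n : ℕ) (t : ℝ) (i : Fin N) :
    M.ref (M.wave c D n t) i = cellItp c D n (M.left i - t) (M.len i) := by
  rw [Mesh.ref, Mesh.wave, M.ref_interp hc, cellItp]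
  congr 1
  ext j
  congr 1
  rw [Mesh.pt]
  ring

theorem Mesh.natDegree_ref_wave_le (M : Mesh a b N) (hc : IsCVNodes m k c) (n : ℕ) (t : ℝ)
    (i : Fin N) : (M.ref (M.wave c D n t) i).natDegree ≤ k := by
  rw [M.ref_wave hc]
  exact natDegree_itp_le hc _

theorem Mesh.ref_wave_eval (M : Mesh a b N) (hc : IsCVNodes m k c) (n : ℕ) (t : ℝ) (i : Fin N)
    (j : Fin (k + 1)) : (M.ref (M.wave c D n t) i).eval (c j.succ) = D n (M.pt c i j.succ - t) := by
  rw [Mesh.ref, Mesh.wave, M.ref_interp hc, itp_eval hc]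

theorem Mesh.ref_wave_eval_one (M : Mesh a b N) (hc : IsCVNodes m k c) (n : ℕ) (t : ℝ)
    (i : Fin N) : (M.ref (M.wave c D n t) i).eval 1 = D n (M.right i - t) := by
  have := M.ref_wave_eval hc n t i (D := D) (Fin.last k)
  rwa [Fin.succ_last, hc.last, Mesh.pt, hc.last, mul_one, M.left_add_len] at this

theorem sub_mem_of_mem {x t : ℝ} (hx : x ∈ Set.Icc a b) (ht : t ∈ Set.Icc 0 T) :
    x - t ∈ Set.Icc (a - T) b := ⟨by linarith [hx.1, ht.2], by linarith [hx.2, ht.1]⟩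

theorem Mesh.left_sub_mem (M : Mesh a b N) (i : Fin N) {t : ℝ} (ht : t ∈ Set.Icc 0 T) :
    M.left i - t ∈ Set.Icc (a - T) b := sub_mem_of_mem (M.left_mem i) ht

theorem Mesh.right_sub_mem (M : Mesh a b N) (i : Fin N) {t : ℝ} (ht : t ∈ Set.Icc 0 T) :
    M.left i - t + M.len i ∈ Set.Icc (a - T) b := by
  have := sub_mem_of_mem (M.right_mem i) ht
  rwa [← M.left_add_len, add_sub_right_comm] at this

theorem Mesh.hasDerivWithinAt_ref_wave (M : Mesh a b N) (hc : IsCVNodes m k c)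
    (hD : IsProfile (a - T) b B (k + 2) D) {n : ℕ} (hn : n < k + 2) (f : ℝ[X] →ₗ[ℝ] ℝ) (i : Fin N)
    {t : ℝ} (ht : t ∈ Set.Icc 0 T) :
    HasDerivWithinAt (fun s => f (M.ref (M.wave c D n s) i))
      (-f (M.ref (M.wave c D (n + 1) t) i)) (Set.Icc 0 T) t := by
  rw [← map_neg]
  refine hasDerivWithinAt_map hc f (fun s _ => M.natDegree_ref_wave_le hc n s i)
    (by rw [natDegree_neg]; exact M.natDegree_ref_wave_le hc (n + 1) t i) ht fun j => ?_
  simp only [eval_neg, M.ref_wave_eval hc]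
  exact hD.hasDerivWithinAt_time hn (M.pt_mem hc i _) ht

/-! ### Jumps of the interpolant and the smooth damping coefficients -/

section Jumps

variable [NeZero N]

/-- The exact wave and its derivatives are single-valued at the interfaces; at a this is the
boundary condition. -/
theorem upwind_wave_eq (M : Mesh a b N)
    (hper : bc = .periodic → ∀ n ≤ k + 2, ∀ t ∈ Set.Icc 0 T, D n (a - t) = D n (b - t))
    {n : ℕ} (hn : n ≤ k + 2) {t : ℝ} (ht : t ∈ Set.Icc 0 T) (i : Fin N) :
    upwind bc (D n (a - t)) (fun i => D n (M.right i - t)) i = D n (M.left i - t) := by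
  by_cases hi : i = 0
  · subst hi
    cases bc with
    | periodic =>
      simp only [upwind]
      rw [M.right_zero_sub_one, M.left_zero, hper rfl n hn t ht]
    | inflow => simp only [upwind, if_true, M.left_zero]
  · cases bc with
    | periodic => simp only [upwind]; rw [M.right_sub_one hi]
    | inflow => simp only [upwind]; rw [if_neg hi, M.right_sub_one hi]

/-- The jumps of the interpolant of a travelling wave. -/
noncomputable def Mesh.waveJump (M : Mesh a b N) (bc : Boundary) (c : Fin (k + 2) → ℝ)
    (D : ℕ → ℝ → ℝ) (n : ℕ) (t : ℝ) (l : ℕ) (i : Fin N) : ℝ :=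
  M.leftJump bc (fun l => D (n + l) (a - t)) (M.wave c D n t) l i

/-- Since the exact derivative has no jump (`upwind_wave_eq`), the jump of the interpolant is a
difference of two interpolation errors, one from each adjacent cell. -/
theorem Mesh.abs_waveJump_le {M : Mesh a b N} {κ K : ℝ} (hκ : M.ShapeRegular κ)
    (hc : IsCVNodes m k c) (hK : IsCellBound c D (a - T) b K)
    (hper : bc = .periodic → ∀ n ≤ k + 2, ∀ t ∈ Set.Icc 0 T, D n (a - t) = D n (b - t))
    {n l : ℕ} (hn : n ≤ 2) (hl : l ≤ k) {t : ℝ} (ht : t ∈ Set.Icc 0 T) (i : Fin N) :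
    M.h ^ l * |M.waveJump bc c D n t l i| ≤ 2 * κ ^ k * K * M.h ^ (k + 1) := by
  have hone : ∀ s : ℝ, s = 0 ∨ s = 1 → ∀ i, M.h ^ l *
      |(M.len i ^ l)⁻¹ * traceDeriv s l (M.ref (M.wave c D n t) i)
        - D (n + l) (M.left i - t + M.len i * s)| ≤ κ ^ k * K * M.h ^ (k + 1) := fun s hs i => by
    have h1 := hK.trace n hn l hl s hs (M.left i - t) (M.len i) (M.len_pos i).le
      (M.left_sub_mem i ht) (M.right_sub_mem i ht)
    have hpos := pow_pos (M.len_pos i) l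
    have h2 : (M.len i ^ l)⁻¹ * traceDeriv s l (M.ref (M.wave c D n t) i)
        - D (n + l) (M.left i - t + M.len i * s) = (M.len i ^ l)⁻¹ *
        (traceDeriv s l (cellItp c D n (M.left i - t) (M.len i))
          - M.len i ^ l * D (n + l) (M.left i - t + M.len i * s)) := by
      rw [M.ref_wave hc]
      field_simp
    rw [h2, abs_mul, abs_of_pos (inv_pos.2 hpos), ← mul_assoc, mul_assoc (κ ^ k)]
    refine mul_le_mul (hκ.h_pow_le hl i) (h1.trans ?_) (abs_nonneg _)
      (pow_nonneg (zero_le_one.trans hκ.one_le) k)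
    exact mul_le_mul_of_nonneg_left (pow_le_pow_left₀ (M.len_pos i).le (M.len_le_h i) _) hK.nonneg
  have h2 := upwind_wave_eq M hper (show n + l ≤ k + 2 by omega) ht i
  rw [Mesh.waveJump, M.leftJump_eq, ← sub_sub_sub_cancel_right _ _ (D (n + l) (M.left i - t))]
  conv_lhs => rw [← h2]
  rw [upwind_sub, sub_self, h2]
  have h3 := hone 0 (Or.inl rfl) i
  have h4 := hone 1 (Or.inr rfl) (i - 1)
  rw [mul_zero, add_zero] at h3
  rw [mul_one, ← add_sub_right_comm, M.left_add_len] at h4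
  have h5 := abs_upwind_zero_le bc (fun i => (M.len i ^ l)⁻¹ * traceDeriv 1 l
    (M.ref (M.wave c D n t) i) - D (n + l) (M.right i - t)) i
  refine (mul_le_mul_of_nonneg_left ((abs_sub _ _).trans (add_le_add_right h5 _))
    (pow_nonneg M.h_pos.le l)).trans ?_
  rw [mul_add]
  linarith

theorem Mesh.hasDerivWithinAt_waveJump (M : Mesh a b N) (hc : IsCVNodes m k c)
    (hab : a ≤ b) (hD : IsProfile (a - T) b B (k + 2) D) {l : ℕ} (hl : l ≤ k) (i : Fin N) {t : ℝ}
    (ht : t ∈ Set.Icc 0 T) :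
    HasDerivWithinAt (fun s => M.waveJump bc c D 0 s l i) (-M.waveJump bc c D 1 t l i)
      (Set.Icc 0 T) t := by
  simp only [Mesh.waveJump, M.leftJump_eq]
  have h1 : ∀ (r : ℝ) i, HasDerivWithinAt (fun s => (M.len i ^ l)⁻¹ *
      traceDeriv r l (M.ref (M.wave c D 0 s) i))
      (-((M.len i ^ l)⁻¹ * traceDeriv r l (M.ref (M.wave c D 1 t) i))) (Set.Icc 0 T) t :=
    fun r i => by
      rw [← mul_neg]
      exact (M.hasDerivWithinAt_ref_wave hc hD (by omega) (traceDeriv r l) i ht).const_mul _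
  have h2 : HasDerivWithinAt (fun s => D (0 + l) (a - s)) (-D (1 + l) (a - t)) (Set.Icc 0 T) t := by
    rw [zero_add, add_comm 1 l]
    exact hD.hasDerivWithinAt_time (by omega) ⟨le_rfl, hab⟩ ht
  refine ((h1 0 i).fun_sub (hasDerivWithinAt_upwind bc h2 (h1 1) i)).congr_deriv ?_
  have h3 : upwind bc (-D (1 + l) (a - t)) (fun i => -((M.len i ^ l)⁻¹ *
      traceDeriv 1 l (M.ref (M.wave c D 1 t) i))) i
      = -upwind bc (D (1 + l) (a - t)) (fun i => (M.len i ^ l)⁻¹ *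
      traceDeriv 1 l (M.ref (M.wave c D 1 t) i)) i := by
    cases bc with
    | periodic => rfl
    | inflow => simp only [upwind]; split_ifs <;> rfl
  rw [h3]
  ring

/-- The smooth approximation of the damping coefficients. -/
noncomputable def Mesh.waveSigma (M : Mesh a b N) (bc : Boundary) (c : Fin (k + 2) → ℝ)
    (D : ℕ → ℝ → ℝ) (t : ℝ) (l : ℕ) (i : Fin N) : ℝ :=
  M.regSigma k bc (fun l => D l (a - t)) (M.wave c D 0 t) (M.h ^ (k + 2 - l)) l i

/-- The time derivative of `Mesh.waveSigma`. -/
noncomputable def Mesh.waveSigmaDeriv (M : Mesh a b N) (bc : Boundary) (c : Fin (k + 2) → ℝ)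
    (D : ℕ → ℝ → ℝ) (t : ℝ) (l : ℕ) (i : Fin N) : ℝ :=
  -(sigmaCoef k M.h l * ((M.waveJump bc c D 0 t l i * M.waveJump bc c D 1 t l i
    + downwind bc (M.waveJump bc c D 0 t l) i * downwind bc (M.waveJump bc c D 1 t l) i)
    / √(M.waveJump bc c D 0 t l i ^ 2 + downwind bc (M.waveJump bc c D 0 t l) i ^ 2
      + (M.h ^ (k + 2 - l)) ^ 2)))

theorem Mesh.waveSigma_eq (M : Mesh a b N) (t : ℝ) (l : ℕ) (i : Fin N) :
    M.waveSigma bc c D t l i = sigmaCoef k M.h l * √(M.waveJump bc c D 0 t l i ^ 2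
      + downwind bc (M.waveJump bc c D 0 t l) i ^ 2 + (M.h ^ (k + 2 - l)) ^ 2) := by
  have h : M.waveJump bc c D 0 t = M.leftJump bc (fun l => D l (a - t)) (M.wave c D 0 t) := by
    funext l i
    simp only [Mesh.waveJump, zero_add]
  rw [h]
  rfl

/-- The regularisation keeps the radicand positive, so the square root is differentiable even when
both jumps vanish. -/
theorem Mesh.hasDerivWithinAt_waveSigma (M : Mesh a b N) (hc : IsCVNodes m k c)
    (hab : a ≤ b) (hD : IsProfile (a - T) b B (k + 2) D) {l : ℕ} (hl : l ≤ k) (i : Fin N) {t : ℝ}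
    (ht : t ∈ Set.Icc 0 T) :
    HasDerivWithinAt (fun s => M.waveSigma bc c D s l i) (M.waveSigmaDeriv bc c D t l i)
      (Set.Icc 0 T) t := by
  simp only [M.waveSigma_eq]
  have h1 := fun i => M.hasDerivWithinAt_waveJump (bc := bc) hc hab hD hl i ht
  have h2 := hasDerivWithinAt_downwind bc h1 i
  have h0 : 0 < M.waveJump bc c D 0 t l i ^ 2 + downwind bc (M.waveJump bc c D 0 t l) i ^ 2
      + (M.h ^ (k + 2 - l)) ^ 2 := by
    have := pow_pos (pow_pos M.h_pos (k + 2 - l)) 2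
    positivity
  have h3 := ((((h1 i).fun_pow 2).fun_add (h2.fun_pow 2)).add_const
    ((M.h ^ (k + 2 - l)) ^ 2)).sqrt h0.ne'
  refine (h3.const_mul (sigmaCoef k M.h l)).congr_deriv ?_
  have h4 : downwind bc (fun i => -M.waveJump bc c D 1 t l i) i
      = -downwind bc (M.waveJump bc c D 1 t l) i := by
    cases bc with
    | periodic => rfl
    | inflow => simp only [downwind]; split_ifs <;> simp
  rw [h4, Mesh.waveSigmaDeriv]
  have h5 := (Real.sqrt_pos.2 h0).ne'
  field_simp
  push_cast
  ring

/-- Differentiating the root gives (x x' + y y') / √(x² + y² + e²), which is at most |x'| + |y'| for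
every e > 0. A small regularisation parameter thus does not worsen the bound of the time derivative,
which is governed by the jumps of ∂ₓu. -/
theorem Mesh.waveSigma_bounds {M : Mesh a b N} {κ K : ℝ} (hκ : M.ShapeRegular κ)
    (hc : IsCVNodes m k c) (hk : 1 ≤ k) (hh : M.h ≤ 1) (hK : IsCellBound c D (a - T) b K)
    (hper : bc = .periodic → ∀ n ≤ k + 2, ∀ t ∈ Set.Icc 0 T, D n (a - t) = D n (b - t))
    {l : ℕ} (hl : l ≤ k) {t : ℝ} (ht : t ∈ Set.Icc 0 T) (i : Fin N) :
    |M.waveSigma bc c D t l i| ≤ (4 * k + 2) * (4 * κ ^ k * K + 1) * M.h ^ (k + 1) ∧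
    |M.waveSigmaDeriv bc c D t l i| ≤ (4 * k + 2) * (4 * κ ^ k * K + 1) * M.h ^ (k + 1) := by
  have hhl := pow_nonneg M.h_pos.le l
  have hj : ∀ n ≤ 2, M.h ^ l * (|M.waveJump bc c D n t l i|
      + |downwind bc (M.waveJump bc c D n t l) i|) ≤ 4 * κ ^ k * K * M.h ^ (k + 1) :=
    fun n hn => by
    have h1 := M.abs_waveJump_le hκ hc hK hper hn hl ht i
    have h2 := M.abs_waveJump_le hκ hc hK hper hn hl ht (i + 1)
    have h3 := mul_le_mul_of_nonneg_left (abs_downwind_le bc (M.waveJump bc c D n t l) i) hhl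
    rw [mul_add]
    linarith
  have hcoef := sigmaCoef_le hk M.h_pos.le hl
  have hcoef0 := sigmaCoef_nonneg hk M.h_pos.le l
  have hk0 : (0 : ℝ) ≤ 4 * k + 2 := by positivity
  have hH : M.h ^ l * M.h ^ (k + 2 - l) ≤ M.h ^ (k + 1) := by
    rw [← pow_add, show l + (k + 2 - l) = k + 2 by omega]
    exact pow_le_pow_of_le_one M.h_pos.le hh (by omega)
  set x := M.waveJump bc c D 0 t l i
  set y := downwind bc (M.waveJump bc c D 0 t l) i
  set x' := M.waveJump bc c D 1 t l i
  set y' := downwind bc (M.waveJump bc c D 1 t l) i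
  set e := M.h ^ (k + 2 - l)
  have he : 0 ≤ e := pow_nonneg M.h_pos.le _
  have hx : |x| ≤ √(x ^ 2 + y ^ 2 + e ^ 2) := Real.abs_le_sqrt (by nlinarith [sq_nonneg y])
  have hy : |y| ≤ √(x ^ 2 + y ^ 2 + e ^ 2) := Real.abs_le_sqrt (by nlinarith [sq_nonneg x])
  constructor
  · rw [M.waveSigma_eq, abs_mul, abs_of_nonneg hcoef0, abs_of_nonneg (Real.sqrt_nonneg _)]
    have h1 : √(x ^ 2 + y ^ 2 + e ^ 2) ≤ |x| + |y| + e := by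
      refine Real.sqrt_le_iff.2 ⟨by positivity, ?_⟩
      nlinarith [abs_nonneg x, abs_nonneg y, sq_abs x, sq_abs y, mul_nonneg (abs_nonneg x)
        (abs_nonneg y), mul_nonneg (abs_nonneg x) he, mul_nonneg (abs_nonneg y) he]
    calc sigmaCoef k M.h l * √(x ^ 2 + y ^ 2 + e ^ 2)
        ≤ (4 * k + 2) * M.h ^ l * (|x| + |y| + e) :=
          mul_le_mul hcoef h1 (Real.sqrt_nonneg _) (by positivity)
      _ = (4 * k + 2) * (M.h ^ l * (|x| + |y|) + M.h ^ l * e) := by ring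
      _ ≤ (4 * k + 2) * (4 * κ ^ k * K * M.h ^ (k + 1) + M.h ^ (k + 1)) :=
          mul_le_mul_of_nonneg_left (add_le_add (hj 0 (by omega)) hH) hk0
      _ = _ := by ring
  · have hpos : 0 < √(x ^ 2 + y ^ 2 + e ^ 2) := by
      have := pow_pos (pow_pos M.h_pos (k + 2 - l)) 2
      exact Real.sqrt_pos.2 (by positivity)
    have h2 : |(x * x' + y * y') / √(x ^ 2 + y ^ 2 + e ^ 2)| ≤ |x'| + |y'| := by
      rw [abs_div, abs_of_pos hpos, div_le_iff₀ hpos]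
      refine (abs_add_le _ _).trans ?_
      rw [abs_mul, abs_mul]
      nlinarith [mul_le_mul_of_nonneg_right hx (abs_nonneg x'),
        mul_le_mul_of_nonneg_right hy (abs_nonneg y')]
    rw [Mesh.waveSigmaDeriv, abs_neg, abs_mul, abs_of_nonneg hcoef0]
    calc sigmaCoef k M.h l * |(x * x' + y * y') / √(x ^ 2 + y ^ 2 + e ^ 2)|
        ≤ (4 * k + 2) * M.h ^ l * (|x'| + |y'|) := mul_le_mul hcoef h2 (abs_nonneg _) (by positivity)
      _ = (4 * k + 2) * (M.h ^ l * (|x'| + |y'|)) := by ring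
      _ ≤ (4 * k + 2) * (4 * κ ^ k * K * M.h ^ (k + 1)) :=
          mul_le_mul_of_nonneg_left (hj 1 (by omega)) hk0
      _ ≤ _ := by
          have := mul_nonneg hk0 (pow_nonneg M.h_pos.le (k + 1))
          nlinarith

end Jumps

end OFSV

namespace OFSV

open Polynomial Finset

variable {m : Method} {k : ℕ} {c : Fin (k + 2) → ℝ} {a b T B : ℝ} {N : ℕ} {D : ℕ → ℝ → ℝ}
  {bc : Boundary}

/-! ### Polynomials with prescribed fluxes -/

/-- The partial sums of `d`, with the last one replaced by `0`. -/
def partialSum (d : Fin (k + 1) → ℝ) (j : Fin (k + 1)) : ℝ :=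
  if j = Fin.last k then 0 else ∑ r ∈ univ.filter (fun r => r ≤ j), d r

theorem abs_partialSum_le {d : Fin (k + 1) → ℝ} {r : ℝ} (h : ∀ j, |d j| ≤ r) (j : Fin (k + 1)) :
    |partialSum d j| ≤ (k + 1) * r := by
  have hr : 0 ≤ r := (abs_nonneg _).trans (h 0)
  rw [partialSum]
  split_ifs
  · rw [abs_zero]; positivity
  · calc |∑ r ∈ univ.filter (fun r => r ≤ j), d r|
        ≤ ∑ r ∈ univ.filter (fun r => r ≤ j), |d r| := abs_sum_le_sum_abs _ _
      _ ≤ ∑ r, |d r| := sum_le_sum_of_subset_of_nonneg (subset_univ _) fun _ _ _ => abs_nonneg _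
      _ ≤ ∑ _r : Fin (k + 1), r := sum_le_sum fun i _ => h i
      _ = (k + 1) * r := by simp

theorem hasDerivWithinAt_partialSum {d : ℝ → Fin (k + 1) → ℝ} {d' : Fin (k + 1) → ℝ} {S : Set ℝ}
    {t : ℝ} (h : ∀ j, HasDerivWithinAt (fun s => d s j) (d' j) S t) (j : Fin (k + 1)) :
    HasDerivWithinAt (fun s => partialSum (d s) j) (partialSum d' j) S t := by
  simp only [partialSum]
  split_ifs
  · exact hasDerivWithinAt_const t S 0
  · exact HasDerivWithinAt.fun_sum fun r _ => h r

/-- Differences of partial sums telescope to d. Setting the last value to 0 moves the total onto the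
last control volume; in return the polynomial vanishes at the right end point and does not act on
the next cell. -/
theorem itp_partialSum_flux (hc : IsCVNodes m k c) (hk : 1 ≤ k) (d : Fin (k + 1) → ℝ)
    (j : Fin (k + 1)) :
    (itp c (partialSum d)).eval (c j.succ)
        - (if j = 0 then 0 else (itp c (partialSum d)).eval (c j.castSucc))
      = d j - if j = Fin.last k then ∑ r, d r else 0 := by
  have hlast : ∑ r ∈ univ.filter (fun r => r ≤ Fin.last k), d r = ∑ r, d r := by
    simp [Fin.le_last]
  have key : ∀ j : Fin (k + 1), (itp c (partialSum d)).eval (c j.succ)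
      = ∑ r ∈ univ.filter (fun r => r ≤ j), d r - if j = Fin.last k then ∑ r, d r else 0 :=
    fun j => by
      rw [itp_eval hc, partialSum]
      split_ifs with h
      · rw [h, hlast, sub_self]
      · rw [sub_zero]
  obtain ⟨n, rfl⟩ : ∃ n, k = n + 1 := ⟨k - 1, by omega⟩
  induction j using Fin.cases with
  | zero =>
    have h0 : univ.filter (fun r : Fin (n + 1 + 1) => r ≤ 0) = {0} := by
      ext r; simp
    rw [key, h0, sum_singleton]
    simp
  | succ i =>
    have h1 : univ.filter (fun r : Fin (n + 1 + 1) => r ≤ i.succ)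
        = insert i.succ (univ.filter fun r => r ≤ i.castSucc) := by
      ext r
      simp only [mem_filter, mem_univ, true_and, mem_insert, Fin.ext_iff, Fin.le_def,
        Fin.val_succ, Fin.val_castSucc]
      omega
    have h2 : i.succ ∉ univ.filter fun r : Fin (n + 1 + 1) => r ≤ i.castSucc := by
      simp
    have h3 : i.castSucc ≠ Fin.last (n + 1) := (Fin.castSucc_lt_last i).ne
    rw [if_neg (Fin.succ_ne_zero i), key, ← Fin.succ_castSucc, key, if_neg h3, h1, sum_insert h2]
    ring

theorem itp_partialSum_eval_one (hc : IsCVNodes m k c) (d : Fin (k + 1) → ℝ) :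
    (itp c (partialSum d)).eval 1 = 0 := by
  rw [← hc.last, ← Fin.succ_last, itp_eval hc, partialSum, if_pos rfl]

/-! ### The consistency error and the correction at all times -/

/-- The consistency error of the interpolant `u_I` in the scheme in which the damping coefficients
are replaced by their smooth approximation. -/
noncomputable def Mesh.defect [NeZero N] (M : Mesh a b N) (bc : Boundary) (c : Fin (k + 2) → ℝ)
    (D : ℕ → ℝ → ℝ) (t : ℝ) (i : Fin N) (j : Fin (k + 1)) : ℝ :=
  D 0 (M.pt c i j.succ - t) - D 0 (M.pt c i j.castSucc - t)
    - M.len i * cvInt c j (M.ref (M.wave c D 1 t) i)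
    + ∑ l ∈ range (k + 1), M.waveSigma bc c D t l i * dampInt c l j (M.ref (M.wave c D 0 t) i)

/-- The time derivative of `Mesh.defect`. -/
noncomputable def Mesh.defectDeriv [NeZero N] (M : Mesh a b N) (bc : Boundary)
    (c : Fin (k + 2) → ℝ) (D : ℕ → ℝ → ℝ) (t : ℝ) (i : Fin N) (j : Fin (k + 1)) : ℝ :=
  -(D 1 (M.pt c i j.succ - t) - D 1 (M.pt c i j.castSucc - t)
    - M.len i * cvInt c j (M.ref (M.wave c D 2 t) i))
    + ∑ l ∈ range (k + 1),
      (M.waveSigmaDeriv bc c D t l i * dampInt c l j (M.ref (M.wave c D 0 t) i)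
        - M.waveSigma bc c D t l i * dampInt c l j (M.ref (M.wave c D 1 t) i))

theorem Mesh.pt_sub (M : Mesh a b N) (i : Fin N) (j : Fin (k + 2)) (t : ℝ) :
    M.pt c i j - t = M.left i - t + M.len i * c j := by
  rw [Mesh.pt]; ring

variable [NeZero N]

theorem Mesh.hasDerivWithinAt_defect (M : Mesh a b N) (hc : IsCVNodes m k c) (hk : 1 ≤ k)
    (hab : a ≤ b) (hD : IsProfile (a - T) b B (k + 2) D) (i : Fin N) (j : Fin (k + 1)) {t : ℝ}
    (ht : t ∈ Set.Icc 0 T) :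
    HasDerivWithinAt (fun s => M.defect bc c D s i j) (M.defectDeriv bc c D t i j)
      (Set.Icc 0 T) t := by
  have h1 := fun j => hD.hasDerivWithinAt_time (n := 0) (by omega) (M.pt_mem hc i j) ht
  have h2 := (M.hasDerivWithinAt_ref_wave hc hD (n := 1) (by omega) (cvInt c j) i ht).const_mul
    (M.len i)
  have h3 := HasDerivWithinAt.fun_sum (u := range (k + 1)) fun l hl =>
    (M.hasDerivWithinAt_waveSigma (bc := bc) hc hab hD (Nat.lt_succ_iff.1 (mem_range.1 hl)) i
      ht).fun_mul
    (M.hasDerivWithinAt_ref_wave hc hD (n := 0) (by omega) (dampInt c l j) i ht)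
  refine ((((h1 j.succ).fun_sub (h1 j.castSucc)).fun_sub h2).fun_add h3).congr_deriv ?_
  rw [Mesh.defectDeriv]
  simp only [zero_add, mul_neg, sub_eq_add_neg]
  ring

/-- The bound for the damping coefficients of a travelling wave. -/
noncomputable def sigmaConst (k : ℕ) (κ K : ℝ) : ℝ := (4 * k + 2) * (4 * κ ^ k * K + 1)

theorem sigmaConst_nonneg {κ K : ℝ} (hκ : 0 ≤ κ) (hK : 0 ≤ K) : 0 ≤ sigmaConst k κ K := by
  rw [sigmaConst]; positivity

/-- On one control volume the transport part is O(h^{k+2}) and the damping part is O(h^{k+1}) times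
O(h). Over the whole cell the damping drops out and the transport part gains one power, which is the
source of the superconvergence. -/
theorem Mesh.defect_bounds {M : Mesh a b N} {κ K : ℝ} (hκ : M.ShapeRegular κ)
    (hc : IsCVNodes m k c) (hk : 1 ≤ k) (hh : M.h ≤ 1) (hK : IsCellBound c D (a - T) b K)
    (hper : bc = .periodic → ∀ n ≤ k + 2, ∀ t ∈ Set.Icc 0 T, D n (a - t) = D n (b - t))
    {t : ℝ} (ht : t ∈ Set.Icc 0 T) (i : Fin N) :
    (∀ j, |M.defect bc c D t i j| ≤ (1 + 2 * (k + 1) * sigmaConst k κ K) * K * M.h ^ (k + 2)) ∧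
    (∀ j, |M.defectDeriv bc c D t i j|
      ≤ (1 + 2 * (k + 1) * sigmaConst k κ K) * K * M.h ^ (k + 2)) ∧
    |∑ j, M.defect bc c D t i j| ≤ K * M.h ^ (k + 3) := by
  have hl := (M.len_pos i).le
  have hlh := M.len_le_h i
  have hS0 := sigmaConst_nonneg (k := k) (zero_le_one.trans hκ.one_le) hK.nonneg
  have hflux : ∀ n ≤ 1, ∀ j : Fin (k + 1), |D n (M.pt c i j.succ - t)
      - D n (M.pt c i j.castSucc - t) - M.len i * cvInt c j (M.ref (M.wave c D (n + 1) t) i)|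
      ≤ K * M.h ^ (k + 2) := fun n hn j => by
    rw [M.pt_sub, M.pt_sub, M.ref_wave hc]
    exact (hK.flux n hn j _ _ hl (M.left_sub_mem i ht) (M.right_sub_mem i ht)).trans
      (mul_le_mul_of_nonneg_left (pow_le_pow_left₀ hl hlh _) hK.nonneg)
  have hdamp : ∀ n ≤ k + 2, ∀ l ≤ k, ∀ j : Fin (k + 1),
      |dampInt c l j (M.ref (M.wave c D n t) i)| ≤ K * M.h := fun n hn l hl' j => by
    rw [M.ref_wave hc]
    exact (hK.damp n hn l hl' j _ _ hl (M.left_sub_mem i ht) (M.right_sub_mem i ht)).trans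
      (mul_le_mul_of_nonneg_left hlh hK.nonneg)
  have hσ : ∀ l ≤ k, _ := fun l hl' => M.waveSigma_bounds hκ hc hk hh hK hper hl' ht i
  have hprod : ∀ l ≤ k, ∀ n ≤ k + 2, ∀ j : Fin (k + 1),
      |M.waveSigma bc c D t l i * dampInt c l j (M.ref (M.wave c D n t) i)|
        ≤ sigmaConst k κ K * K * M.h ^ (k + 2) ∧
      |M.waveSigmaDeriv bc c D t l i * dampInt c l j (M.ref (M.wave c D n t) i)|
        ≤ sigmaConst k κ K * K * M.h ^ (k + 2) := fun l hl' n hn j => by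
    have e : sigmaConst k κ K * K * M.h ^ (k + 2)
        = sigmaConst k κ K * M.h ^ (k + 1) * (K * M.h) := by ring
    have h0 : 0 ≤ sigmaConst k κ K * M.h ^ (k + 1) := mul_nonneg hS0 (pow_nonneg M.h_pos.le _)
    rw [e, abs_mul, abs_mul]
    exact ⟨mul_le_mul (hσ l hl').1 (hdamp n hn l hl' j) (abs_nonneg _) h0,
      mul_le_mul (hσ l hl').2 (hdamp n hn l hl' j) (abs_nonneg _) h0⟩
  have hsum : ∀ (f : ℕ → ℝ) (r : ℝ), (∀ l ≤ k, |f l| ≤ r) →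
      |∑ l ∈ range (k + 1), f l| ≤ (k + 1) * r := fun f r hf => by
    refine (abs_sum_le_sum_abs _ _).trans ((sum_le_sum fun l hl' =>
      hf l (Nat.lt_succ_iff.1 (mem_range.1 hl'))).trans ?_)
    simp
  have hH := mul_nonneg (mul_nonneg hS0 hK.nonneg) (pow_nonneg M.h_pos.le (k + 2))
  refine ⟨fun j => ?_, fun j => ?_, ?_⟩
  · have h1 := hsum _ _ fun l hl' => (hprod l hl' 0 (by omega) j).1
    refine (abs_add_le _ _).trans ((add_le_add (hflux 0 (by omega) j) h1).trans ?_)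
    nlinarith [mul_nonneg (by positivity : (0 : ℝ) ≤ k + 1) hH]
  · have h1 := hsum (fun l => M.waveSigmaDeriv bc c D t l i *
        dampInt c l j (M.ref (M.wave c D 0 t) i) - M.waveSigma bc c D t l i *
        dampInt c l j (M.ref (M.wave c D 1 t) i)) _ fun l hl' =>
      (abs_sub _ _).trans (add_le_add (hprod l hl' 0 (by omega) j).2 (hprod l hl' 1 (by omega) j).1)
    have h2 := hflux 1 le_rfl j
    rw [← abs_neg] at h2
    refine (abs_add_le _ _).trans ((add_le_add h2 h1).trans (le_of_eq ?_))
    ring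
  · have h1 : ∑ j, M.defect bc c D t i j
        = D 0 (M.left i - t + M.len i) - D 0 (M.left i - t)
          - M.len i * polyInt 0 1 (cellItp c D 1 (M.left i - t) (M.len i)) := by
      simp only [Mesh.defect]
      rw [sum_add_distrib, sum_comm (s := univ) (t := range (k + 1))]
      simp_rw [← mul_sum, sum_dampInt hc, mul_zero]
      rw [sum_const_zero, add_zero, sum_sub_distrib, ← mul_sum, sum_cvInt hc, M.ref_wave hc]
      congr 1
      have h2 := sum_sub_castSucc (fun j => D 0 (M.pt c i j - t)) 0
      simp only [Fin.zero_le, filter_true] at h2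
      rw [h2, M.pt_sub, M.pt_sub, hc.first, hc.last, mul_one, mul_zero, add_zero]
    rw [h1]
    exact (hK.flux_sum _ _ hl (M.left_sub_mem i ht) (M.right_sub_mem i ht)).trans
      (mul_le_mul_of_nonneg_left (pow_le_pow_left₀ hl hlh _) hK.nonneg)

/-- The correction, in reference coordinates, built from the smooth damping coefficients. -/
noncomputable def Mesh.waveCorr (M : Mesh a b N) (bc : Boundary) (c : Fin (k + 2) → ℝ)
    (D : ℕ → ℝ → ℝ) (t : ℝ) (i : Fin N) : ℝ[X] :=
  itp c (partialSum (M.defect bc c D t i))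

/-- The time derivative of `Mesh.waveCorr`. -/
noncomputable def Mesh.waveCorrDeriv (M : Mesh a b N) (bc : Boundary) (c : Fin (k + 2) → ℝ)
    (D : ℕ → ℝ → ℝ) (t : ℝ) (i : Fin N) : ℝ[X] :=
  itp c (partialSum (M.defectDeriv bc c D t i))

/-- The bound for the correction of a travelling wave. -/
noncomputable def corrConst (k : ℕ) (κ K : ℝ) : ℝ :=
  (k + 1) * ((k + 1) * ((1 + 2 * (k + 1) * sigmaConst k κ K) * K))

theorem corrConst_nonneg {κ K : ℝ} (hκ : 0 ≤ κ) (hK : 0 ≤ K) : 0 ≤ corrConst k κ K := by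
  have := sigmaConst_nonneg (k := k) hκ hK
  rw [corrConst]; positivity

theorem Mesh.waveCorr_bounds {M : Mesh a b N} {κ K : ℝ} (hκ : M.ShapeRegular κ)
    (hc : IsCVNodes m k c) (hk : 1 ≤ k) (hh : M.h ≤ 1) (hK : IsCellBound c D (a - T) b K)
    (hper : bc = .periodic → ∀ n ≤ k + 2, ∀ t ∈ Set.Icc 0 T, D n (a - t) = D n (b - t))
    {t : ℝ} (ht : t ∈ Set.Icc 0 T) (i : Fin N) :
    nodeNorm c (M.waveCorr bc c D t i) ≤ corrConst k κ K * M.h ^ (k + 2) ∧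
    nodeNorm c (M.waveCorrDeriv bc c D t i) ≤ corrConst k κ K * M.h ^ (k + 2) := by
  obtain ⟨h1, h2, -⟩ := M.defect_bounds hκ hc hk hh hK hper ht i
  have e : corrConst k κ K * M.h ^ (k + 2)
      = (k + 1) * ((k + 1) * ((1 + 2 * (k + 1) * sigmaConst k κ K) * K * M.h ^ (k + 2))) := by
    rw [corrConst]; ring
  rw [e]
  exact ⟨nodeNorm_itp_le hc (abs_partialSum_le h1), nodeNorm_itp_le hc (abs_partialSum_le h2)⟩

end OFSV

namespace OFSV

open Polynomial Finset

variable {m : Method} {k : ℕ} {c : Fin (k + 2) → ℝ} {a b T B : ℝ} {N : ℕ} {D : ℕ → ℝ → ℝ}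
  {bc : Boundary} {g : ℝ → ℝ}

/-! ### The error equation -/

theorem nodeNorm_sub_le (p q : ℝ[X]) : nodeNorm c (p - q) ≤ nodeNorm c p + nodeNorm c q := by
  rw [nodeNorm, nodeNorm, nodeNorm, ← sum_add_distrib]
  refine sum_le_sum fun j _ => ?_
  rw [eval_sub]
  exact abs_sub _ _

/-- The wave with profile `D 0` satisfies the boundary condition, together with the relations that
follow by differentiation. -/
structure IsCompatible (bc : Boundary) (k : ℕ) (a b T : ℝ) (g : ℝ → ℝ) (D : ℕ → ℝ → ℝ) : Prop where
  periodic : bc = .periodic → ∀ n ≤ k + 2, ∀ t ∈ Set.Icc 0 T, D n (a - t) = D n (b - t)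
  inflow : bc = .inflow → ∀ n ≤ k + 2, ∀ t ∈ Set.Icc 0 T, inflowData T g t n = D n (a - t)

theorem IsSolution.isCompatible {u₀ : ℝ → ℝ} {u : ℝ → ℝ → ℝ} (hab : a ≤ b) (hT : 0 < T)
    (hu : IsSolution bc a b T u₀ g u) (hD : IsProfile (a - T) b B (k + 2) D)
    (huD : ∀ x ∈ Set.Icc a b, ∀ t ∈ Set.Icc 0 T, u x t = D 0 (x - t)) :
    IsCompatible bc k a b T g D := by
  constructor <;> rintro rfl
  · refine hD.periodic hab hT fun t ht => ?_
    rw [← huD a ⟨le_rfl, hab⟩ t ht, ← huD b ⟨hab, le_rfl⟩ t ht]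
    exact hu.boundary t ht
  · refine hD.inflowData_eq hab hT fun t ht => ?_
    rw [← huD a ⟨le_rfl, hab⟩ t ht]
    exact hu.boundary t ht

variable [NeZero N]

theorem upwind_congr {e e' : ℝ} (h : bc = .inflow → e = e') (z : Fin N → ℝ) (i : Fin N) :
    upwind bc e z i = upwind bc e' z i := by
  cases bc with
  | periodic => rfl
  | inflow => rw [h rfl]

theorem Mesh.sigma_congr (M : Mesh a b N) {ext ext' : ℕ → ℝ} {l : ℕ}
    (h : bc = .inflow → ext l = ext' l) (w : Fin N → ℝ[X]) (i : Fin N) :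
    M.sigma k bc ext w l i = M.sigma k bc ext' w l i := by
  have h1 : M.leftJump bc ext w l = M.leftJump bc ext' w l := by
    funext i
    rw [M.leftJump_eq, M.leftJump_eq, upwind_congr h]
  rw [Mesh.sigma, Mesh.sigma, M.rightJump_eq, M.rightJump_eq, h1]

/-- The distance of the damping coefficients from their smooth approximation. -/
theorem Mesh.abs_sigma_sub_waveSigma_le {M : Mesh a b N} {κ K : ℝ} (hκ : M.ShapeRegular κ)
    (hc : IsCVNodes m k c) (hk : 1 ≤ k) (hK : IsFunctionalBound m k c K)
    (hD : IsCompatible bc k a b T g D) {w : Fin N → ℝ[X]} (hw : ∀ i, (w i).natDegree ≤ k) {t : ℝ}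
    (ht : t ∈ Set.Icc 0 T) {l : ℕ} (hl : l ≤ k) (i : Fin N) :
    |M.sigma k bc (inflowData T g t) w l i - M.waveSigma bc c D t l i|
      ≤ (4 * k + 2) * (2 * κ ^ k * K *
        patch (fun i => nodeNorm c (M.ref w i - M.ref (M.wave c D 0 t) i)) i + M.h ^ (k + 2)) := by
  rw [M.sigma_congr (fun h => hD.inflow h l (by omega) t ht)
    (ext' := fun l => D l (a - t)), Mesh.waveSigma]
  refine (M.abs_sigma_sub_regSigma_le hκ hk hK bc _ (fun i => natDegree_toRef_le _ _ (hw i))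
    (M.natDegree_ref_wave_le hc 0 t) hl i _).trans (le_of_eq ?_)
  -- The regularisation contributes h^l h^{k+2-l} = h^{k+2}, the target order; this determines its
  -- exponent. The natural subtraction is exact because l ≤ k.
  rw [abs_of_nonneg (pow_nonneg M.h_pos.le _), ← pow_add, show l + (k + 2 - l) = k + 2 by omega]

/-- The error of the discrete solution `w`, in reference coordinates, with the correction. -/
noncomputable def Mesh.corrErr (M : Mesh a b N) (bc : Boundary) (c : Fin (k + 2) → ℝ)
    (D : ℕ → ℝ → ℝ) (t : ℝ) (w : Fin N → ℝ[X]) (i : Fin N) : ℝ[X] :=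
  M.ref w i - M.ref (M.wave c D 0 t) i + M.waveCorr bc c D t i

theorem Mesh.natDegree_corrErr_le (M : Mesh a b N) (hc : IsCVNodes m k c) {w : Fin N → ℝ[X]}
    (hw : ∀ i, (w i).natDegree ≤ k) (t : ℝ) (i : Fin N) :
    (M.corrErr bc c D t w i).natDegree ≤ k :=
  (natDegree_add_le _ _).trans (max_le ((natDegree_sub_le _ _).trans (max_le
    (natDegree_toRef_le _ _ (hw i)) (M.natDegree_ref_wave_le hc 0 t i))) (natDegree_itp_le hc _))

/-- The residual of `Mesh.corrErr` in the scheme. -/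
noncomputable def Mesh.residual (M : Mesh a b N) (bc : Boundary) (c : Fin (k + 2) → ℝ)
    (D : ℕ → ℝ → ℝ) (t : ℝ) (σ : ℕ → Fin N → ℝ) (i : Fin N) (j : Fin (k + 1)) : ℝ :=
  M.len i * cvInt c j (M.waveCorrDeriv bc c D t i)
    - (if j = Fin.last k then ∑ r, M.defect bc c D t i r else 0)
    - ∑ l ∈ range (k + 1), (σ l i - M.waveSigma bc c D t l i) *
        dampInt c l j (M.ref (M.wave c D 0 t) i)
    + ∑ l ∈ range (k + 1), σ l i * dampInt c l j (M.waveCorr bc c D t i)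

/-- With σ frozen, the scheme is affine. By definition of the defect, u_I satisfies it with σ̃ up to
that defect, and the fluxes of ω̃ cancel the defect except for its total on the last control volume.
The traces of ω̃ at right end points are zero, so the upwind values of the error do not contain it.
-/
theorem Mesh.corrErr_eq {M : Mesh a b N} (hc : IsCVNodes m k c) (hk : 1 ≤ k)
    (hD : IsCompatible bc k a b T g D) {t : ℝ} (ht : t ∈ Set.Icc 0 T) {w ut : Fin N → ℝ[X]}
    {σ : ℕ → Fin N → ℝ}
    (h : ∀ i (j : Fin (k + 1)), M.len i * cvInt c j (ut i)
        + ((M.ref w i).eval (c j.succ) - if j = 0 then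
            upwind bc (inflowData T g t 0) (fun i => (M.ref w i).eval 1) i
          else (M.ref w i).eval (c j.castSucc))
        + ∑ l ∈ range (k + 1), σ l i * dampInt c l j (M.ref w i) = 0) (i : Fin N)
    (j : Fin (k + 1)) :
    M.len i * cvInt c j (ut i + M.ref (M.wave c D 1 t) i + M.waveCorrDeriv bc c D t i)
      + ((M.corrErr bc c D t w i).eval (c j.succ) - if j = 0 then
          upwind bc 0 (fun i => (M.corrErr bc c D t w i).eval 1) i
        else (M.corrErr bc c D t w i).eval (c j.castSucc))
      + ∑ l ∈ range (k + 1), σ l i * dampInt c l j (M.corrErr bc c D t w i)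
      = M.residual bc c D t σ i j := by
  have hwave : (M.ref (M.wave c D 0 t) i).eval (c j.succ) - (if j = 0 then
      upwind bc (D 0 (a - t)) (fun i => (M.ref (M.wave c D 0 t) i).eval 1) i
      else (M.ref (M.wave c D 0 t) i).eval (c j.castSucc))
      = D 0 (M.pt c i j.succ - t) - D 0 (M.pt c i j.castSucc - t) := by
    rw [M.ref_wave_eval hc]
    congr 1
    split_ifs with hj
    · simp only [M.ref_wave_eval_one hc]
      rw [upwind_wave_eq M hD.periodic (by omega) ht, hj, Fin.castSucc_zero, Mesh.pt, hc.first,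
        mul_zero, add_zero]
    · obtain ⟨r, hr⟩ := Fin.exists_succ_eq.2 (show j.castSucc ≠ 0 by
        rwa [Ne, Fin.castSucc_eq_zero_iff])
      rw [← hr, M.ref_wave_eval hc]
  have hcorr := itp_partialSum_flux hc hk (M.defect bc c D t i) j
  have hup : upwind bc 0 (fun i => (M.corrErr bc c D t w i).eval 1) i
      = upwind bc (inflowData T g t 0) (fun i => (M.ref w i).eval 1) i
        - upwind bc (D 0 (a - t)) (fun i => (M.ref (M.wave c D 0 t) i).eval 1) i := by
    rw [upwind_congr (fun h => hD.inflow h 0 (by omega) t ht), upwind_sub, sub_self]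
    congr 1
    ext i
    rw [Mesh.corrErr, eval_add, Mesh.waveCorr, itp_partialSum_eval_one hc, add_zero, eval_sub]
  have hs : ∑ l ∈ range (k + 1), σ l i * dampInt c l j (M.corrErr bc c D t w i)
      = ∑ l ∈ range (k + 1), σ l i * dampInt c l j (M.ref w i)
        - ∑ l ∈ range (k + 1), (σ l i - M.waveSigma bc c D t l i) *
            dampInt c l j (M.ref (M.wave c D 0 t) i)
        - ∑ l ∈ range (k + 1), M.waveSigma bc c D t l i *
            dampInt c l j (M.ref (M.wave c D 0 t) i)
        + ∑ l ∈ range (k + 1), σ l i * dampInt c l j (M.waveCorr bc c D t i) := by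
    rw [← sum_sub_distrib, ← sum_sub_distrib, ← sum_add_distrib]
    refine sum_congr rfl fun l _ => ?_
    rw [Mesh.corrErr, map_add, map_sub]
    ring
  have hflux : ((M.corrErr bc c D t w i).eval (c j.succ) - if j = 0 then
          upwind bc 0 (fun i => (M.corrErr bc c D t w i).eval 1) i
        else (M.corrErr bc c D t w i).eval (c j.castSucc))
      = ((M.ref w i).eval (c j.succ) - if j = 0 then
            upwind bc (inflowData T g t 0) (fun i => (M.ref w i).eval 1) i
          else (M.ref w i).eval (c j.castSucc))
        - (D 0 (M.pt c i j.succ - t) - D 0 (M.pt c i j.castSucc - t))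
        + (M.defect bc c D t i j
          - if j = Fin.last k then ∑ r, M.defect bc c D t i r else 0) := by
    rw [← hwave, ← hcorr, hup]
    simp only [Mesh.corrErr, eval_add, eval_sub, Mesh.waveCorr]
    split_ifs <;> ring
  rw [hs, hflux, map_add, map_add, Mesh.residual]
  have h1 := h i j
  have h2 : M.defect bc c D t i j = D 0 (M.pt c i j.succ - t) - D 0 (M.pt c i j.castSucc - t)
    - M.len i * cvInt c j (M.ref (M.wave c D 1 t) i)
    + ∑ l ∈ range (k + 1), M.waveSigma bc c D t l i *
      dampInt c l j (M.ref (M.wave c D 0 t) i) := rfl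
  linear_combination h1 + h2

/-- The bound for the distance of the damping coefficients from their smooth approximation. -/
noncomputable def sigmaErrConst (k : ℕ) (κ K₁ K : ℝ) : ℝ :=
  (4 * k + 2) * (2 * κ ^ k * K₁ * (1 + 3 * corrConst k κ K) + 1)

/-- The bound for the residual. -/
noncomputable def residualConst (k : ℕ) (κ K₁ K : ℝ) : ℝ :=
  K₁ * corrConst k κ K + K + (k + 1) * (sigmaErrConst k κ K₁ K * (K + K₁ * corrConst k κ K)
    + sigmaConst k κ K * K₁ * corrConst k κ K)

theorem sigmaErrConst_nonneg {κ K₁ K : ℝ} (hκ : 0 ≤ κ) (hK₁ : 0 ≤ K₁) (hK : 0 ≤ K) :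
    0 ≤ sigmaErrConst k κ K₁ K := by
  have := corrConst_nonneg (k := k) hκ hK
  rw [sigmaErrConst]; positivity

theorem residualConst_nonneg {κ K₁ K : ℝ} (hκ : 0 ≤ κ) (hK₁ : 0 ≤ K₁) (hK : 0 ≤ K) :
    0 ≤ residualConst k κ K₁ K := by
  have h1 := corrConst_nonneg (k := k) hκ hK
  have h2 := sigmaConst_nonneg (k := k) hκ hK
  have h3 := sigmaErrConst_nonneg (k := k) hκ hK₁ hK
  rw [residualConst]; positivity

theorem patch_mono {z z' : Fin N → ℝ} (h : ∀ i, z i ≤ z' i) (i : Fin N) :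
    patch z i ≤ patch z' i := by
  rw [patch, patch]
  linarith [h (i - 1), h i, h (i + 1)]

theorem patch_nonneg {z : Fin N → ℝ} (h : ∀ i, 0 ≤ z i) (i : Fin N) : 0 ≤ patch z i := by
  rw [patch]
  linarith [h (i - 1), h i, h (i + 1)]

/-- Each of the four terms has a spare factor h: the cell length before ∂ₜω̃, the superconvergent
total defect, the damping of u_I beside σ - σ̃, and for the damping of ω̃ either the size h^{k+1} of
σ̃ or the size h^{k+2} of ω̃. This factor balances the missing cell length in the energy and leaves
a constant independent of h in Gronwall's inequality. -/
theorem Mesh.abs_residual_le {M : Mesh a b N} {κ K₁ K : ℝ} (hκ : M.ShapeRegular κ)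
    (hc : IsCVNodes m k c) (hk : 1 ≤ k) (hh : M.h ≤ 1) (hK₁ : IsFunctionalBound m k c K₁)
    (hK : IsCellBound c D (a - T) b K) (hD : IsCompatible bc k a b T g D) {w : Fin N → ℝ[X]}
    (hw : ∀ i, (w i).natDegree ≤ k) {t : ℝ} (ht : t ∈ Set.Icc 0 T) (i : Fin N)
    (j : Fin (k + 1)) :
    |M.residual bc c D t (M.sigma k bc (inflowData T g t) w) i j|
      ≤ residualConst k κ K₁ K * M.h *
        (M.h ^ (k + 2) + patch (fun i => nodeNorm c (M.corrErr bc c D t w i)) i) := by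
  have hκ0 : 0 ≤ κ := zero_le_one.trans hκ.one_le
  have hQ := corrConst_nonneg (k := k) hκ0 hK.nonneg
  have hs := sigmaConst_nonneg (k := k) hκ0 hK.nonneg
  have hS := sigmaErrConst_nonneg (k := k) hκ0 hK₁.nonneg hK.nonneg
  have hh0 := M.h_pos.le
  have hK0 := hK.nonneg
  have hK10 := hK₁.nonneg
  have hcorr := fun i => M.waveCorr_bounds hκ hc hk hh hK hD.periodic ht i
  have hH : 0 ≤ M.h ^ (k + 2) := pow_nonneg hh0 _
  have hHh : M.h ^ (k + 2) ≤ M.h := pow_le_of_le_one hh0 hh (by omega)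
  have hHh' : M.h ^ (k + 1) ≤ M.h := pow_le_of_le_one hh0 hh (by omega)
  have hpatch0 := patch_nonneg (fun i => nodeNorm_nonneg (c := c) (M.corrErr bc c D t w i)) i
  have hpatch : patch (fun i => nodeNorm c (M.ref w i - M.ref (M.wave c D 0 t) i)) i
      ≤ patch (fun i => nodeNorm c (M.corrErr bc c D t w i)) i
        + 3 * corrConst k κ K * M.h ^ (k + 2) := by
    have h1 : ∀ i, nodeNorm c (M.ref w i - M.ref (M.wave c D 0 t) i)
        ≤ nodeNorm c (M.corrErr bc c D t w i) + corrConst k κ K * M.h ^ (k + 2) := fun i => by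
      have h2 := nodeNorm_sub_le (c := c) (M.corrErr bc c D t w i) (M.waveCorr bc c D t i)
      rw [Mesh.corrErr, add_sub_cancel_right, ← Mesh.corrErr] at h2
      exact h2.trans (add_le_add_right (hcorr i).1 _)
    refine (patch_mono h1 i).trans (le_of_eq ?_)
    simp only [patch]
    ring
  set P := patch (fun i => nodeNorm c (M.corrErr bc c D t w i)) i
  set H := M.h ^ (k + 2)
  have hσ : ∀ l ≤ k, |M.sigma k bc (inflowData T g t) w l i - M.waveSigma bc c D t l i|
      ≤ sigmaErrConst k κ K₁ K * (H + P) := fun l hl => by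
    refine (M.abs_sigma_sub_waveSigma_le hκ hc hk hK₁ hD hw ht hl i).trans ?_
    rw [sigmaErrConst, mul_assoc (4 * (k : ℝ) + 2) _ (H + P)]
    refine mul_le_mul_of_nonneg_left ?_ (by positivity)
    have e : 0 ≤ 2 * κ ^ k * K₁ := by positivity
    have e1 := mul_le_mul_of_nonneg_left hpatch e
    have e2 := mul_nonneg e (mul_nonneg hQ hpatch0)
    have e3 := mul_nonneg e hH
    linarith
  have hσ' : ∀ l ≤ k, |M.sigma k bc (inflowData T g t) w l i|
      ≤ sigmaConst k κ K * M.h ^ (k + 1) + sigmaErrConst k κ K₁ K * (H + P) := fun l hl => by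
    have h1 := (M.waveSigma_bounds hκ hc hk hh hK hD.periodic hl ht i).1
    have h2 := abs_add_le (M.waveSigma bc c D t l i)
      (M.sigma k bc (inflowData T g t) w l i - M.waveSigma bc c D t l i)
    rw [add_sub_cancel] at h2
    exact h2.trans (add_le_add h1 (hσ l hl))
  have hdampw : ∀ l ≤ k, |dampInt c l j (M.ref (M.wave c D 0 t) i)| ≤ K * M.h := fun l hl => by
    rw [M.ref_wave hc]
    exact (hK.damp 0 (by omega) l hl j _ _ (M.len_pos i).le (M.left_sub_mem i ht)
      (M.right_sub_mem i ht)).trans (mul_le_mul_of_nonneg_left (M.len_le_h i) hK0)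
  have hdampc : ∀ l ≤ k, |dampInt c l j (M.waveCorr bc c D t i)| ≤ K₁ * (corrConst k κ K * H) :=
    fun l hl => (hK₁.damp l hl j _ (natDegree_itp_le hc _)).trans
      (mul_le_mul_of_nonneg_left (hcorr i).1 hK10)
  have hsum : ∀ (f : ℕ → ℝ) (r : ℝ), (∀ l ≤ k, |f l| ≤ r) →
      |∑ l ∈ range (k + 1), f l| ≤ (k + 1) * r := fun f r hf => by
    refine (abs_sum_le_sum_abs _ _).trans ((sum_le_sum fun l hl' =>
      hf l (Nat.lt_succ_iff.1 (mem_range.1 hl'))).trans ?_)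
    simp
  have b1 : |M.len i * cvInt c j (M.waveCorrDeriv bc c D t i)|
      ≤ M.h * (K₁ * (corrConst k κ K * H)) := by
    rw [abs_mul, abs_of_pos (M.len_pos i)]
    exact mul_le_mul (M.len_le_h i) ((hK₁.cvInt j _ (natDegree_itp_le hc _)).trans
      (mul_le_mul_of_nonneg_left (hcorr i).2 hK10)) (abs_nonneg _) hh0
  have b2 : |if j = Fin.last k then ∑ r, M.defect bc c D t i r else 0| ≤ K * M.h * H := by
    have : K * M.h ^ (k + 3) = K * M.h * H := by rw [show k + 3 = k + 2 + 1 from rfl, pow_succ]; ring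
    rw [← this]
    split_ifs
    · exact (M.defect_bounds hκ hc hk hh hK hD.periodic ht i).2.2
    · rw [abs_zero]; positivity
  have hHP : 0 ≤ H + P := add_nonneg hH hpatch0
  have b3 := hsum (fun l => (M.sigma k bc (inflowData T g t) w l i - M.waveSigma bc c D t l i) *
        dampInt c l j (M.ref (M.wave c D 0 t) i)) (sigmaErrConst k κ K₁ K * (H + P) * (K * M.h))
    fun l hl => by
      rw [abs_mul]
      exact mul_le_mul (hσ l hl) (hdampw l hl) (abs_nonneg _) (mul_nonneg hS hHP)
  have b4 := hsum (fun l => M.sigma k bc (inflowData T g t) w l i *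
        dampInt c l j (M.waveCorr bc c D t i))
    (M.h * (sigmaConst k κ K * (K₁ * (corrConst k κ K * H))
      + sigmaErrConst k κ K₁ K * (H + P) * (K₁ * corrConst k κ K)))
    fun l hl => by
      rw [abs_mul]
      refine (mul_le_mul (hσ' l hl) (hdampc l hl) (abs_nonneg _)
        (add_nonneg (by positivity) (mul_nonneg hS hHP))).trans ?_
      have e1 := mul_le_mul_of_nonneg_left hHh'
        (mul_nonneg hs (mul_nonneg hK10 (mul_nonneg hQ hH)))
      have e2 := mul_le_mul_of_nonneg_left hHh (mul_nonneg (mul_nonneg hS hHP)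
        (mul_nonneg hK10 hQ))
      linarith
  have hfin : |M.residual bc c D t (M.sigma k bc (inflowData T g t) w) i j| ≤
      M.h * (K₁ * (corrConst k κ K * H)) + K * M.h * H
      + (k + 1) * (sigmaErrConst k κ K₁ K * (H + P) * (K * M.h))
      + (k + 1) * (M.h * (sigmaConst k κ K * (K₁ * (corrConst k κ K * H))
      + sigmaErrConst k κ K₁ K * (H + P) * (K₁ * corrConst k κ K))) := by
    rw [Mesh.residual]
    exact (abs_add_le _ _).trans (add_le_add ((abs_sub _ _).trans (add_le_add ((abs_sub _ _).trans
      (add_le_add b1 b2)) b3)) b4)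
  refine hfin.trans ?_
  have e1 := mul_nonneg (mul_nonneg hh0 (mul_nonneg hK10 hQ)) hpatch0
  have e2 := mul_nonneg (mul_nonneg hK0 hh0) hpatch0
  have e3 := mul_nonneg (mul_nonneg (by positivity : (0 : ℝ) ≤ k + 1) hh0) (mul_nonneg hs
    (mul_nonneg (mul_nonneg hK10 hQ) hpatch0))
  rw [residualConst]
  linarith

end OFSV

namespace OFSV

open Polynomial Finset

variable {m : Method} {k : ℕ} {c : Fin (k + 2) → ℝ} {a b T B : ℝ} {N : ℕ} {D : ℕ → ℝ → ℝ}
  {bc : Boundary} {g : ℝ → ℝ}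

/-! ### Stability -/

theorem Mesh.hasDerivWithinAt_corrErr [NeZero N] (M : Mesh a b N) (hc : IsCVNodes m k c)
    (hk : 1 ≤ k) (hab : a ≤ b) (hD : IsProfile (a - T) b B (k + 2) D) {uh : ℝ → Fin N → ℝ[X]}
    {ut : Fin N → ℝ[X]} {t : ℝ} (ht : t ∈ Set.Icc 0 T)
    (h : ∀ i x, HasDerivWithinAt (fun s => (M.ref (uh s) i).eval x) ((ut i).eval x)
      (Set.Icc 0 T) t) (i : Fin N) (j : Fin (k + 1)) :
    HasDerivWithinAt (fun s => (M.corrErr bc c D s (uh s) i).eval (c j.succ))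
      ((ut i + M.ref (M.wave c D 1 t) i + M.waveCorrDeriv bc c D t i).eval (c j.succ))
      (Set.Icc 0 T) t := by
  simp only [Mesh.corrErr, eval_add, eval_sub, Mesh.waveCorr, Mesh.waveCorrDeriv, itp_eval hc]
  have h1 := M.hasDerivWithinAt_ref_wave hc hD (n := 0) (by omega) (leval (c j.succ)) i ht
  have h2 := hasDerivWithinAt_partialSum
    (fun j => M.hasDerivWithinAt_defect (bc := bc) hc hk hab hD i j ht) j
  refine (((h i (c j.succ)).fun_sub h1).fun_add h2).congr_deriv ?_
  rw [leval_apply, sub_neg_eq_add]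

/-- The corrected error stays as small as it is at the initial time. -/
theorem exists_corrErr_bound {κ K : ℝ} (hc : IsCVNodes m k c) (hk : 1 ≤ k) (hab : a ≤ b)
    (hD : IsProfile (a - T) b B (k + 2) D) (hK : IsCellBound c D (a - T) b K)
    (hcomp : IsCompatible bc k a b T g D) (R : ℝ) :
    ∃ C, 0 ≤ C ∧ ∀ (N : ℕ) [NeZero N] (M : Mesh a b N), M.ShapeRegular κ → M.h ≤ 1 →
      ∀ uh : ℝ → Fin N → ℝ[X], M.IsSchemeSolution bc c T g uh →
      (∀ i, nodeNorm c (M.corrErr bc c D 0 (uh 0) i) ≤ R * M.h ^ (k + 2)) →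
      ∀ t ∈ Set.Icc 0 T, ∑ i, M.len i * nodeNorm c (M.corrErr bc c D t (uh t) i) ^ 2
        ≤ C * (M.h ^ (k + 2)) ^ 2 := by
  obtain ⟨K₁, hK₁⟩ := exists_isFunctionalBound hc
  obtain ⟨K₂, hK₂, hE⟩ := exists_energy_bounds hc hk
  -- Twice the constant of `Mesh.energy_step` (the energy derivative has a factor 2), with the nodal
  -- sum estimated by K₂ times the energy. The constants are chosen before any mesh is given, when
  -- the sign of κ is unknown; hence |L| in the exponential.
  set L := 2 * (3 * κ * (k + 1) * K₁ * residualConst k κ K₁ K * ((b - a) + 3 * K₂))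
  have hba := sub_nonneg.2 hab
  refine ⟨K₂ * ((K₂ * (b - a) * R ^ 2 + 1) * Real.exp (|L| * T)), by positivity,
    fun N _ M hκ hh uh hs h0 t ht => ?_⟩
  have hκ0 : 0 ≤ κ := zero_le_one.trans hκ.one_le
  have hA := residualConst_nonneg (k := k) hκ0 hK₁.nonneg hK.nonneg
  have hK10 := hK₁.nonneg
  have hdeg : ∀ s ∈ Set.Icc 0 T, ∀ i, (M.corrErr bc c D s (uh s) i).natDegree ≤ k := fun s hs' i =>
    M.natDegree_corrErr_le hc (hs.degree s hs') s i
  set H := M.h ^ (k + 2)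
  have hlow : ∀ s ∈ Set.Icc 0 T, ∑ i, M.len i * nodeNorm c (M.corrErr bc c D s (uh s) i) ^ 2
      ≤ K₂ * M.energy m c (M.corrErr bc c D s (uh s)) := fun s hs' => by
    rw [Mesh.energy, mul_sum]
    refine sum_le_sum fun i _ => ?_
    rw [mul_left_comm]
    exact mul_le_mul_of_nonneg_left (hE _ (hdeg s hs' i)).1 (M.len_pos i).le
  have hsum0 : ∀ s, 0 ≤ ∑ i, M.len i * nodeNorm c (M.corrErr bc c D s (uh s) i) ^ 2 := fun s =>
    sum_nonneg fun i _ => mul_nonneg (M.len_pos i).le (sq_nonneg _)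
  have hE0 : ∀ s ∈ Set.Icc 0 T, 0 ≤ M.energy m c (M.corrErr bc c D s (uh s)) := fun s hs' =>
    nonneg_of_mul_nonneg_right ((hsum0 s).trans (hlow s hs')) hK₂
  have hstep : ∀ s ∈ Set.Icc 0 T, ∃ d, HasDerivWithinAt
      (fun s => M.energy m c (M.corrErr bc c D s (uh s))) d (Set.Icc 0 T) s ∧
      d ≤ |L| * (M.energy m c (M.corrErr bc c D s (uh s)) + H ^ 2) := fun s hs' => by
    obtain ⟨ut, hut, hder, heq⟩ := hs.ref_eq hs'
    refine ⟨_, M.hasDerivWithinAt_energy hc hk hs' hdeg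
      (zt := fun i => ut i + M.ref (M.wave c D 1 s) i + M.waveCorrDeriv bc c D s i)
      (fun i => (natDegree_add_le _ _).trans (max_le ((natDegree_add_le _ _).trans
        (max_le (hut i) (M.natDegree_ref_wave_le hc 1 s i))) (natDegree_itp_le hc _)))
      (fun i j => M.hasDerivWithinAt_corrErr hc hk hab hD hs' hder i j), ?_⟩
    have h1 := M.energy_step hκ hc hk hK₁ hA bc (hdeg s hs')
      (fun l i => M.sigma_nonneg hk bc (inflowData T g s) (uh s) l i)
      (M.corrErr_eq hc hk hcomp hs' heq)
      (M.abs_residual_le hκ hc hk hh hK₁ hK hcomp (hs.degree s hs') hs')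
    have h2 := hlow s hs'
    have h3 := hE0 s hs'
    have hq : 0 ≤ 3 * κ * (k + 1) * K₁ * residualConst k κ K₁ K := by positivity
    have h4 : (b - a) * H ^ 2 + 3 * ∑ i, M.len i * nodeNorm c (M.corrErr bc c D s (uh s) i) ^ 2
        ≤ ((b - a) + 3 * K₂) * (M.energy m c (M.corrErr bc c D s (uh s)) + H ^ 2) := by
      have := mul_nonneg hba h3
      have := mul_nonneg hK₂.le (sq_nonneg H)
      nlinarith
    refine (mul_le_mul_of_nonneg_left (h1.trans (mul_le_mul_of_nonneg_left h4 hq))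
      zero_le_two).trans ?_
    rw [← mul_assoc, ← mul_assoc]
    exact mul_le_mul_of_nonneg_right ((le_of_eq (by ring)).trans (le_abs_self L))
      (add_nonneg h3 (sq_nonneg H))
  choose! d hd hdle using hstep
  have hgr := le_mul_exp_of_hasDerivWithinAt hd hdle ht
  have hT0 : (0 : ℝ) ∈ Set.Icc 0 T := ⟨le_rfl, ht.1.trans ht.2⟩
  have hinit : M.energy m c (M.corrErr bc c D 0 (uh 0)) ≤ K₂ * (b - a) * R ^ 2 * H ^ 2 := by
    have h1 : ∀ i, M.len i * ∑ j, star m k c j (M.corrErr bc c D 0 (uh 0) i) *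
        cvInt c j (M.corrErr bc c D 0 (uh 0) i) ≤ M.len i * (K₂ * (R * H) ^ 2) := fun i =>
      mul_le_mul_of_nonneg_left ((hE _ (hdeg 0 hT0 i)).2.trans (mul_le_mul_of_nonneg_left
        (pow_le_pow_left₀ (nodeNorm_nonneg _) (h0 i) 2) hK₂.le)) (M.len_pos i).le
    refine (sum_le_sum fun i _ => h1 i).trans (le_of_eq ?_)
    rw [← sum_mul, M.sum_len]
    ring
  have hexp : Real.exp (|L| * t) ≤ Real.exp (|L| * T) :=
    Real.exp_le_exp.2 (mul_le_mul_of_nonneg_left ht.2 (abs_nonneg L))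
  calc ∑ i, M.len i * nodeNorm c (M.corrErr bc c D t (uh t) i) ^ 2
      ≤ K₂ * M.energy m c (M.corrErr bc c D t (uh t)) := hlow t ht
    _ ≤ K₂ * ((K₂ * (b - a) * R ^ 2 * H ^ 2 + H ^ 2) * Real.exp (|L| * T)) := by
        refine mul_le_mul_of_nonneg_left ?_ hK₂.le
        refine ((le_add_of_nonneg_right (sq_nonneg H)).trans hgr).trans ?_
        exact mul_le_mul (by linarith) hexp (Real.exp_pos _).le (by positivity)
    _ = _ := by ring

end OFSV

namespace OFSV

open Polynomial Finset

variable {m : Method} {k : ℕ} {c : Fin (k + 2) → ℝ} {a b T B : ℝ} {N : ℕ} {D : ℕ → ℝ → ℝ}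
  {bc : Boundary} {g : ℝ → ℝ}

/-! ### The correction function on the reference cell -/

/-- A polynomial that vanishes at `1` is bounded by its moments against derivatives, expressed
through the trial-to-test map. -/
theorem exists_correction_bound (hk : 1 ≤ k) (c : Fin (k + 2) → ℝ) :
    ∃ C, 0 ≤ C ∧ ∀ (ω : ℝ[X]) (X : Fin (k + 1) → ℝ) (r : ℝ), ω.natDegree ≤ k → ω.eval 1 = 0 →
      (∀ j, |X j| ≤ r) →
      (∀ q : ℝ[X], q.natDegree ≤ k → polyInt 0 1 q = 0 →
        polyInt 0 1 (ω * derivative q) = ∑ j, star m k c j q * X j) →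
      nodeNorm c ω ≤ C * r := by
  have hW : ∀ x : ℝ, (1 - Polynomial.X : ℝ[X]).eval x = 1 - x := fun x => by simp
  have hform := exists_sq_le_form k (weightForm (1 - Polynomial.X))
    (fun p => weightForm_self_nonneg (fun x hx => by rw [hW]; linarith [hx.2]) p)
    (weightForm_symm _)
    (fun p hp => eq_zero_of_weightForm_self (fun x hx => by rw [hW]; linarith [hx.2])
      (by rw [hW]; norm_num) hp)
  choose C₁ hC₁0 hC₁ using fun j : Fin (k + 1) =>
    hform ((star m k c j).comp antideriv - (polyInt 0 1).comp antideriv)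
  choose C₂ hC₂0 hC₂ using fun j : Fin (k + 1) =>
    hform ((leval (c j.succ)).comp (LinearMap.mulLeft ℝ (1 - Polynomial.X)))
  refine ⟨(∑ j, √(C₂ j)) * ∑ j, √(C₁ j), mul_nonneg (sum_nonneg fun _ _ => Real.sqrt_nonneg _)
    (sum_nonneg fun _ _ => Real.sqrt_nonneg _), fun ω X r hω hω1 hX h => ?_⟩
  have hr : 0 ≤ r := (abs_nonneg _).trans (hX 0)
  -- Since ω(1) = 0, ω = (1 - x) η with η of degree at most k - 1. Testing with q' = η yields the
  -- integral of (1 - x) η², which is positive definite.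
  obtain ⟨η', hη'⟩ := dvd_iff_isRoot.2 hω1
  obtain ⟨η, rfl⟩ : ∃ η, η' = -η := ⟨-η', (neg_neg _).symm⟩
  have hωη : ω = (1 - Polynomial.X) * η := by rw [hη', C_1]; ring
  have hη : η.natDegree ≤ k - 1 := by
    rcases eq_or_ne η 0 with rfl | hne
    · simp
    · rw [hη', natDegree_mul (X_sub_C_ne_zero 1) (neg_ne_zero.2 hne), natDegree_X_sub_C,
        natDegree_neg] at hω
      omega
  set Q := weightForm (1 - Polynomial.X) η η
  have hQ0 : 0 ≤ Q :=
    weightForm_self_nonneg (fun x hx => by rw [hW]; linarith [hx.2]) η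
  have hb : ∀ {f C : ℝ}, f ^ 2 ≤ C * Q → |f| ≤ √C * √Q := fun {f C} hf => by
    rw [← Real.sqrt_mul' _ hQ0]
    exact Real.abs_le_sqrt hf
  -- The primitive of η with mean zero, as the test functions require. Its values under `star` are
  -- linear functionals of η, hence bounded by √Q.
  set q := antideriv η - C (polyInt 0 1 (antideriv η)) with hq
  have hstar : ∀ j, |star m k c j q| ≤ √(C₁ j) * √Q := fun j => by
    refine hb ?_
    have := hC₁ j η (hη.trans (by omega))
    rwa [LinearMap.sub_apply, LinearMap.comp_apply, LinearMap.comp_apply,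
      ← star_C (m := m) (c := c) j (polyInt 0 1 (antideriv η)), ← map_sub] at this
  have hqdeg : q.natDegree ≤ k := by
    rw [hq, natDegree_sub_C]
    exact (natDegree_antideriv_le hη).trans (by omega)
  have hqint : polyInt 0 1 q = 0 := by
    rw [hq, map_sub, polyInt_apply 0 1 (C _)]
    simp
  have hQ : Q = ∑ j, star m k c j q * X j := by
    rw [← h q hqdeg hqint, hq, derivative_sub, derivative_antideriv, derivative_C, sub_zero, hωη]
    rfl
  have hQle : Q ≤ (∑ j, √(C₁ j)) * r * √Q := by
    conv_lhs => rw [hQ]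
    rw [sum_mul, sum_mul]
    refine sum_le_sum fun j _ => (le_abs_self _).trans ?_
    rw [abs_mul]
    refine (mul_le_mul (hstar j) (hX j) (abs_nonneg _) (by positivity)).trans (le_of_eq ?_)
    ring
  -- Q is at most a constant times r √Q; one factor √Q is cancelled, the case √Q = 0 being trivial.
  have hS : √Q ≤ (∑ j, √(C₁ j)) * r := by
    rcases (Real.sqrt_nonneg Q).eq_or_lt with h0 | h0
    · rw [← h0]
      exact mul_nonneg (sum_nonneg fun _ _ => Real.sqrt_nonneg _) hr
    · refine le_of_mul_le_mul_right ?_ h0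
      rwa [Real.mul_self_sqrt hQ0]
  rw [mul_assoc]
  refine le_trans ?_ (mul_le_mul_of_nonneg_left hS (sum_nonneg fun _ _ => Real.sqrt_nonneg _))
  rw [nodeNorm, sum_mul]
  refine sum_le_sum fun j _ => hb ?_
  have := hC₂ j η (hη.trans (by omega))
  rwa [LinearMap.comp_apply, LinearMap.mulLeft_apply, leval_apply, ← hωη] at this

/-! ### The initial error -/

theorem Mesh.starVal_eq (M : Mesh a b N) (q : ℝ[X]) (i : Fin N) (j : Fin (k + 1)) :
    M.starVal m c q i j = star m k c j (toRef (M.left i) (M.len i) q) := by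
  rw [star_apply, Mesh.starVal, derivative_toRef, toRef_eval, mul_zero, add_zero]
  congr 1
  refine sum_congr rfl fun r _ => ?_
  rw [eval_mul, eval_C, toRef_eval, Mesh.pt]
  ring

/-- The integral over a control volume of the interpolation error of the time derivative. -/
theorem Mesh.integral_sub_interp (M : Mesh a b N) (hc : IsCVNodes m k c)
    (hD : IsProfile (a - T) b B (k + 2) D) (hT : 0 ≤ T) {vt : ℝ → ℝ}
    (hvt : ∀ x ∈ Set.Icc a b, vt x = -D 1 x) (i : Fin N) (j : Fin (k + 1)) :
    ∫ x in (M.pt c i j.castSucc)..(M.pt c i j.succ), (vt x - (M.interp c vt i).eval x)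
      = -(D 0 (M.pt c i j.succ - 0) - D 0 (M.pt c i j.castSucc - 0)
        - M.len i * cvInt c j (M.ref (M.wave c D 1 0) i)) := by
  have hle : M.pt c i j.castSucc ≤ M.pt c i j.succ :=
    add_le_add_right (mul_le_mul_of_nonneg_left (hc.strictMono Fin.castSucc_lt_succ).le
      (M.len_pos i).le) _
  have hsub : Set.Icc (M.pt c i j.castSucc) (M.pt c i j.succ) ⊆ Set.Icc a b :=
    Set.Icc_subset_Icc (M.pt_mem hc i _).1 (M.pt_mem hc i _).2
  have hsub' : Set.Icc a b ⊆ Set.Icc (a - T) b := Set.Icc_subset_Icc (by linarith) le_rfl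
  have hcont : ∀ n < k + 2, ContinuousOn (D n) (Set.Icc (M.pt c i j.castSucc) (M.pt c i j.succ)) :=
    fun n hn x hx => ((hD.deriv n hn x (hsub' (hsub hx))).continuousWithinAt).mono
      (hsub.trans hsub')
  have h1 : ∫ x in (M.pt c i j.castSucc)..(M.pt c i j.succ), D 1 x
      = D 0 (M.pt c i j.succ) - D 0 (M.pt c i j.castSucc) :=
    intervalIntegral.integral_eq_sub_of_hasDerivAt_of_le hle (hcont 0 (by omega))
      (fun x hx => (hD.deriv 0 (by omega) x (hsub' (hsub (Set.Ioo_subset_Icc_self hx)))).hasDerivAt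
        (Icc_mem_nhds (lt_of_le_of_lt (hsub'.trans' hsub ⟨le_rfl, hle⟩).1 hx.1)
          (lt_of_lt_of_le hx.2 (hsub ⟨hle, le_rfl⟩).2)))
      ((hcont 1 (by omega)).intervalIntegrable_of_Icc hle)
  have h2 : ∫ x in (M.pt c i j.castSucc)..(M.pt c i j.succ), (M.interp c vt i).eval x
      = -(M.len i * cvInt c j (M.ref (M.wave c D 1 0) i)) := by
    rw [← polyInt_apply, Mesh.pt, Mesh.pt, polyInt_cell, M.ref_interp hc, Mesh.ref, Mesh.wave,
      M.ref_interp hc, ← mul_neg, cvInt, ← map_neg, ← map_neg]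
    congr 3
    ext r
    rw [hvt _ (M.pt_mem hc i _), Pi.neg_apply, sub_zero]
  have h3 : ∫ x in (M.pt c i j.castSucc)..(M.pt c i j.succ), (vt x - (M.interp c vt i).eval x)
      = ∫ x in (M.pt c i j.castSucc)..(M.pt c i j.succ), (-D 1 x - (M.interp c vt i).eval x) := by
    refine intervalIntegral.integral_congr fun x hx => ?_
    rw [Set.uIcc_of_le hle] at hx
    simp only [hvt x (hsub hx)]
  rw [h3, intervalIntegral.integral_sub, intervalIntegral.integral_neg, h1, h2]
  · simp only [sub_zero]
    ring
  · exact ((hcont 1 (by omega)).neg).intervalIntegrable_of_Icc hle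
  · exact (by fun_prop : Continuous fun x => (M.interp c vt i).eval x).intervalIntegrable _ _

theorem Mesh.l2norm_le (M : Mesh a b N) {w : Fin N → ℝ[X]} {r : ℝ} (hr : 0 ≤ r)
    (h : ∑ i, M.len i * polyInt 0 1 (M.ref w i * M.ref w i) ≤ r ^ 2) : M.l2norm w ≤ r := by
  refine Real.sqrt_le_iff.2 ⟨hr, le_trans (le_of_eq (sum_congr rfl fun i _ => ?_)) h⟩
  have hcell := polyInt_cell (M.left i) (M.len i) 0 1 (w i * w i)
  simp only [mul_zero, add_zero, mul_one, M.left_add_len] at hcell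
  rw [Mesh.ref, ← toRef_mul, ← hcell, polyInt_apply]
  simp only [eval_mul, sq]

variable [NeZero N]

/-- The correction function in reference coordinates. -/
theorem Mesh.IsCorrection.ref_eq {M : Mesh a b N} {ext : ℕ → ℝ} {w ω : Fin N → ℝ[X]}
    {v vt : ℝ → ℝ} (h : M.IsCorrection m bc c ext w v vt ω) (hc : IsCVNodes m k c)
    (hD : IsProfile (a - T) b B (k + 2) D) (hT : 0 ≤ T)
    (hv : ∀ x ∈ Set.Icc a b, v x = D 0 x) (hvt : ∀ x ∈ Set.Icc a b, vt x = -D 1 x) (i : Fin N) :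
    (M.ref ω i).natDegree ≤ k ∧ (M.ref ω i).eval 1 = 0 ∧
    ∀ q : ℝ[X], q.natDegree ≤ k → polyInt 0 1 q = 0 →
      polyInt 0 1 (M.ref ω i * derivative q) = ∑ j, star m k c j q *
        (-(D 0 (M.pt c i j.succ - 0) - D 0 (M.pt c i j.castSucc - 0)
          - M.len i * cvInt c j (M.ref (M.wave c D 1 0) i))
        + ∑ l ∈ range (k + 1), M.sigma k bc ext w l i *
          dampInt c l j (M.ref (M.wave c D 0 0) i)) := by
  obtain ⟨hd, h1, hq⟩ := h i
  refine ⟨natDegree_toRef_le _ _ hd, ?_, fun q hqd hq0 => ?_⟩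
  · rw [Mesh.ref, toRef_eval, mul_one, M.left_add_len, h1]
  · obtain ⟨s, hs, rfl⟩ := exists_toRef_eq (M.left i) (M.len_pos i).ne' q hqd
    have hcell := fun p => polyInt_cell (M.left i) (M.len i) 0 1 p
    simp only [mul_zero, add_zero, mul_one, M.left_add_len] at hcell
    have h2 := hq s hs (by rw [← polyInt_apply, hcell, hq0, mul_zero])
    have h3 : ∫ x in (M.left i)..(M.right i), (ω i).eval x * s.derivative.eval x
        = polyInt 0 1 (M.ref ω i * derivative (toRef (M.left i) (M.len i) s)) := by
      rw [derivative_toRef, mul_left_comm, ← smul_eq_C_mul, map_smul, smul_eq_mul, Mesh.ref,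
        ← toRef_mul, ← hcell, polyInt_apply]
      simp only [eval_mul]
    rw [← h3, h2]
    refine sum_congr rfl fun j _ => ?_
    have h5 : toRef (M.left i) (M.len i) (M.interp c v i) = M.ref (M.wave c D 0 0) i := by
      rw [Mesh.ref, Mesh.wave, M.ref_interp hc, M.ref_interp hc]
      congr 1
      ext r
      rw [hv _ (M.pt_mem hc i _), sub_zero]
    rw [M.starVal_eq, M.integral_sub_interp hc hD hT hvt, M.damping_eq, h5]

theorem nodeNorm_neg (p : ℝ[X]) : nodeNorm c (-p) = nodeNorm c p := by
  simp only [nodeNorm, eval_neg, abs_neg]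

/-- The corrected error at the initial time. -/
theorem exists_initial_bound {κ K : ℝ} (hc : IsCVNodes m k c) (hk : 1 ≤ k) (hT : 0 ≤ T)
    (hD : IsProfile (a - T) b B (k + 2) D) (hK : IsCellBound c D (a - T) b K)
    (hcomp : IsCompatible bc k a b T g D) :
    ∃ R h₀, 0 < h₀ ∧ h₀ ≤ 1 ∧ ∀ (N : ℕ) [NeZero N] (M : Mesh a b N), M.ShapeRegular κ →
      M.h ≤ h₀ → ∀ (w ω : Fin N → ℝ[X]) (v vt : ℝ → ℝ),
      M.IsCorrection m bc c (inflowData T g 0) w v vt ω →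
      (∀ x ∈ Set.Icc a b, v x = D 0 x) → (∀ x ∈ Set.Icc a b, vt x = -D 1 x) →
      (∀ i, (w i).natDegree ≤ k) → (∀ i, w i = M.interp c v i - ω i) →
      ∀ i, nodeNorm c (M.corrErr bc c D 0 w i) ≤ R * M.h ^ (k + 2) := by
  obtain ⟨K₁, hK₁⟩ := exists_isFunctionalBound hc
  obtain ⟨C, hC, hω⟩ := exists_correction_bound (m := m) hk c
  set Q := K + (k + 1) * ((sigmaConst k κ K + (4 * k + 2)) * K)
  set Q' := (k + 1) * ((4 * k + 2) * (2 * κ ^ k * K₁ * 3) * K)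
  -- The threshold ensures C Q' h ≤ 1/2, so that the part of the right-hand side that depends on ω
  -- can be absorbed.
  refine ⟨2 * C * Q + corrConst k κ K, min 1 (1 / (2 * (C * |Q'| + 1))), by positivity,
    min_le_left _ _, fun N _ M hκ hh w ω v vt hcor hv hvt hw hwω => ?_⟩
  have hh1 : M.h ≤ 1 := hh.trans (min_le_left _ _)
  have hh0 := M.h_pos.le
  have hκ0 : 0 ≤ κ := zero_le_one.trans hκ.one_le
  have hK0 := hK.nonneg
  have hK10 := hK₁.nonneg
  have hs := sigmaConst_nonneg (k := k) hκ0 hK0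
  have hT0 : (0 : ℝ) ∈ Set.Icc 0 T := ⟨le_rfl, hT⟩
  have hH0 := pow_nonneg hh0 (k + 2)
  have hdiff : ∀ i, M.ref w i - M.ref (M.wave c D 0 0) i = -M.ref ω i := fun i => by
    have h5 : toRef (M.left i) (M.len i) (M.interp c v i) = M.ref (M.wave c D 0 0) i := by
      rw [Mesh.ref, Mesh.wave, M.ref_interp hc, M.ref_interp hc]
      congr 1
      ext r
      rw [hv _ (M.pt_mem hc i _), sub_zero]
    rw [Mesh.ref, hwω, toRef_sub, h5, Mesh.ref, Mesh.ref]
    ring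
  -- The coefficients σ_i couple ω on neighbouring cells, so the estimate is closed at the cell
  -- where ω is largest.
  obtain ⟨i₀, hi₀⟩ := Finite.exists_max fun i => nodeNorm c (M.ref ω i)
  set A := nodeNorm c (M.ref ω i₀)
  have hA0 : 0 ≤ A := nodeNorm_nonneg _
  have hX : ∀ i, ∀ j : Fin (k + 1), |-(D 0 (M.pt c i j.succ - 0) - D 0 (M.pt c i j.castSucc - 0)
          - M.len i * cvInt c j (M.ref (M.wave c D 1 0) i))
        + ∑ l ∈ range (k + 1), M.sigma k bc (inflowData T g 0) w l i *
          dampInt c l j (M.ref (M.wave c D 0 0) i)| ≤ Q * M.h ^ (k + 2) + Q' * M.h * A :=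
    fun i j => by
    have hl := (M.len_pos i).le
    have hlh := M.len_le_h i
    have h1 : |-(D 0 (M.pt c i j.succ - 0) - D 0 (M.pt c i j.castSucc - 0)
          - M.len i * cvInt c j (M.ref (M.wave c D 1 0) i))| ≤ K * M.h ^ (k + 2) := by
      rw [abs_neg, M.pt_sub, M.pt_sub, M.ref_wave hc]
      exact (hK.flux 0 (by omega) j _ _ hl (M.left_sub_mem i hT0) (M.right_sub_mem i hT0)).trans
        (mul_le_mul_of_nonneg_left (pow_le_pow_left₀ hl hlh _) hK0)
    have h2 : ∀ l ∈ range (k + 1), |M.sigma k bc (inflowData T g 0) w l i *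
        dampInt c l j (M.ref (M.wave c D 0 0) i)| ≤ (sigmaConst k κ K * M.h ^ (k + 1)
          + (4 * k + 2) * (2 * κ ^ k * K₁ * (3 * A) + M.h ^ (k + 2))) * (K * M.h) :=
      fun l hl' => by
      have hlk := Nat.lt_succ_iff.1 (mem_range.1 hl')
      have e1 := (M.waveSigma_bounds hκ hc hk hh1 hK hcomp.periodic hlk hT0 i).1
      have e2 := M.abs_sigma_sub_waveSigma_le hκ hc hk hK₁ hcomp hw hT0 hlk i
      have e3 : patch (fun i => nodeNorm c (M.ref w i - M.ref (M.wave c D 0 0) i)) i ≤ 3 * A := by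
        simp only [hdiff, nodeNorm_neg, patch]
        linarith [hi₀ (i - 1), hi₀ i, hi₀ (i + 1)]
      have e4 := abs_add_le (M.waveSigma bc c D 0 l i)
        (M.sigma k bc (inflowData T g 0) w l i - M.waveSigma bc c D 0 l i)
      rw [add_sub_cancel] at e4
      rw [abs_mul, M.ref_wave hc]
      refine mul_le_mul (e4.trans (add_le_add e1 (e2.trans ?_)))
        ((hK.damp 0 (by omega) l hlk j _ _ hl (M.left_sub_mem i hT0) (M.right_sub_mem i hT0)).trans
          (mul_le_mul_of_nonneg_left hlh hK0)) (abs_nonneg _) (by positivity)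
      refine mul_le_mul_of_nonneg_left (add_le_add_left ?_ _) (by positivity)
      exact mul_le_mul_of_nonneg_left e3 (by positivity)
    have h3 := (abs_sum_le_sum_abs _ _).trans (sum_le_sum h2)
    rw [sum_const, card_range, nsmul_eq_mul] at h3
    push_cast at h3
    refine (abs_add_le _ _).trans ((add_le_add h1 h3).trans ?_)
    have e : M.h ^ (k + 2) * M.h ≤ M.h ^ (k + 2) := mul_le_of_le_one_right hH0 hh1
    have e' := mul_le_mul_of_nonneg_left e
      (by positivity : 0 ≤ ((k : ℝ) + 1) * ((4 * k + 2) * K))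
    have e'' : M.h ^ (k + 2) = M.h ^ (k + 1) * M.h := pow_succ _ _
    calc K * M.h ^ (k + 2) + (k + 1) * ((sigmaConst k κ K * M.h ^ (k + 1)
          + (4 * k + 2) * (2 * κ ^ k * K₁ * (3 * A) + M.h ^ (k + 2))) * (K * M.h))
        = K * M.h ^ (k + 2) + (k + 1) * (sigmaConst k κ K * K) * (M.h ^ (k + 1) * M.h)
          + Q' * M.h * A + (k + 1) * ((4 * k + 2) * K) * (M.h ^ (k + 2) * M.h) := by ring
      _ ≤ K * M.h ^ (k + 2) + (k + 1) * (sigmaConst k κ K * K) * (M.h ^ (k + 1) * M.h)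
          + Q' * M.h * A + (k + 1) * ((4 * k + 2) * K) * M.h ^ (k + 2) := by linarith
      _ = _ := by rw [← e'']; ring
  have hA : A ≤ 2 * C * Q * M.h ^ (k + 2) := by
    obtain ⟨q1, q2, q3⟩ := hcor.ref_eq hc hD hT hv hvt i₀
    have h1 := hω _ _ _ q1 q2 (hX i₀) q3
    have h2 : M.h * (2 * (C * |Q'| + 1)) ≤ 1 := by
      rw [← le_div_iff₀ (by positivity)]
      exact hh.trans (min_le_right _ _)
    -- Absorption: half of A is moved to the left-hand side, which accounts for the factor 2 in the
    -- bound of A.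
    have h3 : C * (Q' * M.h * A) ≤ 1 / 2 * A := by
      have e1 : C * Q' ≤ C * |Q'| := mul_le_mul_of_nonneg_left (le_abs_self _) hC
      have e2 := mul_le_mul_of_nonneg_right e1 (mul_nonneg hh0 hA0)
      have e3 := mul_le_mul_of_nonneg_right h2 hA0
      have e4 := mul_nonneg hh0 hA0
      linarith
    linarith
  intro i
  have h1 := (M.waveCorr_bounds hκ hc hk hh1 hK hcomp.periodic hT0 i).1
  rw [Mesh.corrErr, hdiff]
  refine (nodeNorm_add_le _ _).trans ?_
  rw [nodeNorm_neg, add_mul]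
  exact add_le_add ((hi₀ i).trans hA) h1

/-! ### The error in the broken `L²` norm -/

/-- The error of the discrete solution in the `L²` norm, in terms of the corrected error. -/
theorem exists_l2norm_bound {κ K : ℝ} (hc : IsCVNodes m k c) (hk : 1 ≤ k) (hab : a ≤ b)
    (hK : IsCellBound c D (a - T) b K) (hcomp : IsCompatible bc k a b T g D) {R : ℝ} (hR : 0 ≤ R) :
    ∃ C, 0 < C ∧ ∀ (N : ℕ) [NeZero N] (M : Mesh a b N), M.ShapeRegular κ → M.h ≤ 1 →
      ∀ w : Fin N → ℝ[X], (∀ i, (w i).natDegree ≤ k) → ∀ t ∈ Set.Icc 0 T,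
      ∑ i, M.len i * nodeNorm c (M.corrErr bc c D t w i) ^ 2 ≤ R * (M.h ^ (k + 2)) ^ 2 →
      M.l2norm (fun i => M.wave c D 0 t i - w i) ≤ C * M.h ^ (k + 2) := by
  obtain ⟨K₂, hK₂, h2⟩ := exists_polyInt_sq_le hc
  have hba := sub_nonneg.2 hab
  -- From |ω̃ - e|² ≤ 2 (|ω̃|² + |e|²), with the cell lengths adding up to b - a; the added 1 only
  -- makes the constant positive.
  refine ⟨√(K₂ * (2 * (R + (b - a) * corrConst k κ K ^ 2))) + 1, by positivity,
    fun N _ M hκ hh w hw t ht hsum => ?_⟩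
  have hH0 := pow_nonneg M.h_pos.le (k + 2)
  have hle : ∀ i, polyInt 0 1 (M.ref (fun i => M.wave c D 0 t i - w i) i
      * M.ref (fun i => M.wave c D 0 t i - w i) i)
      ≤ K₂ * (2 * (nodeNorm c (M.corrErr bc c D t w i) ^ 2
        + (corrConst k κ K * M.h ^ (k + 2)) ^ 2)) := fun i => by
    have e : M.ref (fun i => M.wave c D 0 t i - w i) i
        = M.waveCorr bc c D t i - M.corrErr bc c D t w i := by
      rw [Mesh.corrErr, Mesh.ref, toRef_sub, Mesh.ref, Mesh.ref]
      ring
    have hd : (M.waveCorr bc c D t i - M.corrErr bc c D t w i).natDegree ≤ k :=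
      (natDegree_sub_le _ _).trans (max_le (natDegree_itp_le hc _)
        (M.natDegree_corrErr_le hc hw t i))
    rw [e]
    refine (h2 _ hd).trans (mul_le_mul_of_nonneg_left ?_ hK₂)
    have h3 := (M.waveCorr_bounds hκ hc hk hh hK hcomp.periodic ht i).1
    have h4 := (nodeNorm_sub_le (M.waveCorr bc c D t i) (M.corrErr bc c D t w i)).trans
      (add_le_add_left h3 _)
    refine (pow_le_pow_left₀ (nodeNorm_nonneg _) h4 2).trans ?_
    nlinarith [sq_nonneg (corrConst k κ K * M.h ^ (k + 2) - nodeNorm c (M.corrErr bc c D t w i))]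
  have hfin : ∑ i, M.len i * polyInt 0 1 (M.ref (fun i => M.wave c D 0 t i - w i) i
      * M.ref (fun i => M.wave c D 0 t i - w i) i)
      ≤ (√(K₂ * (2 * (R + (b - a) * corrConst k κ K ^ 2))) * M.h ^ (k + 2)) ^ 2 := by
    rw [mul_pow, Real.sq_sqrt (by positivity)]
    calc _ ≤ ∑ i, M.len i * (K₂ * (2 * (nodeNorm c (M.corrErr bc c D t w i) ^ 2
            + (corrConst k κ K * M.h ^ (k + 2)) ^ 2))) :=
          sum_le_sum fun i _ => mul_le_mul_of_nonneg_left (hle i) (M.len_pos i).le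
      _ = K₂ * (2 * (∑ i, M.len i * nodeNorm c (M.corrErr bc c D t w i) ^ 2
            + (∑ i, M.len i) * (corrConst k κ K * M.h ^ (k + 2)) ^ 2)) := by
          rw [sum_mul, ← sum_add_distrib, mul_sum, mul_sum]
          exact sum_congr rfl fun i _ => by ring
      _ ≤ K₂ * (2 * (R * (M.h ^ (k + 2)) ^ 2
            + (b - a) * (corrConst k κ K * M.h ^ (k + 2)) ^ 2)) := by
          rw [M.sum_len]
          gcongr
      _ = _ := by ring
  refine (M.l2norm_le (by positivity) hfin).trans ?_
  rw [add_mul]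
  linarith

end OFSV

/-! ### Proof of supercloseness -/

theorem theorem3p4 (m : OFSV.Method) (bc : OFSV.Boundary) (k : ℕ) (hk : 1 ≤ k)
    (hkLSV : m = OFSV.Method.LSV → 2 ≤ k)
    (c : Fin (k + 2) → ℝ) (hc : OFSV.IsCVNodes m k c)
    (a b T κ : ℝ) (hab : a < b) (hT : 0 < T)
    (u₀ g : ℝ → ℝ) (u : ℝ → ℝ → ℝ) (hu : OFSV.IsSolution bc a b T u₀ g u)
    (hreg : ∃ B : ℝ, ∀ t ∈ Set.Icc 0 T, OFSV.SobolevBound a b (k + 3) B (fun x => u x t)) :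
    ∃ C h₀ : ℝ, 0 < C ∧ 0 < h₀ ∧
      ∀ (N : ℕ) [NeZero N] (M : OFSV.Mesh a b N), M.ShapeRegular κ → M.h ≤ h₀ →
        ∀ uh : ℝ → Fin N → Polynomial ℝ, M.IsSchemeSolution bc c T g uh →
        ∀ ω : Fin N → Polynomial ℝ,
          M.IsCorrection m bc c (OFSV.inflowData T g 0) (uh 0) u₀
            (fun x => derivWithin (fun s => u x s) (Set.Icc 0 T) 0) ω →
          (∀ i, uh 0 i = M.interp c u₀ i - ω i) →
          ∀ t ∈ Set.Icc 0 T,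
            M.l2norm (fun i => M.interp c (fun x => u x t) i - uh t i) ≤ C * M.h ^ (k + 2) := by
  -- One of the k + 3 weak derivatives is spent on Lipschitz continuity: the profile has k + 2
  -- classical derivatives.
  obtain ⟨B, D, hD, huD⟩ := hu.exists_profile (m := k + 2) hab hT (by omega) hreg
  have hcomp := hu.isCompatible hab.le hT hD huD
  obtain ⟨K, hK⟩ := hD.exists_isCellBound hc hk hkLSV
  obtain ⟨R, h₀, hh₀, hh₀', hinit⟩ :=
    OFSV.exists_initial_bound (κ := κ) hc hk hT.le hD hK hcomp
  obtain ⟨C₁, hC₁, hstab⟩ := OFSV.exists_corrErr_bound (κ := κ) hc hk hab.le hD hK hcomp R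
  obtain ⟨C, hC, hfin⟩ := OFSV.exists_l2norm_bound (κ := κ) hc hk hab.le hK hcomp hC₁
  refine ⟨C, h₀, hC, hh₀, fun N _ M hκ hh uh hs ω hω hω0 t ht => ?_⟩
  have h0 : (0 : ℝ) ∈ Set.Icc 0 T := ⟨le_rfl, hT.le⟩
  have hv : ∀ x ∈ Set.Icc a b, u₀ x = D 0 x := fun x hx => by
    rw [← hu.initial x hx, huD x hx 0 h0, sub_zero]
  have hvt : ∀ x ∈ Set.Icc a b, derivWithin (fun s => u x s) (Set.Icc 0 T) 0 = -D 1 x :=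
    fun x hx => by
      have h1 := (hD.hasDerivWithinAt_time (n := 0) (by omega) hx h0).congr
        (fun s hs => huD x hx s hs) (huD x hx 0 h0)
      rw [h1.derivWithin (uniqueDiffOn_Icc hT 0 h0), sub_zero]
  have h1 := hinit N M hκ hh (uh 0) ω _ _ hω hv hvt (hs.degree 0 h0) hω0
  have h2 := hfin N M hκ (hh.trans hh₀') (uh t) (hs.degree t ht) t ht
    (hstab N M hκ (hh.trans hh₀') uh hs h1 t ht)
  have h3 : ∀ i, M.interp c (fun x => u x t) i = M.wave c D 0 t i := fun i => by
    rw [OFSV.Mesh.wave, OFSV.Mesh.interp, OFSV.Mesh.interp]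
    congr 1
    ext j
    exact huD _ (M.pt_mem hc i _) t ht
  simp only [h3]
  exact h2
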